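/- Fix a field $k$. A \emph{pseudo-tensor category} is an essentially small $k$-linear additive monoidal category (tensor product $k$-bilinear on morphisms) in which idempotents split, every object has a left and a right dual, and $\mathrm{End}(\mathbf 1)$ is one-dimensional over $k$; it is a \emph{tensor category} if it is moreover abelian. Morphisms between ($k$-linear, strong) monoidal functors are the monoidal natural transformations. A \emph{monoidal abelian envelope} of a pseudo-tensor category $\mathcal C$ is a pair $(\mathcal T,F)$ of a tensor category $\mathcal T$ and a fully faithful $k$-linear monoidal functor $F\colon\mathcal C\to\mathcal T$ such that for every tensor category $\mathcal T'$, composition with $F$ is an equivalence from the category of exact $k$-linear monoidal functors $\mathcal T\to\mathcal T'$ to the category of faithful $k$-linear monoidal functors $\mathcal C\to\mathcal T'$. A morphism $f$ is \emph{split} if $f=fgf$ for some morphism $g$. A (possibly zero) object $S$ of $\mathcal C$ is a \emph{global splitting object} if $S\otimes f$ and $f\otimes S$ are split for all morphisms $f$ of $\mathcal C$; let $\mathcal S\subseteq\mathcal C$ be the full subcategory of these objects. Let $\mathcal U(\mathcal C)$ be the collection of all non-zero morphisms $u\colon U\to\mathbf 1$, $U\in\mathcal C$, and let $\mathcal U^{ex}(\mathcal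 C)$ be the collection of those $u\in\mathcal U(\mathcal C)$ that are a coequalizer of $u\otimes U,\ U\otimes u\colon U\otimes U\to U$. Let $\mathrm{mod}\text{-}\mathcal S$ be the category of finitely presented functors, i.e. of those functors $M\colon\mathcal S^{op}\to\mathrm{Ab}$ for which there are a morphism $\alpha\colon Y\to X$ in $\mathcal S$ and a pointwise exact sequence $\mathcal S(-,Y)\xrightarrow{\alpha\circ-}\mathcal S(-,X)\to M\to0$, with natural transformations as morphisms. \textbf{Theorem.} For a pseudo-tensor category $\mathcal C$ over $k$ the following are equivalent: (a) $\mathcal C$ has a monoidal abelian envelope with enough projectives; (b) there is a cokernel sequence $S\to T\to\mathbf 1\to0$ in $\mathcal C$ with $S,T\in\mathcal S$; (c) $\mathcal C$ has a non-zero global splitting object, and $\mathcal U(\mathcal C)=\mathcal U^{ex}(\mathcal C)$. In this case, $\mathcal C(-,A)|_{\mathcal S}$ is finitely presented for every $A\in\mathcal C$, and the category $\mathrm{mod}\text{-}\mathcal S$, with its natural $k$-linear structure and a suitable monoidal structure, together with the functor $A\mapsto\mathcal C(-,A)|_{\mathcal S}$, suitably equipped with a monoidal structure, is a monoidal abelian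 envelope of $\mathcal C$, and it has enough projectives. -/

import Mathlib

open CategoryTheory CategoryTheory.Limits MonoidalCategory Opposite

universe w t u v u₁ v₁ u₂ v₂ u₃ v₃

namespace AbEnv

/-! ### Pseudo-tensor categories and tensor categories -/

section TensorCategories

variable (k : Type t) [Field k] (C : Type u) [Category.{v} C] [Preadditive C] [Linear k C]
  [MonoidalCategory C]

/-- A `k`-linear monoidal category `C` is a *pseudo-tensor category* if it is additive, idempotent
complete, rigid, essentially small (with respect to the universe `w`), with a one-dimensional
endomorphism algebra of the unit. The tensor product is `k`-bilinear on morphisms. -/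
class IsPseudoTensorCategory : Prop where
  [monoidalPreadditive : MonoidalPreadditive C]
  [monoidalLinear : MonoidalLinear k C]
  [hasFiniteBiproducts : HasFiniteBiproducts C]
  [isIdempotentComplete : IsIdempotentComplete C]
  [essentiallySmall : EssentiallySmall.{w} C]
  nonempty_hasLeftDual : ∀ X : C, Nonempty (HasLeftDual X)
  nonempty_hasRightDual : ∀ X : C, Nonempty (HasRightDual X)
  finrank_end_unit : Module.finrank k (𝟙_ C ⟶ 𝟙_ C) = 1

/-- A *tensor category* is a pseudo-tensor category which is abelian (i.e., which moreover has
kernels and cokernels, and whose monomorphisms and epimorphisms are normal). -/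
class IsTensorCategory : Prop extends IsPseudoTensorCategory.{w} k C where
  [hasKernels : HasKernels C]
  [hasCokernels : HasCokernels C]
  [isNormalMonoCategory : IsNormalMonoCategory C]
  [isNormalEpiCategory : IsNormalEpiCategory C]

end TensorCategories

/-! ### Categories of linear monoidal functors -/

/-- A `k`-linear (strong) monoidal functor. -/
structure TensorFunctor (k : Type t) [Field k]
    (C : Type u₁) [Category.{v₁} C] [Preadditive C] [Linear k C] [MonoidalCategory C]
    (D : Type u₂) [Category.{v₂} D] [Preadditive D] [Linear k D] [MonoidalCategory D] where
  /-- the underlying functor -/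
  toFunctor : C ⥤ D
  /-- the monoidal structure -/
  [monoidal : toFunctor.Monoidal]
  [additive : toFunctor.Additive]
  [linear : toFunctor.Linear k]

namespace TensorFunctor

attribute [instance] monoidal additive linear

variable {k : Type t} [Field k]
  {C : Type u₁} [Category.{v₁} C] [Preadditive C] [Linear k C] [MonoidalCategory C]
  {D : Type u₂} [Category.{v₂} D] [Preadditive D] [Linear k D] [MonoidalCategory D]
  {E : Type u₃} [Category.{v₃} E] [Preadditive E] [Linear k E] [MonoidalCategory E]

/-- Morphisms of `k`-linear monoidal functors: monoidal natural transformations. -/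
@[ext]
structure Hom (F G : TensorFunctor k C D) where
  /-- the underlying natural transformation -/
  hom : F.toFunctor ⟶ G.toFunctor
  isMonoidal : NatTrans.IsMonoidal hom

attribute [instance] Hom.isMonoidal

instance : Category (TensorFunctor k C D) where
  Hom := Hom
  id F := ⟨𝟙 F.toFunctor, inferInstance⟩
  comp α β := ⟨α.hom ≫ β.hom, inferInstance⟩

/-- The composition of `k`-linear monoidal functors. -/
def comp (F : TensorFunctor k C D) (G : TensorFunctor k D E) : TensorFunctor k C E where
  toFunctor := F.toFunctor ⋙ G.toFunctor

/-- Precomposition with `F`, as a functor between categories of `k`-linear monoidal functors. -/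
def precomp (F : TensorFunctor k C D) : TensorFunctor k D E ⥤ TensorFunctor k C E where
  obj G := F.comp G
  map α := ⟨Functor.whiskerLeft F.toFunctor α.hom,
    NatTrans.IsMonoidal.whiskerLeft (F₁ := F.toFunctor) α.hom⟩

variable (k C D)

/-- The faithful functors among the `k`-linear monoidal functors. -/
def faithful : ObjectProperty (TensorFunctor k C D) :=
  fun F => F.toFunctor.Faithful

/-- The exact functors among the `k`-linear monoidal functors. -/
def exact : ObjectProperty (TensorFunctor k C D) :=
  fun F => PreservesFiniteLimits F.toFunctor ∧ PreservesFiniteColimits F.toFunctor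

end TensorFunctor

/-! ### Monoidal abelian envelopes -/

/-- `(T, F)` is a *monoidal abelian envelope* of the pseudo-tensor category `D`: `T` is a tensor
category, `F : D ⥤ T` is a fully faithful `k`-linear monoidal functor and, for every tensor
category `T'`, precomposition with `F` sends exact linear monoidal functors `T ⥤ T'` to faithful
linear monoidal functors `D ⥤ T'` and defines an equivalence between these two categories.
The categories `T'` live in the universes of `T`. -/
structure IsMonoidalAbelianEnvelope {k : Type t} [Field k]
    {D : Type u₁} [Category.{v₁} D] [Preadditive D] [Linear k D] [MonoidalCategory D]
    {T : Type u₂} [Category.{v₂} T] [Preadditive T] [Linear k T] [MonoidalCategory T]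
    (F : TensorFunctor k D T) : Prop where
  isTensorCategory : IsTensorCategory.{w} k T
  full : F.toFunctor.Full
  faithful : F.toFunctor.Faithful
  universal : ∀ (T' : Type u₂) [Category.{v₂} T'] [Preadditive T'] [Linear k T']
    [MonoidalCategory T'] [IsTensorCategory.{w} k T'],
    ∃ h : ∀ G : (TensorFunctor.exact k T T').FullSubcategory,
        TensorFunctor.faithful k D T'
          (((TensorFunctor.exact k T T').ι ⋙ F.precomp).obj G),
      ((TensorFunctor.faithful k D T').lift
        ((TensorFunctor.exact k T T').ι ⋙ F.precomp) h).IsEquivalence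

/-! ### Splitting objects and the exactness condition -/

section Splitting

variable {C : Type u} [Category.{v} C]

/-- A morphism `f` is *split* if `f = f g f` for some morphism `g`. -/
def IsSplit {X Y : C} (f : X ⟶ Y) : Prop :=
  ∃ g : Y ⟶ X, f ≫ g ≫ f = f

variable (C) [MonoidalCategory C]

/-- The *global splitting objects*: those objects `S` for which `S ⊗ f` and `f ⊗ S` are split,
for all morphisms `f`. (Zero objects are allowed.) -/
def globalSplitting : ObjectProperty C :=
  fun S => ∀ ⦃X Y : C⦄ (f : X ⟶ Y), IsSplit (S ◁ f) ∧ IsSplit (f ▷ S)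

/-- The unit has a presentation by global splitting objects: there is a cokernel sequence
`S ⟶ T ⟶ 𝟙 ⟶ 0` with `S` and `T` global splitting objects. -/
def UnitHasSplittingPresentation [Preadditive C] : Prop :=
  ∃ (S T : C) (f : S ⟶ T) (g : T ⟶ 𝟙_ C) (zero : f ≫ g = 0),
    globalSplitting C S ∧ globalSplitting C T ∧ Nonempty (IsColimit (CokernelCofork.ofπ g zero))

/-- The collection `𝒰(C)` of all nonzero morphisms `u : U ⟶ 𝟙`. -/
def morU [Preadditive C] : Set (Σ U : C, U ⟶ 𝟙_ C) :=
  {p | p.2 ≠ 0}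

/-- The collection `𝒰ᵉˣ(C)` of those `u : U ⟶ 𝟙` in `𝒰(C)` which are a coequalizer of
`u ⊗ U` and `U ⊗ u : U ⊗ U ⟶ U`. -/
def morUex [Preadditive C] : Set (Σ U : C, U ⟶ 𝟙_ C) :=
  {p | p ∈ morU C ∧ ∃ h : (p.2 ▷ p.1 ≫ (λ_ p.1).hom) ≫ p.2 = (p.1 ◁ p.2 ≫ (ρ_ p.1).hom) ≫ p.2,
    Nonempty (IsColimit (Cofork.ofπ p.2 h))}

end Splitting

/-! ### Finitely presented functors -/

section FinitelyPresented

variable (A : Type u) [Category.{v} A] [Preadditive A]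

/-- A functor `M : Aᵒᵖ ⥤ Ab` is *finitely presented* if there is a morphism `α : Y ⟶ X` in `A`
and an exact sequence of functors `A(-,Y) ⟶ A(-,X) ⟶ M ⟶ 0` (exactness is pointwise). -/
def finitelyPresented : ObjectProperty (Aᵒᵖ ⥤ AddCommGrpCat.{v}) :=
  fun M => ∃ (Y X : A) (α : Y ⟶ X) (π : preadditiveYoneda.obj X ⟶ M), ∀ Z : Aᵒᵖ,
    Function.Exact ((preadditiveYoneda.map α).app Z) (π.app Z) ∧ Function.Surjective (π.app Z)

/-- The category `mod-A` of finitely presented functors `Aᵒᵖ ⥤ Ab`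
and natural transformations. -/
abbrev ModCat : Type (max u (v + 1)) := (finitelyPresented A).FullSubcategory

variable {A}

theorem finitelyPresented.map_add {M : Aᵒᵖ ⥤ AddCommGrpCat.{v}} (hM : finitelyPresented A M)
    {Y Z : A} (f g : Y ⟶ Z) : M.map (f + g).op = M.map f.op + M.map g.op := by
  obtain ⟨_, X, _, π, h⟩ := hM
  ext x
  obtain ⟨y, rfl⟩ := (h (op Z)).2 x
  let y' : Z ⟶ X := y
  let φ : (Y ⟶ X) →+ M.obj (op Y) := (π.app (op Y)).hom
  have nat : ∀ e : Y ⟶ Z, M.map e.op (π.app (op Z) y) = φ (e ≫ y') :=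
    fun e => (ConcreteCategory.congr_hom (π.naturality e.op) y).symm
  have e : φ ((f + g) ≫ y') = φ (f ≫ y') + φ (g ≫ y') := by
    rw [Preadditive.add_comp, _root_.map_add]
  rw [← nat, ← nat, ← nat] at e
  exact e

variable {k : Type t} [Field k] [Linear k A]

/-- The action of a scalar `r` on a functor `M : Aᵒᵖ ⥤ Ab` on a `k`-linear category: on `M(X)`
it is given by `M(r • id_X)`. -/
def scalar (k : Type t) [Field k] [Linear k A] (r : k) (M : Aᵒᵖ ⥤ AddCommGrpCat.{v}) : M ⟶ M where
  app X := M.map (r • 𝟙 X.unop).op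
  naturality X Y f := by
    rw [← M.map_comp, ← M.map_comp]
    congr 1
    apply Quiver.Hom.unop_inj
    simp

theorem scalar_naturality (r : k) {M N : Aᵒᵖ ⥤ AddCommGrpCat.{v}} (η : M ⟶ N) :
    scalar k r M ≫ η = η ≫ scalar k r N := by
  ext X : 2
  exact η.naturality _

theorem scalar_one (M : Aᵒᵖ ⥤ AddCommGrpCat.{v}) : scalar k 1 M = 𝟙 M := by
  ext X : 2
  simp [scalar]

theorem scalar_mul (r s : k) (M : Aᵒᵖ ⥤ AddCommGrpCat.{v}) :
    scalar k (r * s) M = scalar k r M ≫ scalar k s M := by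
  ext X : 2
  simp only [scalar, NatTrans.comp_app]
  rw [← M.map_comp, ← op_comp]
  simp [smul_smul]

theorem scalar_add (r s : k) {M : Aᵒᵖ ⥤ AddCommGrpCat.{v}} (hM : finitelyPresented A M) :
    scalar k (r + s) M = scalar k r M + scalar k s M := by
  ext X : 2
  simp only [scalar, add_smul, hM.map_add]
  rfl

/-- The `k`-linear structure on `mod-A`, for a `k`-linear category `A`. -/
instance : Linear k (ModCat A) where
  homModule M N :=
    { smul := fun r η => ObjectProperty.homMk (scalar k r M.obj ≫ η.hom)
      one_smul := fun η => by
        ext1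
        change scalar k 1 M.obj ≫ η.hom = η.hom
        rw [scalar_one, Category.id_comp]
      mul_smul := fun r s η => by
        ext1
        change scalar k (r * s) M.obj ≫ η.hom = scalar k r M.obj ≫ scalar k s M.obj ≫ η.hom
        rw [scalar_mul, Category.assoc]
      smul_zero := fun r => by
        ext1
        exact comp_zero
      smul_add := fun r η θ => by
        ext1
        exact Preadditive.comp_add _ _ _ _ _ _
      add_smul := fun r s η => by
        ext1
        change scalar k (r + s) M.obj ≫ η.hom =
          scalar k r M.obj ≫ η.hom + scalar k s M.obj ≫ η.hom
        rw [scalar_add r s M.property, Preadditive.add_comp]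
      zero_smul := fun η => by
        have h : scalar k (0 : k) M.obj = 0 := by
          have := scalar_add (0 : k) 0 M.property
          rwa [add_zero, left_eq_add] at this
        ext1
        change scalar k 0 M.obj ≫ η.hom = 0
        rw [h, zero_comp] }
  smul_comp M N P r η θ := by
    ext1
    exact Category.assoc _ _ _
  comp_smul M N P η r θ := by
    ext1
    change η.hom ≫ scalar k r N.obj ≫ θ.hom = scalar k r M.obj ≫ η.hom ≫ θ.hom
    rw [← Category.assoc, ← scalar_naturality, Category.assoc]

end FinitelyPresented

/-- The functor `C ⥤ (𝒮ᵒᵖ ⥤ Ab)`, `A ↦ C(-, A)|_𝒮`, for a full subcategory `𝒮` of `C`. -/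
noncomputable def restrictedYoneda {C : Type u} [Category.{v} C] [Preadditive C]
    (P : ObjectProperty C) : C ⥤ (P.FullSubcategoryᵒᵖ ⥤ AddCommGrpCat.{v}) :=
  preadditiveYoneda ⋙ (Functor.whiskeringLeft _ _ _).obj P.ι.op

end AbEnv

/-!
Write `𝒮` for the full subcategory of global splitting objects of a pseudo-tensor category `C`.

**From a presentation of the unit to the envelope.** Objects of `𝒮` behave like projective objects
of `C`: tensoring a cokernel sequence with a dual of `Z ∈ 𝒮` makes it split exact, so `C(Z, -)` is
exact on cokernel sequences (`globalSplitting.hom_exact`). Given a presentation `S ⟶ T ⟶ 𝟙 ⟶ 0`,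
tensoring with `A` presents every `A ∈ C` by objects of `𝒮`, and the kernels of the split morphisms
`T ⊗ f` give weak kernels in `𝒮` (`exists_weakKernel`). Hence `mod-𝒮` is abelian
(`abelianModCat`) and `A ↦ C(-, A)|_𝒮` is a fully faithful functor `Y` to it which sends `𝒮` to
projective objects, of which every object is a quotient. From here on only these properties of `Y`,
named `IsProjectiveRealization`, are used.

The monoidal structure on the target `T` of `Y` is obtained by localization instead of by a choice
of presentations. The category `B` of reflexive pairs in `C` is monoidal for the pointwise tensor
product, and sending a pair to the coequalizer of its image under `Y` defines a functor `B ⥤ T`.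
This is a localization functor (`isLocalization_reflCoeq`): pairs of objects of `𝒮` are cofibrant,
morphisms out of them lift, and a morphism which becomes zero factors through a pair with zero
coequalizer. The morphisms which become invertible are stable under tensoring
(`reflW_isMonoidal`), because the coequalizer of `R ⊗ N` can be computed one variable at a time
(`isCoker_of_diagonal`) and because `A ⊗ -` has an adjoint preserving `𝒮`. So the
localization inherits a monoidal structure for which `Y`, viewed as constant pairs followed by the
coequalizer, is monoidal.

For `S ∈ 𝒮`, all objects `M ⊗ Y(S)` are projective (`projective_tensor_map`), so exact sequences
split after tensoring with `Y(S)`; choosing `S` with an epimorphism to `𝟙`, for which `- ⊗ Y(S)` is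
faithful, one sees that a functor compatible with `- ⊗ Y(S)` is exact (`exact_of_projective`). In
particular the tensor product of `T` is exact, and the kernel of the dual of a morphism is a dual of
its cokernel, so `T` is rigid.

A faithful tensor functor `F : C ⥤ T'` sends an epimorphism `S ⟶ 𝟙` to a nonzero morphism, which is
an epimorphism as the unit of `T'` is simple (`isIso_of_mono_unit`). Coequalizers of reflexive pairs
after `F` form a monoidal functor `B ⥤ T'`, since the tensor product of `T'` is right exact, and it
inverts what `Y` inverts, since after tensoring with `S` all pairs have split coequalizers in `C`
(`reflW_isInvertedBy`). It thus factors through `T`, and the extension is exact by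
`exact_of_projective`. Natural transformations extend along presentations by objects of `𝒮`, and
exact tensor functors are faithful (`faithful_of_exact`).

**From an envelope with enough projectives to a presentation of the unit.** The subquotients of the
objects `F(A)` form a tensor subcategory of `T`; by the universal property of `F` the identity of
`T` factors over it up to isomorphism, so every object of `T` is such a subquotient
(`subquotient_of_envelope`). A projective object of a rigid abelian category is a global splitting
object, and it is injective (`exists_retraction_of_projective`). So a projective object is a direct
summand of some `F(A)`, i.e., it is `F(S)` with `S ∈ 𝒮`, and a projective presentation of the unit
of `T` comes from `C`.

**The exactness condition.** In a tensor category, a nonzero `u : U ⟶ 𝟙` is an epimorphism, and an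
epimorphism `u` is the coequalizer of `u ⊗ U` and `U ⊗ u`; this is reflected by the fully faithful
functor from `C` to its envelope (`morU_eq_morUex`). Conversely, for `S ∈ 𝒮` nonzero, the evaluation
`S* ⊗ S ⟶ 𝟙` is nonzero, and the exactness condition for it is a presentation of the unit by objects
of `𝒮` (`unitHasSplittingPresentation`).
-/

namespace AbEnv

set_option linter.unusedSectionVars false

/-! ### Cokernels and split exactness -/

section Coker

variable {C : Type u₁} [Category.{v₁} C] [Preadditive C]
  {D : Type u₂} [Category.{v₂} D] [Preadditive D]

/-- `g` is a cokernel of `f`, as a proposition: uniqueness of factorizations is expressed by `g`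
being an epimorphism. -/
structure IsCoker {X Y Z : C} (f : X ⟶ Y) (g : Y ⟶ Z) : Prop where
  zero : f ≫ g = 0
  epi : Epi g
  exists_desc : ∀ {W : C} (t : Y ⟶ W), f ≫ t = 0 → ∃ s, g ≫ s = t

theorem isCoker_of_isColimit {X Y Z : C} {f : X ⟶ Y} {g : Y ⟶ Z} (w : f ≫ g = 0)
    (h : IsColimit (CokernelCofork.ofπ g w)) : IsCoker f g where
  zero := w
  epi := Cofork.IsColimit.epi h
  exists_desc t ht := ⟨_, (CokernelCofork.IsColimit.desc' h t ht).2⟩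

/-- A cokernel in the propositional sense gives a colimit cofork. -/
noncomputable def IsCoker.isColimit {X Y Z : C} {f : X ⟶ Y} {g : Y ⟶ Z} (h : IsCoker f g) :
    IsColimit (CokernelCofork.ofπ g h.zero) :=
  haveI := h.epi
  CokernelCofork.IsColimit.ofπ' g h.zero fun t ht =>
    ⟨(h.exists_desc t ht).choose, (h.exists_desc t ht).choose_spec⟩

theorem IsCoker.map {X Y Z : C} {f : X ⟶ Y} {g : Y ⟶ Z} (h : IsCoker f g) (F : C ⥤ D)
    [F.PreservesZeroMorphisms] [PreservesColimit (parallelPair f 0) F] :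
    IsCoker (F.map f) (F.map g) :=
  isCoker_of_isColimit (by rw [← F.map_comp, h.zero, F.map_zero])
    (CokernelCofork.mapIsColimit _ h.isColimit F)

theorem IsCoker.of_iso {X Y Z X' Y' Z' : C} {f : X ⟶ Y} {g : Y ⟶ Z} (h : IsCoker f g)
    {f' : X' ⟶ Y'} {g' : Y' ⟶ Z'} (a : X ≅ X') (b : Y ≅ Y') (c : Z ≅ Z')
    (hf : f ≫ b.hom = a.hom ≫ f') (hg : g ≫ c.hom = b.hom ≫ g') : IsCoker f' g' := by
  have hf' : f' = a.inv ≫ f ≫ b.hom := by rw [hf, a.inv_hom_id_assoc]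
  have hg' : g' = b.inv ≫ g ≫ c.hom := by rw [hg, b.inv_hom_id_assoc]
  have := h.epi
  subst hf' hg'
  refine ⟨by simp [reassoc_of% h.zero], inferInstance, fun t ht => ?_⟩
  obtain ⟨s, hs⟩ := h.exists_desc (b.hom ≫ t) (by
    rw [← cancel_epi a.inv]; simpa using ht)
  exact ⟨c.inv ≫ s, by simp [hs]⟩

theorem IsCoker.exists_iso {X Y Z Z' : C} {f : X ⟶ Y} {g : Y ⟶ Z} {g' : Y ⟶ Z'}
    (h : IsCoker f g) (h' : IsCoker f g') : ∃ e : Z ≅ Z', g ≫ e.hom = g' := by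
  obtain ⟨a, ha⟩ := h.exists_desc g' h'.zero
  obtain ⟨b, hb⟩ := h'.exists_desc g h.zero
  have := h.epi
  have := h'.epi
  exact ⟨⟨a, b, by rw [← cancel_epi g, reassoc_of% ha, hb, Category.comp_id],
    by rw [← cancel_epi g', reassoc_of% hb, ha, Category.comp_id]⟩, ha⟩

/-- The complex `X ⟶ Y ⟶ Z` is split exact at `Y`: the identity of `Y` is homotopic to zero. (The
last morphism is not required to be an epimorphism.) -/
def IsSplitExact {X Y Z : C} (f : X ⟶ Y) (g : Y ⟶ Z) : Prop :=
  f ≫ g = 0 ∧ ∃ (r : Y ⟶ X) (t : Z ⟶ Y), r ≫ f + g ≫ t = 𝟙 Y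

theorem IsSplitExact.map {X Y Z : C} {f : X ⟶ Y} {g : Y ⟶ Z} (h : IsSplitExact f g) (F : C ⥤ D)
    [F.Additive] : IsSplitExact (F.map f) (F.map g) := by
  obtain ⟨w, r, t, e⟩ := h
  exact ⟨by rw [← F.map_comp, w, F.map_zero], F.map r, F.map t, by
    rw [← F.map_comp, ← F.map_comp, ← F.map_add, e, F.map_id]⟩

theorem IsSplitExact.exact {X Y Z : C} {f : X ⟶ Y} {g : Y ⟶ Z} (h : IsSplitExact f g) {W : C}
    (y : W ⟶ Y) (hy : y ≫ g = 0) : ∃ x, x ≫ f = y := by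
  obtain ⟨_, r, t, e⟩ := h
  refine ⟨y ≫ r, ?_⟩
  have := congrArg (y ≫ ·) e
  simpa [reassoc_of% hy] using this

theorem IsSplitExact.isCoker {X Y Z : C} {f : X ⟶ Y} {g : Y ⟶ Z} (h : IsSplitExact f g)
    {s : Z ⟶ Y} (hs : s ≫ g = 𝟙 Z) : IsCoker f g := by
  have : IsSplitEpi g := ⟨⟨s, hs⟩⟩
  obtain ⟨w, r, t, e⟩ := h
  refine ⟨w, inferInstance, fun y hy => ⟨t ≫ y, ?_⟩⟩
  have := congrArg (· ≫ y) e
  simpa [hy] using this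

/-- A cokernel of a split morphism is a split epimorphism, and the cokernel sequence is split
exact. -/
theorem IsCoker.isSplitExact {X Y Z : C} {f : X ⟶ Y} {g : Y ⟶ Z} (h : IsCoker f g)
    (hf : IsSplit f) : IsSplitExact f g ∧ ∃ s, s ≫ g = 𝟙 Z := by
  obtain ⟨r, hr⟩ := hf
  obtain ⟨t, ht⟩ := h.exists_desc (𝟙 Y - r ≫ f) (by simp [hr])
  have := h.epi
  refine ⟨⟨h.zero, r, t, by simp [ht]⟩, t, ?_⟩
  rw [← cancel_epi g, reassoc_of% ht]
  simp [h.zero]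

/-- In an idempotent complete category a split morphism has a split exact cokernel. -/
theorem IsSplit.exists_isCoker [IsIdempotentComplete C] {X Y : C} {f : X ⟶ Y} (h : IsSplit f) :
    ∃ (Z : C) (g : Y ⟶ Z) (s : Z ⟶ Y), IsCoker f g ∧ s ≫ g = 𝟙 Z := by
  obtain ⟨r, hr⟩ := h
  obtain ⟨Z, i, p, hip, hpi⟩ := IsIdempotentComplete.idempotents_split Y (𝟙 Y - r ≫ f)
    (by simp [hr])
  have : IsSplitEpi p := ⟨⟨i, hip⟩⟩
  have hz : f ≫ p = 0 := by
    have e : p ≫ i ≫ p = p := by rw [hip, Category.comp_id]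
    rw [← e, reassoc_of% hpi]
    simp [reassoc_of% hr]
  refine ⟨Z, p, i, ⟨hz, inferInstance, fun t ht => ⟨i ≫ t, ?_⟩⟩, hip⟩
  rw [← Category.assoc, hpi]
  simp [ht]

/-- In an idempotent complete category a split morphism has a split kernel. -/
theorem IsSplit.exists_kernel [IsIdempotentComplete C] {X Y : C} {f : X ⟶ Y} (h : IsSplit f) :
    ∃ (K : C) (i : K ⟶ X) (p : X ⟶ K), i ≫ p = 𝟙 K ∧ i ≫ f = 0 ∧
      ∀ {Z : C} (z : Z ⟶ X), z ≫ f = 0 → (z ≫ p) ≫ i = z := by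
  obtain ⟨r, hr⟩ := h
  obtain ⟨K, i, p, hip, hpi⟩ := IsIdempotentComplete.idempotents_split X (𝟙 X - f ≫ r)
    (by simp [reassoc_of% hr])
  refine ⟨K, i, p, hip, ?_, fun z hz => ?_⟩
  · have e : i ≫ p ≫ i = i := by rw [← Category.assoc, hip, Category.id_comp]
    rw [← e, hpi]
    simp [hr]
  · rw [Category.assoc, hpi]
    simp [reassoc_of% hz]

end Coker

theorem isCoker_kernel_ι {T : Type u} [Category.{v} T] [Abelian T] {X Y : T} (f : X ⟶ Y) [Epi f] :
    IsCoker (kernel.ι f) f :=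
  ⟨kernel.condition f, inferInstance, fun t ht => ⟨_, (CokernelCofork.IsColimit.desc'
    (Abelian.epiIsCokernelOfKernel _ (kernelIsKernel f)) t ht).2⟩⟩

/-! ### Duals -/

/-- Every object of the monoidal category `C` has a left and a right dual. -/
class HasDuals (C : Type u) [Category.{v} C] [MonoidalCategory C] : Prop where
  exists_right : ∀ X : C, ∃ Y : C, Nonempty (ExactPairing X Y)
  exists_left : ∀ X : C, ∃ Y : C, Nonempty (ExactPairing Y X)

section Duals

variable {C : Type u} [Category.{v} C] [MonoidalCategory C]

theorem exists_tensorLeft_adj [HasDuals C] (X : C) :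
    ∃ Y : C, Nonempty (tensorLeft X ⊣ tensorLeft Y) := by
  obtain ⟨Y, ⟨h⟩⟩ := HasDuals.exists_left X
  exact ⟨Y, ⟨tensorLeftAdjunction Y X⟩⟩

theorem exists_tensorLeft_adj' [HasDuals C] (X : C) :
    ∃ Y : C, Nonempty (tensorLeft Y ⊣ tensorLeft X) := by
  obtain ⟨Y, ⟨h⟩⟩ := HasDuals.exists_right X
  exact ⟨Y, ⟨tensorLeftAdjunction X Y⟩⟩

theorem exists_tensorRight_adj [HasDuals C] (X : C) :
    ∃ Y : C, Nonempty (tensorRight X ⊣ tensorRight Y) := by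
  obtain ⟨Y, ⟨h⟩⟩ := HasDuals.exists_right X
  exact ⟨Y, ⟨tensorRightAdjunction X Y⟩⟩

theorem exists_tensorRight_adj' [HasDuals C] (X : C) :
    ∃ Y : C, Nonempty (tensorRight Y ⊣ tensorRight X) := by
  obtain ⟨Y, ⟨h⟩⟩ := HasDuals.exists_left X
  exact ⟨Y, ⟨tensorRightAdjunction Y X⟩⟩

instance [HasDuals C] (X : C) : PreservesFiniteColimits (tensorLeft X) := by
  obtain ⟨Y, ⟨adj⟩⟩ := exists_tensorLeft_adj X
  have : PreservesColimitsOfSize.{0, 0} (tensorLeft X) := adj.leftAdjoint_preservesColimits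
  infer_instance

instance [HasDuals C] (X : C) : PreservesFiniteLimits (tensorLeft X) := by
  obtain ⟨Y, ⟨adj⟩⟩ := exists_tensorLeft_adj' X
  have : PreservesLimitsOfSize.{0, 0} (tensorLeft X) := adj.rightAdjoint_preservesLimits
  infer_instance

instance [HasDuals C] (X : C) : PreservesFiniteColimits (tensorRight X) := by
  obtain ⟨Y, ⟨adj⟩⟩ := exists_tensorRight_adj X
  have : PreservesColimitsOfSize.{0, 0} (tensorRight X) := adj.leftAdjoint_preservesColimits
  infer_instance

instance [HasDuals C] (X : C) : PreservesFiniteLimits (tensorRight X) := by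
  obtain ⟨Y, ⟨adj⟩⟩ := exists_tensorRight_adj' X
  have : PreservesLimitsOfSize.{0, 0} (tensorRight X) := adj.rightAdjoint_preservesLimits
  infer_instance

theorem epi_whiskerLeft [HasDuals C] (X : C) {A B : C} (f : A ⟶ B) [Epi f] : Epi (X ◁ f) :=
  inferInstanceAs (Epi ((tensorLeft X).map f))

theorem mono_whiskerLeft [HasDuals C] (X : C) {A B : C} (f : A ⟶ B) [Mono f] : Mono (X ◁ f) :=
  inferInstanceAs (Mono ((tensorLeft X).map f))

theorem epi_whiskerRight [HasDuals C] (X : C) {A B : C} (f : A ⟶ B) [Epi f] : Epi (f ▷ X) :=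
  inferInstanceAs (Epi ((tensorRight X).map f))

theorem mono_whiskerRight [HasDuals C] (X : C) {A B : C} (f : A ⟶ B) [Mono f] : Mono (f ▷ X) :=
  inferInstanceAs (Mono ((tensorRight X).map f))

theorem IsCoker.whiskerLeft [HasDuals C] [Preadditive C] [MonoidalPreadditive C] {X Y Z : C}
    {f : X ⟶ Y} {g : Y ⟶ Z} (h : IsCoker f g) (A : C) : IsCoker (A ◁ f) (A ◁ g) :=
  h.map (tensorLeft A)

theorem IsCoker.whiskerRight [HasDuals C] [Preadditive C] [MonoidalPreadditive C] {X Y Z : C}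
    {f : X ⟶ Y} {g : Y ⟶ Z} (h : IsCoker f g) (A : C) : IsCoker (f ▷ A) (g ▷ A) :=
  h.map (tensorRight A)

end Duals

theorem hasDuals_of_isPseudoTensorCategory (k : Type t) [Field k] (C : Type u) [Category.{v} C]
    [Preadditive C] [Linear k C] [MonoidalCategory C] [h : IsPseudoTensorCategory.{w} k C] :
    HasDuals C where
  exists_right X := by
    obtain ⟨h⟩ := h.nonempty_hasRightDual X
    exact ⟨h.rightDual, ⟨h.exact⟩⟩
  exists_left X := by
    obtain ⟨h⟩ := h.nonempty_hasLeftDual X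
    exact ⟨h.leftDual, ⟨h.exact⟩⟩

/-! ### The ideal of global splitting objects -/

section GlobalSplitting

variable {C : Type u} [Category.{v} C] [MonoidalCategory C]

/-- Global splitting objects are stable under retracts. -/
theorem globalSplitting.of_retract {P Q : C} (hQ : globalSplitting C Q) (i : P ⟶ Q) (r : Q ⟶ P)
    (h : i ≫ r = 𝟙 P) : globalSplitting C P := by
  intro X Y f
  obtain ⟨⟨a, ha⟩, b, hb⟩ := hQ f
  refine ⟨⟨i ▷ Y ≫ a ≫ r ▷ X, ?_⟩, ?_⟩
  · calc P ◁ f ≫ (i ▷ Y ≫ a ≫ r ▷ X) ≫ P ◁ f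
        = i ▷ X ≫ (Q ◁ f ≫ a ≫ Q ◁ f) ≫ r ▷ Y := by
          simp only [Category.assoc, whisker_exchange_assoc, ← whisker_exchange]
      _ = P ◁ f := by rw [ha, whisker_exchange, ← comp_whiskerRight_assoc, h, id_whiskerRight,
          Category.id_comp]
  · exact ⟨Y ◁ i ≫ b ≫ X ◁ r, calc
      f ▷ P ≫ (Y ◁ i ≫ b ≫ X ◁ r) ≫ f ▷ P
        = X ◁ i ≫ (f ▷ Q ≫ b ≫ f ▷ Q) ≫ Y ◁ r := by
          simp only [Category.assoc, ← whisker_exchange_assoc, whisker_exchange]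
      _ = f ▷ P := by rw [hb, ← whisker_exchange, ← MonoidalCategory.whiskerLeft_comp_assoc, h,
          MonoidalCategory.whiskerLeft_id, Category.id_comp]⟩

theorem globalSplitting.of_iso {P Q : C} (hQ : globalSplitting C Q) (e : P ≅ Q) :
    globalSplitting C P :=
  hQ.of_retract e.hom e.inv e.hom_inv_id

theorem globalSplitting.tensor_left {S : C} (hS : globalSplitting C S) (X : C) :
    globalSplitting C (X ⊗ S) := by
  intro A B f
  constructor
  · obtain ⟨g, hg⟩ := (hS f).1
    exact ⟨(α_ _ _ _).hom ≫ X ◁ g ≫ (α_ _ _ _).inv, by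
      have := congrArg (X ◁ ·) hg
      simp only [MonoidalCategory.whiskerLeft_comp] at this
      simp [reassoc_of% this]⟩
  · obtain ⟨g, hg⟩ := (hS (f ▷ X)).2
    exact ⟨(α_ _ _ _).inv ≫ g ≫ (α_ _ _ _).hom, by simp [reassoc_of% hg]⟩

theorem globalSplitting.tensor_right {S : C} (hS : globalSplitting C S) (X : C) :
    globalSplitting C (S ⊗ X) := by
  intro A B f
  constructor
  · obtain ⟨g, hg⟩ := (hS (X ◁ f)).1
    exact ⟨(α_ _ _ _).hom ≫ g ≫ (α_ _ _ _).inv, by simp [reassoc_of% hg]⟩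
  · obtain ⟨g, hg⟩ := (hS f).2
    exact ⟨(α_ _ _ _).inv ≫ g ▷ X ≫ (α_ _ _ _).hom, by
      have := congrArg (· ▷ X) hg
      simp only [comp_whiskerRight] at this
      simp [reassoc_of% this]⟩

/-- `P` is a retract of `P ⊗ (Q ⊗ P)`, for a dual `Q` of `P`. -/
theorem globalSplitting.of_exactPairing_left {P Q : C} [ExactPairing P Q]
    (hQ : globalSplitting C Q) : globalSplitting C P :=
  (((hQ.tensor_right P).tensor_left P)).of_retract
    ((λ_ P).inv ≫ η_ P Q ▷ P ≫ (α_ _ _ _).hom) (P ◁ ε_ P Q ≫ (ρ_ P).hom) (by simp)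

variable [Preadditive C] [MonoidalPreadditive C]

theorem globalSplitting.of_sum {P Q R : C} (hP : globalSplitting C P) (hQ : globalSplitting C Q)
    (p : R ⟶ P) (i : P ⟶ R) (q : R ⟶ Q) (j : Q ⟶ R) (h : p ≫ i + q ≫ j = 𝟙 R) :
    globalSplitting C R := by
  intro X Y f
  obtain ⟨⟨a, ha⟩, b, hb⟩ := hP f
  obtain ⟨⟨c, hc⟩, d, hd⟩ := hQ f
  constructor
  · refine ⟨p ▷ Y ≫ a ≫ i ▷ X + q ▷ Y ≫ c ≫ j ▷ X, ?_⟩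
    have e1 : R ◁ f ≫ (p ▷ Y ≫ a ≫ i ▷ X) ≫ R ◁ f = p ▷ X ≫ i ▷ X ≫ R ◁ f := by
      simp only [Category.assoc, whisker_exchange_assoc, ← whisker_exchange, reassoc_of% ha]
    have e2 : R ◁ f ≫ (q ▷ Y ≫ c ≫ j ▷ X) ≫ R ◁ f = q ▷ X ≫ j ▷ X ≫ R ◁ f := by
      simp only [Category.assoc, whisker_exchange_assoc, ← whisker_exchange, reassoc_of% hc]
    rw [Preadditive.add_comp, Preadditive.comp_add, e1, e2, ← Category.assoc, ← Category.assoc,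
      ← Preadditive.add_comp, ← comp_whiskerRight, ← comp_whiskerRight,
      ← MonoidalPreadditive.add_whiskerRight, h, id_whiskerRight, Category.id_comp]
  · refine ⟨Y ◁ p ≫ b ≫ X ◁ i + Y ◁ q ≫ d ≫ X ◁ j, ?_⟩
    have e1 : f ▷ R ≫ (Y ◁ p ≫ b ≫ X ◁ i) ≫ f ▷ R = X ◁ p ≫ X ◁ i ≫ f ▷ R := by
      simp only [Category.assoc, ← whisker_exchange_assoc, whisker_exchange, reassoc_of% hb]
    have e2 : f ▷ R ≫ (Y ◁ q ≫ d ≫ X ◁ j) ≫ f ▷ R = X ◁ q ≫ X ◁ j ≫ f ▷ R := by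
      simp only [Category.assoc, ← whisker_exchange_assoc, whisker_exchange, reassoc_of% hd]
    rw [Preadditive.add_comp, Preadditive.comp_add, e1, e2, ← Category.assoc, ← Category.assoc,
      ← Preadditive.add_comp, ← MonoidalCategory.whiskerLeft_comp,
      ← MonoidalCategory.whiskerLeft_comp, ← MonoidalPreadditive.whiskerLeft_add, h,
      MonoidalCategory.whiskerLeft_id, Category.id_comp]

theorem globalSplitting.biprod [HasBinaryBiproducts C] {P Q : C} (hP : globalSplitting C P)
    (hQ : globalSplitting C Q) : globalSplitting C (P ⊞ Q) :=
  hP.of_sum hQ biprod.fst biprod.inl biprod.snd biprod.inr biprod.total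

theorem globalSplitting.of_isZero {Z : C} (hZ : IsZero Z) : globalSplitting C Z := by
  intro X Y f
  have h1 : Z ◁ f = 0 := by
    have : Z ◁ f = (𝟙 Z) ▷ X ≫ Z ◁ f := by simp
    rw [this, hZ.eq_of_src (𝟙 Z) 0]
    simp
  have h2 : f ▷ Z = 0 := by
    have : f ▷ Z = X ◁ (𝟙 Z) ≫ f ▷ Z := by simp
    rw [this, hZ.eq_of_src (𝟙 Z) 0]
    simp
  exact ⟨⟨0, by simp [h1]⟩, 0, by simp [h2]⟩

variable [HasDuals C]

/-- Global splitting objects are projective with respect to the cokernel sequences of `C`: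
tensoring such a sequence with a dual of `Z` makes it split exact. -/
theorem globalSplitting.hom_exact {Z : C} (hZ : globalSplitting C Z) {X Y W : C} {f : X ⟶ Y}
    {g : Y ⟶ W} (h : IsCoker f g) :
    (∀ z : Z ⟶ W, ∃ y, y ≫ g = z) ∧ ∀ y : Z ⟶ Y, y ≫ g = 0 → ∃ x, x ≫ f = y := by
  obtain ⟨Z', ⟨_⟩⟩ := HasDuals.exists_left Z
  have hZ' : globalSplitting C Z' := globalSplitting.of_exactPairing_left hZ
  obtain ⟨hs, t, ht⟩ := (h.whiskerLeft Z').isSplitExact (hZ' f).1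
  let e (A : C) : (Z ⊗ 𝟙_ C ⟶ A) ≃ (𝟙_ C ⟶ Z' ⊗ A) := tensorLeftHomEquiv _ _ _ _
  have he {A B : C} (x : Z ⊗ 𝟙_ C ⟶ A) (y : A ⟶ B) : e B (x ≫ y) = e A x ≫ Z' ◁ y :=
    tensorLeftHomEquiv_naturality _ _
  have he0 (A : C) : e A 0 = 0 := by
    have := he (0 : Z ⊗ 𝟙_ C ⟶ A) (0 : A ⟶ A)
    simpa using this
  constructor
  · intro z
    refine ⟨(ρ_ Z).inv ≫ (e Y).symm (e W ((ρ_ Z).hom ≫ z) ≫ t), ?_⟩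
    rw [Category.assoc, Iso.inv_comp_eq]
    apply (e W).injective
    rw [he, Equiv.apply_symm_apply, Category.assoc, ht, Category.comp_id]
  · intro y hy
    obtain ⟨x, hx⟩ := hs.exact (e Y ((ρ_ Z).hom ≫ y)) (by
      rw [← he, Category.assoc, hy, comp_zero, he0])
    refine ⟨(ρ_ Z).inv ≫ (e X).symm x, ?_⟩
    rw [Category.assoc, Iso.inv_comp_eq]
    apply (e Y).injective
    rw [he, Equiv.apply_symm_apply, hx]

/-- Tensoring a presentation of the unit with `A`. -/
theorem IsCoker.whiskerRight_unit {S T : C} {f : S ⟶ T} {g : T ⟶ 𝟙_ C} (h : IsCoker f g) (A : C) :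
    IsCoker (f ▷ A) (g ▷ A ≫ (λ_ A).hom) :=
  (h.whiskerRight A).of_iso (Iso.refl _) (Iso.refl _) (λ_ A) (by simp) (by simp)

/-- Every object has a presentation by global splitting objects. -/
theorem exists_splitting_presentation (hC : UnitHasSplittingPresentation C) (A : C) :
    ∃ (S T : C) (f : S ⟶ T) (g : T ⟶ A), globalSplitting C S ∧ globalSplitting C T ∧
      IsCoker f g := by
  obtain ⟨S, T, f, g, zero, hS, hT, ⟨h⟩⟩ := hC
  exact ⟨_, _, _, _, hS.tensor_right A, hT.tensor_right A,
    (isCoker_of_isColimit zero h).whiskerRight_unit A⟩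

/-- Weak kernels with respect to global splitting objects: the kernel of the split morphism
`T ⊗ f`, for a presentation `S ⟶ T ⟶ 𝟙 ⟶ 0` of the unit. -/
theorem exists_weakKernel [IsIdempotentComplete C] (hC : UnitHasSplittingPresentation C) {X Y : C}
    (f : X ⟶ Y) : ∃ (K : C) (κ : K ⟶ X), globalSplitting C K ∧ κ ≫ f = 0 ∧
      ∀ {Z : C} (_ : globalSplitting C Z) (z : Z ⟶ X), z ≫ f = 0 → ∃ y, y ≫ κ = z := by
  obtain ⟨S, T, a, g, zero, hS, hT, ⟨h⟩⟩ := hC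
  have hg := isCoker_of_isColimit zero h
  obtain ⟨K, i, p, hip, hif, hp⟩ := (hT f).1.exists_kernel
  refine ⟨K, i ≫ g ▷ X ≫ (λ_ X).hom, (hT.tensor_right X).of_retract i p hip, ?_, fun hZ z hz => ?_⟩
  · rw [Category.assoc, Category.assoc, ← leftUnitor_naturality, ← whisker_exchange_assoc,
      reassoc_of% hif, zero_comp]
  · obtain ⟨s, hs⟩ := (hZ.hom_exact (hg.whiskerRight_unit _)).1 (𝟙 _)
    refine ⟨(s ≫ T ◁ z) ≫ p, ?_⟩
    rw [← Category.assoc, hp]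
    · simp only [Category.assoc, whisker_exchange_assoc, leftUnitor_naturality]
      simpa using congrArg (· ≫ z) hs
    · rw [Category.assoc, ← MonoidalCategory.whiskerLeft_comp, hz]
      simp

end GlobalSplitting

/-! ### A criterion for localization functors -/

section Localization

variable {B : Type u₁} [Category.{v₁} B] {D : Type u₂} [Category.{v₂} D] (L : B ⥤ D)

open Localization.Construction in
/-- Every morphism of the localization becomes the image of a morphism of `B` after precomposition
with the image of a morphism from a cofibrant object. As the property of having such lifts is stable
under composition, it suffices to prove it for the images of morphisms of `B` and for the formal
inverses. -/
theorem exists_Q_map_eq_comp (cof : ObjectProperty B)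
    (full : ∀ {P R : B}, cof P → ∀ g : L.obj P ⟶ L.obj R, ∃ φ, L.map φ = g)
    (faithful : ∀ {P R : B}, cof P → ∀ φ ψ : P ⟶ R, L.map φ = L.map ψ →
      ((MorphismProperty.isomorphisms D).inverseImage L).Q.map φ =
      ((MorphismProperty.isomorphisms D).inverseImage L).Q.map ψ)
    {X Y : B} (g : ((MorphismProperty.isomorphisms D).inverseImage L).Q.obj X ⟶
      ((MorphismProperty.isomorphisms D).inverseImage L).Q.obj Y) {P : B} (hP : cof P)
    (w : P ⟶ X) :
    ∃ φ : P ⟶ Y,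
      ((MorphismProperty.isomorphisms D).inverseImage L).Q.map w ≫ g =
      ((MorphismProperty.isomorphisms D).inverseImage L).Q.map φ := by
  let W := (MorphismProperty.isomorphisms D).inverseImage L
  change ∃ φ : P ⟶ Y, W.Q.map w ≫ g = W.Q.map φ
  let M : MorphismProperty W.Localization := fun A A' g =>
    ∀ (P : B) (_ : cof P) (w : P ⟶ (objEquiv W).symm A),
      ∃ φ : P ⟶ (objEquiv W).symm A', CategoryStruct.comp (Y := A) (W.Q.map w) g = W.Q.map φ
  have : M.IsStableUnderComposition := ⟨by
    intro A₁ A₂ A₃ f g hf hg P hP w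
    obtain ⟨φ, hφ⟩ := hf P hP w
    obtain ⟨ψ, hψ⟩ := hg P hP φ
    exact ⟨ψ, (Category.assoc (X := A₁) (W.Q.map w) f g).symm.trans
      ((congrArg (CategoryStruct.comp · g) hφ).trans hψ)⟩⟩
  have key {A A' : B} (v : A ⟶ A') (hv : W v) (P : B) (hP : cof P) (w : P ⟶ A') :
      ∃ φ : P ⟶ A, W.Q.map w ≫ wInv v hv = W.Q.map φ := by
    have hv' : IsIso (L.map v) := hv
    obtain ⟨φ, hφ⟩ := full hP (L.map w ≫ inv (L.map v))
    refine ⟨φ, ?_⟩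
    have e : W.Q.map (φ ≫ v) = W.Q.map w := faithful hP _ _ (by simp [hφ])
    have hi : W.Q.map v ≫ wInv v hv = 𝟙 _ := (wIso v hv).hom_inv_id
    rw [← e, W.Q.map_comp, Category.assoc, hi, Category.comp_id]
  have hM : M = ⊤ := morphismProperty_eq_top _
    (fun A A' f P _ w => ⟨(show P ⟶ A from w) ≫ f, (W.Q.map_comp (show P ⟶ A from w) f).symm⟩)
    (fun A A' v hv P hP w => key v hv P hP w)
  have : M g := by rw [hM]; trivial
  exact this P hP w

/-- A functor `L` is a localization functor if every object is the image of a cofibrant object,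
morphisms between images lift when the source is cofibrant, and two morphisms from a cofibrant
object with the same image are identified in the localization. -/
theorem isLocalization_of_cofibrant (cof : ObjectProperty B)
    (essSurj : ∀ d : D, ∃ P, cof P ∧ Nonempty (L.obj P ≅ d))
    (full : ∀ {P R : B}, cof P → ∀ g : L.obj P ⟶ L.obj R, ∃ φ, L.map φ = g)
    (faithful : ∀ {P R : B}, cof P → ∀ φ ψ : P ⟶ R, L.map φ = L.map ψ →
      ((MorphismProperty.isomorphisms D).inverseImage L).Q.map φ =
      ((MorphismProperty.isomorphisms D).inverseImage L).Q.map ψ) :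
    L.IsLocalization ((MorphismProperty.isomorphisms D).inverseImage L) := by
  set W := (MorphismProperty.isomorphisms D).inverseImage L with hW
  have hinv : W.IsInvertedBy L := fun _ _ _ h => h
  let G := Localization.Construction.lift L hinv
  have fac {X Y : B} (f : X ⟶ Y) : G.map (W.Q.map f) = L.map f :=
    Category.id_comp (L.map f)
  have res (X : B) : ∃ (P : B) (_ : cof P) (w : P ⟶ X), W w := by
    obtain ⟨P, hP, ⟨e⟩⟩ := essSurj (L.obj X)
    obtain ⟨w, hw⟩ := full hP e.hom
    exact ⟨P, hP, w, by
      change IsIso (L.map w)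
      rw [hw]; infer_instance⟩
  have hfaith : G.Faithful := ⟨by
    intro X Y g g' h
    obtain ⟨P, hP, w, hw⟩ := res ((Localization.Construction.objEquiv W).symm X)
    obtain ⟨φ, hφ⟩ := exists_Q_map_eq_comp L cof full faithful
      (Y := (Localization.Construction.objEquiv W).symm Y) g hP w
    obtain ⟨φ', hφ'⟩ := exists_Q_map_eq_comp L cof full faithful
      (Y := (Localization.Construction.objEquiv W).symm Y) g' hP w
    have : IsIso (W.Q.map w) := Localization.inverts W.Q W w hw
    refine (cancel_epi (Z := Y) (W.Q.map w)).1 ?_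
    refine hφ.trans (Eq.trans ?_ hφ'.symm)
    apply faithful hP
    rw [← fac, ← fac]
    refine (congrArg G.map hφ).symm.trans (Eq.trans ?_ (congrArg G.map hφ'))
    exact (G.map_comp _ _).trans ((congrArg (G.map (W.Q.map w) ≫ ·) h).trans
      (G.map_comp _ _).symm)⟩
  have hfull : G.Full := ⟨by
    intro X Y g
    obtain ⟨P, hP, w, hw⟩ := res ((Localization.Construction.objEquiv W).symm X)
    obtain ⟨φ, hφ⟩ := full (R := (Localization.Construction.objEquiv W).symm Y) hP (L.map w ≫ g)
    have hw' : IsIso (L.map w) := hw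
    let i := Localization.Construction.wIso w hw
    refine ⟨i.inv ≫ W.Q.map φ, ?_⟩
    have h1 : G.map (W.Q.map w) ≫ G.map (i.inv ≫ W.Q.map φ) = G.map (W.Q.map φ) := by
      rw [← G.map_comp]
      exact congrArg G.map (i.hom_inv_id_assoc _)
    rw [fac, fac, hφ] at h1
    exact (cancel_epi (L.map w)).1 h1⟩
  have hess : G.EssSurj := ⟨fun d => by
    obtain ⟨P, _, ⟨e⟩⟩ := essSurj d
    exact ⟨W.Q.obj P, ⟨e⟩⟩⟩
  exact ⟨hinv, { }⟩

/-- In the localization of an additive category at the morphisms inverted by an additive functor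
`L`, two morphisms agree if their difference factors through an object killed by `L`. -/
theorem Q_map_eq_of_sub_factors [Preadditive B] [HasBinaryBiproducts B] [Preadditive D]
    [L.Additive] {P R E : B} (φ ψ : P ⟶ R) (hE : IsZero (L.obj E)) (q : P ⟶ E) (e : E ⟶ R)
    (h : φ = ψ + q ≫ e) :
    ((MorphismProperty.isomorphisms D).inverseImage L).Q.map φ =
      ((MorphismProperty.isomorphisms D).inverseImage L).Q.map ψ := by
  set W := (MorphismProperty.isomorphisms D).inverseImage L
  -- the inclusion of `R` into `R ⊞ E` is inverted, so its two retractions `fst` and `desc 1 e`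
  -- agree
  have hi : W (biprod.inl : R ⟶ R ⊞ E) := by
    refine ⟨L.map biprod.fst, ?_, ?_⟩
    · rw [← L.map_comp, biprod.inl_fst, L.map_id]
    · have := congrArg L.map (biprod.total (X := R) (Y := E))
      rw [L.map_add, L.map_comp, L.map_comp, hE.eq_of_tgt (L.map biprod.snd) 0, zero_comp,
        add_zero, L.map_id] at this
      exact this
  have := Localization.inverts W.Q W _ hi
  have e1 : W.Q.map (biprod.fst : R ⊞ E ⟶ R) = W.Q.map (biprod.desc (𝟙 R) e) := by
    rw [← cancel_epi (W.Q.map biprod.inl), ← W.Q.map_comp, ← W.Q.map_comp]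
    simp
  have e2 : φ = biprod.lift ψ q ≫ biprod.desc (𝟙 R) e := by simp [h]
  rw [e2, W.Q.map_comp, ← e1, ← W.Q.map_comp, biprod.lift_fst]

end Localization

/-! ### Coequalizers of reflexive pairs -/

section ReflCoeq

open WalkingReflexivePair WalkingReflexivePair.Hom

variable {C : Type u₁} [Category.{v₁} C]

variable {T : Type u₂} [Category.{v₂} T] [HasColimitsOfShape WalkingReflexivePair T] (Y : C ⥤ T)

/-- The functor sending a reflexive pair in `C` to the coequalizer of its image under `Y`. -/
noncomputable abbrev reflCoeq : (WalkingReflexivePair ⥤ C) ⥤ T :=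
  (Functor.whiskeringRight WalkingReflexivePair C T).obj Y ⋙ colim

/-- The projection onto the coequalizer. -/
noncomputable def reflπ (R : WalkingReflexivePair ⥤ C) :
    Y.obj (R.obj zero) ⟶ (reflCoeq Y).obj R :=
  colimit.ι (R ⋙ Y) zero

theorem reflπ_naturality {R R' : WalkingReflexivePair ⥤ C} (f : R ⟶ R') :
    reflπ Y R ≫ (reflCoeq Y).map f = Y.map (f.app zero) ≫ reflπ Y R' :=
  ι_colimMap (Functor.whiskerRight f Y) zero

theorem reflπ_condition (R : WalkingReflexivePair ⥤ C) :
    Y.map (R.map left) ≫ reflπ Y R = Y.map (R.map right) ≫ reflπ Y R :=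
  (colimit.w (R ⋙ Y) left).trans (colimit.w (R ⋙ Y) right).symm

theorem exists_reflπ_desc (R : WalkingReflexivePair ⥤ C) {E : T} (t : Y.obj (R.obj zero) ⟶ E)
    (ht : Y.map (R.map left) ≫ t = Y.map (R.map right) ≫ t) :
    ∃ s : (reflCoeq Y).obj R ⟶ E, reflπ Y R ≫ s = t :=
  ⟨colimit.desc (R ⋙ Y) (ReflexiveCofork.mk (F := R ⋙ Y) t ht), colimit.ι_desc _ _⟩

instance reflπ_epi (R : WalkingReflexivePair ⥤ C) : Epi (reflπ Y R) where
  left_cancellation {E} a b h := by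
    have h' : colimit.ι (R ⋙ Y) zero ≫ a = colimit.ι (R ⋙ Y) zero ≫ b := h
    refine colimit.hom_ext (F := R ⋙ Y) fun j => ?_
    cases j
    · exact h'
    · rw [← colimit.w (R ⋙ Y) left, Category.assoc, Category.assoc, h']

end ReflCoeq

section Additive

open WalkingReflexivePair WalkingReflexivePair.Hom

variable {C : Type u₁} [Category.{v₁} C] [Preadditive C] {T : Type u₂} [Category.{v₂} T]
  [Preadditive T] [HasColimitsOfShape WalkingReflexivePair T] (Y : C ⥤ T) [Y.Additive]

instance : (reflCoeq Y).Additive where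
  map_add {R R' f g} := by
    rw [← cancel_epi (reflπ Y R), Preadditive.comp_add, reflπ_naturality, reflπ_naturality,
      reflπ_naturality, ← Preadditive.add_comp, ← Y.map_add]
    rfl

theorem isCoker_reflπ (R : WalkingReflexivePair ⥤ C) :
    IsCoker (Y.map (R.map left - R.map right)) (reflπ Y R) where
  zero := by rw [Y.map_sub, Preadditive.sub_comp, reflπ_condition, sub_self]
  epi := inferInstance
  exists_desc t ht := exists_reflπ_desc Y R t
    (by rwa [Y.map_sub, Preadditive.sub_comp, sub_eq_zero] at ht)

variable [HasBinaryBiproducts C]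

/-- The reflexive pair `X₀ ⊞ X₁ ⇉ X₀` attached to a morphism `α : X₁ ⟶ X₀`. Its coequalizer is the
cokernel of `α`. -/
noncomputable def reflOfHom {X₁ X₀ : C} (α : X₁ ⟶ X₀) : WalkingReflexivePair ⥤ C :=
  reflexivePair (biprod.desc (𝟙 X₀) α) biprod.fst biprod.inl (by simp) (by simp)

/-- A morphism out of the reflexive pair attached to `α`. -/
noncomputable def reflOfHomDesc {X₁ X₀ : C} (α : X₁ ⟶ X₀) (R : WalkingReflexivePair ⥤ C)
    (r : X₀ ⟶ R.obj zero) (c : X₁ ⟶ R.obj one) (h₁ : c ≫ R.map left = α ≫ r)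
    (h₂ : c ≫ R.map right = 0) : reflOfHom α ⟶ R :=
  reflexivePair.mkNatTrans (F := reflOfHom α) r (biprod.desc (r ≫ R.map reflexion) c)
    (by
      have : biprod.desc (𝟙 X₀) α ≫ r = biprod.desc (r ≫ R.map reflexion) c ≫ R.map left := by
        ext <;> simp [h₁]
      exact this)
    (by
      have : biprod.fst ≫ r = biprod.desc (r ≫ R.map reflexion) c ≫ R.map right := by
        ext <;> simp [h₂]
      exact this)
    (biprod.inl_desc _ _)

/-- A morphism into the reflexive pair attached to `α`. -/
noncomputable def reflOfHomLift {X₁ X₀ : C} (α : X₁ ⟶ X₀) (P : WalkingReflexivePair ⥤ C)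
    (x₀ : P.obj zero ⟶ X₀) (x₁ : P.obj one ⟶ X₁)
    (h₁ : P.map left ≫ x₀ = P.map right ≫ x₀ + x₁ ≫ α) (h₂ : P.map reflexion ≫ x₁ = 0) :
    P ⟶ reflOfHom α :=
  reflexivePair.mkNatTrans (G := reflOfHom α) x₀ (biprod.lift (P.map right ≫ x₀) x₁)
    (by
      have : P.map left ≫ x₀ = biprod.lift (P.map right ≫ x₀) x₁ ≫ biprod.desc (𝟙 X₀) α := by
        simp [h₁]
      exact this)
    (biprod.lift_fst _ _).symm
    (by
      have : P.map reflexion ≫ biprod.lift (P.map right ≫ x₀) x₁ = x₀ ≫ biprod.inl := by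
        ext <;> simp [h₂]
      exact this)

/-- The projection onto the cokernel of `α`. -/
noncomputable def reflOfHomπ {X₁ X₀ : C} (α : X₁ ⟶ X₀) :
    Y.obj X₀ ⟶ (reflCoeq Y).obj (reflOfHom α) :=
  reflπ Y (reflOfHom α)

theorem isCoker_reflOfHom {X₁ X₀ : C} (α : X₁ ⟶ X₀) :
    IsCoker (Y.map α) (reflOfHomπ Y α) where
  zero := by
    have h : Y.map (biprod.desc (𝟙 X₀) α) ≫ reflOfHomπ Y α = Y.map biprod.fst ≫ reflOfHomπ Y α :=
      reflπ_condition Y (reflOfHom α)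
    have := congrArg (Y.map biprod.inr ≫ ·) h
    simp only [← Category.assoc, ← Y.map_comp] at this
    simpa using this
  epi := reflπ_epi Y (reflOfHom α)
  exists_desc t ht := exists_reflπ_desc Y (reflOfHom α) t (by
    have e : biprod.desc (𝟙 X₀) α = biprod.fst + biprod.snd ≫ α := by ext <;> simp
    have : Y.map (biprod.desc (𝟙 X₀) α) ≫ t = Y.map biprod.fst ≫ t := by
      rw [e, Y.map_add, Y.map_comp, Preadditive.add_comp, Category.assoc, ht, comp_zero, add_zero]
    exact this)

theorem isZero_reflCoeq_reflOfHom {X₁ X₀ : C} (α : X₁ ⟶ X₀) [IsSplitEpi α] :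
    IsZero ((reflCoeq Y).obj (reflOfHom α)) := by
  have h := (isCoker_reflOfHom Y α).zero
  have := (isCoker_reflOfHom Y α).epi
  rw [IsZero.iff_id_eq_zero, ← cancel_epi (reflOfHomπ Y α), Category.comp_id, comp_zero,
    ← cancel_epi (Y.map α), h, comp_zero]

end Additive

/-! ### Resolutions by global splitting objects -/

section Realization

open WalkingReflexivePair WalkingReflexivePair.Hom

instance {T : Type u₂} [Category.{v₂} T] [Abelian T] :
    HasColimitsOfShape WalkingReflexivePair T :=
  hasReflexiveCoequalizers_iff.2 inferInstance

theorem IsCoker.exact_of_projective {T : Type u₂} [Category.{v₂} T] [Abelian T] {X Z W : T}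
    {f : X ⟶ Z} {g : Z ⟶ W} (h : IsCoker f g) {P : T} [Projective P] (y : P ⟶ Z)
    (hy : y ≫ g = 0) : ∃ x, x ≫ f = y := by
  have he : (ShortComplex.mk f g h.zero).Exact :=
    ShortComplex.exact_of_g_is_cokernel _ h.isColimit
  exact ⟨he.liftFromProjective y hy, he.liftFromProjective_comp y hy⟩

/-- The functor `Y : C ⥤ T` to an abelian category sends global splitting objects to projective
objects, and every object of `T` is a quotient of the image of a global splitting object. -/
class IsProjectiveRealization {C : Type u₁} [Category.{v₁} C] [MonoidalCategory C]
    {T : Type u₂} [Category.{v₂} T] (Y : C ⥤ T) : Prop where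
  projective : ∀ {S : C}, globalSplitting C S → Projective (Y.obj S)
  exists_epi : ∀ M : T, ∃ (S : C) (p : Y.obj S ⟶ M), globalSplitting C S ∧ Epi p

/-- The reflexive pairs of global splitting objects. -/
def cofibrant (C : Type u₁) [Category.{v₁} C] [MonoidalCategory C] :
    ObjectProperty (WalkingReflexivePair ⥤ C) :=
  fun P => ∀ j, globalSplitting C (P.obj j)

variable {C : Type u₁} [Category.{v₁} C] [Preadditive C] [MonoidalCategory C]
  {T : Type u₂} [Category.{v₂} T] [Abelian T] (Y : C ⥤ T) [Y.Additive] [Y.Full] [Y.Faithful]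
  [hY : IsProjectiveRealization Y]

theorem exists_lift_reflπ {Z : C} (hZ : globalSplitting C Z) (R : WalkingReflexivePair ⥤ C)
    (t : Y.obj Z ⟶ (reflCoeq Y).obj R) : ∃ z : Z ⟶ R.obj zero, Y.map z ≫ reflπ Y R = t := by
  have := hY.projective hZ
  exact ⟨Y.preimage (Projective.factorThru t (reflπ Y R)), by simp⟩

/-- A morphism from a global splitting object to `R₀` which vanishes on the coequalizer is the
boundary of a morphism to `R₁`, normalized to vanish under the right morphism of the pair. -/
theorem exists_lift_of_reflπ_eq_zero {Z : C} (hZ : globalSplitting C Z)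
    (R : WalkingReflexivePair ⥤ C) (a : Z ⟶ R.obj zero) (ha : Y.map a ≫ reflπ Y R = 0) :
    ∃ c : Z ⟶ R.obj one, c ≫ R.map left = a ∧ c ≫ R.map right = 0 := by
  have := hY.projective hZ
  obtain ⟨x, hx⟩ := (isCoker_reflπ Y R).exact_of_projective _ ha
  obtain ⟨c, rfl⟩ := Y.map_surjective x
  rw [← Y.map_comp] at hx
  have hc := Y.map_injective hx
  rw [Preadditive.comp_sub] at hc
  exact ⟨c - c ≫ R.map right ≫ R.map reflexion, by simp [hc], by simp⟩

/-- Morphisms of coequalizers lift to morphisms of reflexive pairs if the source is cofibrant. -/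
theorem exists_map_eq_of_cofibrant {P R : WalkingReflexivePair ⥤ C} (hP : cofibrant C P)
    (g : (reflCoeq Y).obj P ⟶ (reflCoeq Y).obj R) : ∃ φ, (reflCoeq Y).map φ = g := by
  obtain ⟨φ₀, h₀⟩ := exists_lift_reflπ Y (hP zero) R (reflπ Y P ≫ g)
  obtain ⟨c, hc₁, hc₂⟩ := exists_lift_of_reflπ_eq_zero Y (hP one) R
    ((P.map left - P.map right) ≫ φ₀) (by
      rw [Y.map_comp, Category.assoc, h₀, ← Category.assoc, (isCoker_reflπ Y P).zero, zero_comp])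
  -- `φ'` is compatible with the left and right morphisms, and its correction `φ₁` on the degenerate
  -- part is moreover compatible with the common section
  let φ' := c + P.map right ≫ φ₀ ≫ R.map reflexion
  have l' : φ' ≫ R.map left = P.map left ≫ φ₀ := by simp [φ', hc₁]
  have r' : φ' ≫ R.map right = P.map right ≫ φ₀ := by simp [φ', hc₂]
  let φ₁ := φ' - P.map right ≫ P.map reflexion ≫ φ' + P.map right ≫ φ₀ ≫ R.map reflexion
  refine ⟨reflexivePair.mkNatTrans φ₀ φ₁ ?_ ?_ ?_, ?_⟩
  · simp [φ₁, l']
  · simp [φ₁, r']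
  · simp [φ₁]
  · rw [← cancel_epi (reflπ Y P), reflπ_naturality, ← h₀]
    rfl

/-- A morphism from a cofibrant pair which is zero on coequalizers factors through a pair with zero
coequalizer, the one attached to the split epimorphism `P₀ ⊞ P₁ ⟶ P₀`: this is a null-homotopy
`h : P₀ ⟶ R₁` together with the remaining component `ε : P₁ ⟶ R₁`. -/
theorem exists_factorization_of_map_eq_zero [HasBinaryBiproducts C]
    {P R : WalkingReflexivePair ⥤ C} (hP : cofibrant C P) (δ : P ⟶ R)
    (hδ : (reflCoeq Y).map δ = 0) :
    ∃ (E : WalkingReflexivePair ⥤ C) (q : P ⟶ E) (e : E ⟶ R),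
      IsZero ((reflCoeq Y).obj E) ∧ δ = q ≫ e := by
  obtain ⟨h, hl, hr⟩ := exists_lift_of_reflπ_eq_zero Y (hP zero) R (δ.app zero) (by
    rw [← reflπ_naturality, hδ, comp_zero])
  have nl : P.map left ≫ δ.app zero = δ.app one ≫ R.map left := δ.naturality left
  have nr : P.map right ≫ δ.app zero = δ.app one ≫ R.map right := δ.naturality right
  have ns : P.map reflexion ≫ δ.app one = δ.app zero ≫ R.map reflexion := δ.naturality reflexion
  let ε := δ.app one - P.map right ≫ δ.app zero ≫ R.map reflexion
    - (P.map left - P.map right) ≫ h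
  refine ⟨reflOfHom (biprod.fst : P.obj zero ⊞ P.obj one ⟶ _),
    reflOfHomLift _ _ (𝟙 _) (biprod.lift (P.map left - P.map right)
        (𝟙 _ - P.map right ≫ P.map reflexion)) ?_ ?_,
    reflOfHomDesc _ _ (δ.app zero) (biprod.desc h ε) ?_ ?_,
    isZero_reflCoeq_reflOfHom Y _, ?_⟩
  · simp
  · ext <;> simp
  · ext
    · simp [hl]
    · simp [ε, hl, nl]
  · ext
    · simp [hr]
    · simp [ε, hr]
  · ext j
    cases j
    · exact (Category.id_comp _).symm
    · have : δ.app one = biprod.lift (P.map right ≫ 𝟙 _) (biprod.lift (P.map left - P.map right)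
          (𝟙 _ - P.map right ≫ P.map reflexion)) ≫
          biprod.desc (δ.app zero ≫ R.map reflexion) (biprod.desc h ε) := by
        simp [ε, ns]
      exact this

/-- Every object is the cokernel of the image of a morphism of global splitting objects. -/
theorem exists_presentation (M : T) : ∃ (X₁ X₀ : C) (α : X₁ ⟶ X₀) (p : Y.obj X₀ ⟶ M),
    globalSplitting C X₁ ∧ globalSplitting C X₀ ∧ IsCoker (Y.map α) p := by
  obtain ⟨X₀, p₀, h₀, _⟩ := hY.exists_epi M
  obtain ⟨X₁, p₁, h₁, _⟩ := hY.exists_epi (kernel p₀)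
  have hα : IsCoker (p₁ ≫ kernel.ι p₀) p₀ := by
    refine ⟨by simp, inferInstance, fun t ht => ?_⟩
    have ht' : kernel.ι p₀ ≫ t = 0 := by
      rw [← cancel_epi p₁, comp_zero, ← ht, Category.assoc]
    exact ⟨_, (CokernelCofork.IsColimit.desc'
      (Abelian.epiIsCokernelOfKernel _ (kernelIsKernel p₀)) t ht').2⟩
  obtain ⟨α, hα'⟩ := Y.map_surjective (p₁ ≫ kernel.ι p₀)
  exact ⟨X₁, X₀, α, p₀, h₁, h₀, by rwa [hα']⟩

/-- Every object is the coequalizer of a cofibrant pair. -/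
theorem exists_cofibrant_iso [HasBinaryBiproducts C] (hS : ∀ {S S' : C}, globalSplitting C S →
      globalSplitting C S' → globalSplitting C (S ⊞ S')) (M : T) :
    ∃ P, cofibrant C P ∧ Nonempty ((reflCoeq Y).obj P ≅ M) := by
  obtain ⟨X₁, X₀, α, p₀, h₁, h₀, hα⟩ := exists_presentation Y M
  obtain ⟨e, -⟩ := (isCoker_reflOfHom Y α).exists_iso hα
  refine ⟨reflOfHom α, ?_, ⟨e⟩⟩
  rintro (_ | _)
  exacts [h₀, hS h₀ h₁]

/-- The morphisms of reflexive pairs which induce an isomorphism on coequalizers. -/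
def reflW : MorphismProperty (WalkingReflexivePair ⥤ C) :=
  (MorphismProperty.isomorphisms T).inverseImage (reflCoeq Y)

/-- Taking coequalizers is a localization functor. -/
theorem isLocalization_reflCoeq [HasFiniteBiproducts C] [MonoidalPreadditive C] :
    (reflCoeq Y).IsLocalization (reflW Y) := by
  have : HasBinaryBiproducts C := hasBinaryBiproducts_of_finite_biproducts C
  have : HasFiniteProducts C := inferInstance
  have : HasFiniteBiproducts (WalkingReflexivePair ⥤ C) := HasFiniteBiproducts.of_hasFiniteProducts
  have : HasBinaryBiproducts (WalkingReflexivePair ⥤ C) :=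
    hasBinaryBiproducts_of_finite_biproducts _
  refine isLocalization_of_cofibrant _ (cofibrant C)
    (exists_cofibrant_iso Y fun h h' => h.biprod h')
    (exists_map_eq_of_cofibrant Y) fun hP φ ψ h => ?_
  obtain ⟨E, q, e, hE, he⟩ := exists_factorization_of_map_eq_zero Y hP (φ - ψ) (by
    rw [Functor.map_sub, h, sub_self])
  exact Q_map_eq_of_sub_factors _ φ ψ hE q e (by rw [← he]; abel)

end Realization

/-! ### Coequalizers of diagonals -/

section Diagonal

open WalkingReflexivePair WalkingReflexivePair.Hom

variable {C : Type u₁} [Category.{v₁} C] {D : Type u₃} [Category.{v₃} D]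
  {E : Type u₂} [Category.{v₂} E] [Preadditive E]
  (G : C ⥤ D ⥤ E) (R : WalkingReflexivePair ⥤ C) (N : WalkingReflexivePair ⥤ D)

/-- The left or right morphism of the diagonal of the double reflexive pair `G (R -) (N -)`. -/
abbrev diagMap (h : one ⟶ zero) : (G.obj (R.obj one)).obj (N.obj one) ⟶
    (G.obj (R.obj zero)).obj (N.obj zero) :=
  (G.map (R.map h)).app (N.obj one) ≫ (G.obj (R.obj zero)).map (N.map h)

variable {G R N} {A₀ A₁ Q : E} {p₀ : (G.obj (R.obj zero)).obj (N.obj zero) ⟶ A₀}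
  {p₁ : (G.obj (R.obj one)).obj (N.obj zero) ⟶ A₁} {al ar : A₁ ⟶ A₀} {q : A₀ ⟶ Q}

/-- The coequalizer of the coequalizers of the rows is a coequalizer of the diagonal. -/
theorem isCoker_diagonal
    (hp₀ : IsCoker ((G.obj (R.obj zero)).map (N.map left) -
      (G.obj (R.obj zero)).map (N.map right)) p₀) (hp₁ : Epi p₁)
    (hl : (G.map (R.map left)).app _ ≫ p₀ = p₁ ≫ al)
    (hr : (G.map (R.map right)).app _ ≫ p₀ = p₁ ≫ ar) (hq : IsCoker (al - ar) q) :
    IsCoker (diagMap G R N left - diagMap G R N right) (p₀ ≫ q) := by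
  have e₀ : (G.obj (R.obj zero)).map (N.map left) ≫ p₀ =
      (G.obj (R.obj zero)).map (N.map right) ≫ p₀ := by
    simpa [sub_eq_zero] using hp₀.zero
  have eq : al ≫ q = ar ≫ q := by simpa [sub_eq_zero] using hq.zero
  have := hp₀.epi
  have := hq.epi
  refine ⟨?_, inferInstance, fun t ht => ?_⟩
  · simp only [Preadditive.sub_comp, Category.assoc, sub_eq_zero]
    rw [reassoc_of% e₀, ← NatTrans.naturality_assoc, ← NatTrans.naturality_assoc, reassoc_of% hl,
      reassoc_of% hr, eq]
  · have h : diagMap G R N left ≫ t = diagMap G R N right ≫ t := by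
      simpa [sub_eq_zero] using ht
    have hN : (G.obj (R.obj zero)).map (N.map left) ≫ t =
        (G.obj (R.obj zero)).map (N.map right) ≫ t := by
      have := congrArg ((G.map (R.map reflexion)).app (N.obj one) ≫ ·) h
      simpa [← NatTrans.comp_app_assoc, ← Functor.map_comp] using this
    have hR : (G.map (R.map left)).app (N.obj zero) ≫ t =
        (G.map (R.map right)).app (N.obj zero) ≫ t := by
      have := congrArg ((G.obj (R.obj one)).map (N.map reflexion) ≫ ·) h
      simpa [← Functor.map_comp_assoc] using this
    obtain ⟨t₁, rfl⟩ := hp₀.exists_desc t (by simp [hN])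
    obtain ⟨t₂, rfl⟩ := hq.exists_desc t₁ (by
      rw [← cancel_epi p₁]
      simp only [Preadditive.sub_comp, Preadditive.comp_sub, comp_zero, sub_eq_zero]
      rw [← reassoc_of% hl, ← reassoc_of% hr, hR])
    exact ⟨t₂, by simp⟩

/-- A coequalizer of the diagonal is the coequalizer of the coequalizers of the rows. -/
theorem isCoker_of_diagonal
    (hp₀ : IsCoker ((G.obj (R.obj zero)).map (N.map left) -
      (G.obj (R.obj zero)).map (N.map right)) p₀) (hp₁ : Epi p₁)
    (hl : (G.map (R.map left)).app _ ≫ p₀ = p₁ ≫ al)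
    (hr : (G.map (R.map right)).app _ ≫ p₀ = p₁ ≫ ar)
    (hq : IsCoker (diagMap G R N left - diagMap G R N right) (p₀ ≫ q)) :
    IsCoker (al - ar) q := by
  have e₀ : (G.obj (R.obj zero)).map (N.map left) ≫ p₀ =
      (G.obj (R.obj zero)).map (N.map right) ≫ p₀ := by
    simpa [sub_eq_zero] using hp₀.zero
  have h : diagMap G R N left ≫ p₀ ≫ q = diagMap G R N right ≫ p₀ ≫ q := by
    simpa [sub_eq_zero] using hq.zero
  have := hp₀.epi
  have := hq.epi
  have hR : (G.map (R.map left)).app (N.obj zero) ≫ p₀ ≫ q =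
      (G.map (R.map right)).app (N.obj zero) ≫ p₀ ≫ q := by
    have := congrArg ((G.obj (R.obj one)).map (N.map reflexion) ≫ ·) h
    simpa [← Functor.map_comp_assoc] using this
  refine ⟨?_, epi_of_epi p₀ q, fun t ht => ?_⟩
  · rw [← cancel_epi p₁]
    simp only [Preadditive.sub_comp, Preadditive.comp_sub, comp_zero, sub_eq_zero]
    rw [← reassoc_of% hl, ← reassoc_of% hr, hR]
  · have ht' : al ≫ t = ar ≫ t := by simpa [sub_eq_zero] using ht
    obtain ⟨s, hs⟩ := hq.exists_desc (p₀ ≫ t) (by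
      simp only [Preadditive.sub_comp, Category.assoc, sub_eq_zero]
      rw [reassoc_of% e₀, ← NatTrans.naturality_assoc, ← NatTrans.naturality_assoc,
        reassoc_of% hl, reassoc_of% hr, ht'])
    exact ⟨s, by rwa [Category.assoc, cancel_epi] at hs⟩

theorem IsCoker.congr {X Z W : E} {a a' : X ⟶ Z} {p p' : Z ⟶ W} (h : IsCoker a p) (ha : a = a')
    (hp : p = p') : IsCoker a' p' := by
  subst ha hp
  exact h

/-- A morphism of cokernel sequences which is an epimorphism on the first and an isomorphism on the
second terms is an isomorphism on cokernels. -/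
theorem IsCoker.isIso {X X' Z Z' W W' : E} {a : X ⟶ Z} {p : Z ⟶ W} {a' : X' ⟶ Z'} {p' : Z' ⟶ W'}
    (h : IsCoker a p) (h' : IsCoker a' p') (u : X ⟶ X') [Epi u] (u₀ : Z ⟶ Z') [IsIso u₀]
    (g : W ⟶ W') (e : a ≫ u₀ = u ≫ a') (e' : p ≫ g = u₀ ≫ p') : IsIso g := by
  have := h.epi
  have := h'.epi
  obtain ⟨s, hs⟩ := h'.exists_desc (inv u₀ ≫ p) (by
    rw [← cancel_epi u, ← reassoc_of% e, IsIso.hom_inv_id_assoc, h.zero, comp_zero])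
  refine ⟨s, ?_, ?_⟩
  · rw [← cancel_epi p, reassoc_of% e', hs]
    simp
  · rw [← cancel_epi p', reassoc_of% hs, e']
    simp

end Diagonal

section ReflTensor

open WalkingReflexivePair WalkingReflexivePair.Hom

variable {C : Type u₁} [Category.{v₁} C]

/-- The morphism from the constant reflexive pair at `R₀` to the reflexive pair `R`. -/
def constIncl (R : WalkingReflexivePair ⥤ C) :
    (Functor.const WalkingReflexivePair).obj (R.obj zero) ⟶ R :=
  reflexivePair.mkNatTrans (F := (Functor.const WalkingReflexivePair).obj (R.obj zero))
    (𝟙 _) (R.map reflexion)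
    (by
      rw [← R.map_comp]
      exact (Category.comp_id _).trans (R.map_id _).symm)
    (by
      rw [← R.map_comp]
      exact (Category.comp_id _).trans (R.map_id _).symm)
    rfl

variable [MonoidalCategory C]
  {T : Type u₂} [Category.{v₂} T] [Preadditive T] [HasColimitsOfShape WalkingReflexivePair T]
  [Preadditive C] (Y : C ⥤ T) [Y.Additive]

theorem isCoker_reflπ' (R : WalkingReflexivePair ⥤ C) :
    IsCoker (Y.map (R.map left) - Y.map (R.map right)) (reflπ Y R) := by
  rw [← Y.map_sub]
  exact isCoker_reflπ Y R

/-- The coequalizer of `R ⊗ N` is the coequalizer of the coequalizers of `R₁ ⊗ N` and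
`R₀ ⊗ N`. -/
theorem isCoker_reflCoeq_whiskerRight (R N : WalkingReflexivePair ⥤ C) :
    IsCoker ((reflCoeq Y).map ((Functor.const _).map (R.map left) ▷ N) -
        (reflCoeq Y).map ((Functor.const _).map (R.map right) ▷ N))
      ((reflCoeq Y).map (constIncl R ▷ N)) := by
  refine isCoker_of_diagonal (G := curriedTensor C ⋙ (Functor.whiskeringRight _ _ _).obj Y)
    (R := R) (N := N) (p₀ := reflπ Y ((Functor.const _).obj (R.obj zero) ⊗ N))
    (p₁ := reflπ Y ((Functor.const _).obj (R.obj one) ⊗ N)) ?_ (reflπ_epi Y _)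
    (reflπ_naturality Y ((Functor.const _).map (R.map left) ▷ N)).symm
    (reflπ_naturality Y ((Functor.const _).map (R.map right) ▷ N)).symm ?_
  · have e (h : one ⟶ zero) : Y.map (((Functor.const _).obj (R.obj zero) ⊗ N).map h) =
        Y.map (R.obj zero ◁ N.map h) := congrArg Y.map (id_tensorHom _ _)
    exact (isCoker_reflπ' Y ((Functor.const _).obj (R.obj zero) ⊗ N)).congr
      (congrArg₂ (· - ·) (e left) (e right)) rfl
  · have h1 : (constIncl R ▷ N).app zero = 𝟙 _ := id_whiskerRight _ _
    have h : reflπ Y (R ⊗ N) =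
        reflπ Y ((Functor.const _).obj (R.obj zero) ⊗ N) ≫ (reflCoeq Y).map (constIncl R ▷ N) := by
      rw [reflπ_naturality, h1]
      exact ((congrArg (· ≫ reflπ Y (R ⊗ N)) (Y.map_id _)).trans (Category.id_comp _)).symm
    have e (h : one ⟶ zero) : Y.map ((R ⊗ N).map h) =
        Y.map (R.map h ▷ N.obj one) ≫ Y.map (R.obj zero ◁ N.map h) :=
      (congrArg Y.map (MonoidalCategory.tensorHom_def _ _)).trans (Y.map_comp _ _)
    exact (isCoker_reflπ' Y (R ⊗ N)).congr (congrArg₂ (· - ·) (e left) (e right)) h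

theorem isCoker_reflCoeq_whiskerLeft (R N : WalkingReflexivePair ⥤ C) :
    IsCoker ((reflCoeq Y).map (N ◁ (Functor.const _).map (R.map left)) -
        (reflCoeq Y).map (N ◁ (Functor.const _).map (R.map right)))
      ((reflCoeq Y).map (N ◁ constIncl R)) := by
  refine isCoker_of_diagonal (G := (curriedTensor C).flip ⋙ (Functor.whiskeringRight _ _ _).obj Y)
    (R := R) (N := N) (p₀ := reflπ Y (N ⊗ (Functor.const _).obj (R.obj zero)))
    (p₁ := reflπ Y (N ⊗ (Functor.const _).obj (R.obj one))) ?_ (reflπ_epi Y _)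
    (reflπ_naturality Y (N ◁ (Functor.const _).map (R.map left))).symm
    (reflπ_naturality Y (N ◁ (Functor.const _).map (R.map right))).symm ?_
  · have e (h : one ⟶ zero) : Y.map ((N ⊗ (Functor.const _).obj (R.obj zero)).map h) =
        Y.map (N.map h ▷ R.obj zero) := congrArg Y.map (tensorHom_id _ _)
    exact (isCoker_reflπ' Y (N ⊗ (Functor.const _).obj (R.obj zero))).congr
      (congrArg₂ (· - ·) (e left) (e right)) rfl
  · have h1 : (N ◁ constIncl R).app zero = 𝟙 _ := MonoidalCategory.whiskerLeft_id _ _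
    have h : reflπ Y (N ⊗ R) =
        reflπ Y (N ⊗ (Functor.const _).obj (R.obj zero)) ≫ (reflCoeq Y).map (N ◁ constIncl R) := by
      rw [reflπ_naturality, h1]
      exact ((congrArg (· ≫ reflπ Y (N ⊗ R)) (Y.map_id _)).trans (Category.id_comp _)).symm
    have e (h : one ⟶ zero) : Y.map ((N ⊗ R).map h) =
        Y.map (N.obj one ◁ R.map h) ≫ Y.map (N.map h ▷ R.obj zero) :=
      (congrArg Y.map (MonoidalCategory.tensorHom_def' _ _)).trans (Y.map_comp _ _)
    exact (isCoker_reflπ' Y (N ⊗ R)).congr (congrArg₂ (· - ·) (e left) (e right)) h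

end ReflTensor

section IsMonoidal

open WalkingReflexivePair WalkingReflexivePair.Hom

variable {C : Type u₁} [Category.{v₁} C] [Preadditive C] [MonoidalCategory C]
  {T : Type u₂} [Category.{v₂} T] [Abelian T] (Y : C ⥤ T) [Y.Additive] [Y.Full] [Y.Faithful]
  [hY : IsProjectiveRealization Y]

include hY in
/-- Isomorphisms of `T` are detected by morphisms from global splitting objects. -/
theorem isIso_of_bijective {M N : T} (g : M ⟶ N)
    (inj : ∀ {Z : C}, globalSplitting C Z → ∀ y : Y.obj Z ⟶ M, y ≫ g = 0 → y = 0)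
    (surj : ∀ {Z : C}, globalSplitting C Z → ∀ z : Y.obj Z ⟶ N, ∃ y, y ≫ g = z) : IsIso g := by
  have : Mono g := by
    obtain ⟨Z, p, hZ, _⟩ := hY.exists_epi (kernel g)
    refine Preadditive.mono_of_kernel_zero ?_
    rw [← cancel_epi p, comp_zero]
    exact inj hZ _ (by simp)
  have : Epi g := by
    obtain ⟨Z, p, hZ, _⟩ := hY.exists_epi N
    obtain ⟨y, rfl⟩ := surj hZ p
    exact epi_of_epi y g
  exact isIso_of_mono_of_epi g

/-- A functor with a left adjoint preserving global splitting objects preserves the morphisms of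
reflexive pairs which induce an isomorphism on coequalizers. -/
theorem reflW_whiskerRight {F G : C ⥤ C} (adj : G ⊣ F) [F.Additive]
    (hG : ∀ {Z : C}, globalSplitting C Z → globalSplitting C (G.obj Z))
    {N N' : WalkingReflexivePair ⥤ C} (f : N ⟶ N') (hf : reflW Y f) :
    reflW Y (Functor.whiskerRight f F) := by
  have hf' : IsIso ((reflCoeq Y).map f) := hf
  have : G.Additive := adj.left_adjoint_additive
  let e (X Z : C) := adj.homAddEquiv X Z
  have he {X A A' : C} (x : G.obj X ⟶ A) (y : A ⟶ A') :
      adj.homAddEquiv X A' (x ≫ y) = adj.homAddEquiv X A x ≫ F.map y :=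
    adj.homEquiv_naturality_right x y
  have he' {X A A' : C} (x : X ⟶ F.obj A) (y : A ⟶ A') :
      (adj.homAddEquiv X A').symm (x ≫ F.map y) = (adj.homAddEquiv X A).symm x ≫ y :=
    adj.homEquiv_naturality_right_symm x y
  change IsIso ((reflCoeq Y).map (Functor.whiskerRight f F))
  refine isIso_of_bijective Y _ (fun {Z} hZ y hy => ?_) (fun {Z} hZ z => ?_)
  · obtain ⟨(y : Z ⟶ F.obj (N.obj zero)), rfl⟩ := exists_lift_reflπ Y hZ (N ⋙ F) y
    rw [Category.assoc, reflπ_naturality, ← Category.assoc, ← Y.map_comp] at hy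
    obtain ⟨c, hc₁, hc₂⟩ := exists_lift_of_reflπ_eq_zero Y hZ (N' ⋙ F) _ hy
    have h0 : Y.map ((adj.homAddEquiv _ _).symm y) ≫ reflπ Y N = 0 := by
      rw [← cancel_mono ((reflCoeq Y).map f), zero_comp, Category.assoc, reflπ_naturality,
        ← Category.assoc, ← Y.map_comp, ← he']
      have : y ≫ F.map (f.app zero) = c ≫ F.map (N'.map left - N'.map right) := by
        rw [F.map_sub, Preadditive.comp_sub]
        exact (sub_zero (y ≫ F.map (f.app zero))).symm.trans (congrArg₂ (· - ·) hc₁.symm hc₂.symm)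
      rw [this, he', Y.map_comp, Category.assoc, (isCoker_reflπ Y N').zero, comp_zero]
    obtain ⟨c', hc'₁, hc'₂⟩ := exists_lift_of_reflπ_eq_zero Y (hG hZ) N _ h0
    have hy' : y = adj.homAddEquiv _ _ c' ≫ F.map (N.map left - N.map right) := by
      rw [← he, Preadditive.comp_sub, hc'₁, hc'₂, sub_zero, AddEquiv.apply_symm_apply]
    have := (isCoker_reflπ Y (N ⋙ F)).zero
    rw [hy', F.map_sub, Y.map_comp, Category.assoc]
    exact (congrArg (Y.map _ ≫ ·) this).trans comp_zero
  · obtain ⟨(z : Z ⟶ F.obj (N'.obj zero)), rfl⟩ := exists_lift_reflπ Y hZ (N' ⋙ F) z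
    obtain ⟨y, hy⟩ := exists_lift_reflπ Y (hG hZ) N
      (Y.map ((adj.homAddEquiv _ _).symm z) ≫ reflπ Y N' ≫ inv ((reflCoeq Y).map f))
    have h0 : Y.map ((adj.homAddEquiv _ _).symm z - y ≫ f.app zero) ≫ reflπ Y N' = 0 := by
      rw [Y.map_sub, Preadditive.sub_comp, Y.map_comp, Category.assoc, ← reflπ_naturality,
        reassoc_of% hy]
      simp
    obtain ⟨c, hc₁, hc₂⟩ := exists_lift_of_reflπ_eq_zero Y (hG hZ) N' _ h0
    have hz : z - adj.homAddEquiv _ _ y ≫ F.map (f.app zero) =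
        adj.homAddEquiv _ _ c ≫ F.map (N'.map left - N'.map right) := by
      rw [← he, ← he, Preadditive.comp_sub, hc₁, hc₂, sub_zero, map_sub,
        AddEquiv.apply_symm_apply]
    refine ⟨Y.map (adj.homAddEquiv _ _ y) ≫ reflπ Y (N ⋙ F), ?_⟩
    rw [Category.assoc, reflπ_naturality, ← Category.assoc, ← Y.map_comp, eq_comm, ← sub_eq_zero,
      ← Preadditive.sub_comp, ← Y.map_sub]
    have := (isCoker_reflπ Y (N' ⋙ F)).zero
    refine (congrArg (Y.map · ≫ _) hz).trans ?_
    rw [F.map_sub, Y.map_comp, Category.assoc]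
    exact (congrArg (Y.map _ ≫ ·) this).trans comp_zero

variable [MonoidalPreadditive C] [HasDuals C]

/-- The right adjoint `A ⊗ -` of tensoring with a dual of `A` preserves the morphisms in
`reflW Y`. -/
theorem reflW_const_whiskerLeft (A : C) {N N' : WalkingReflexivePair ⥤ C} (f : N ⟶ N')
    (hf : reflW Y f) : reflW Y ((Functor.const WalkingReflexivePair).obj A ◁ f) := by
  obtain ⟨A', ⟨adj⟩⟩ := exists_tensorLeft_adj' A
  have h := reflW_whiskerRight Y adj (fun hZ => hZ.tensor_left A') f hf
  let e (M : WalkingReflexivePair ⥤ C) :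
      (Functor.const WalkingReflexivePair).obj A ⊗ M ≅ M ⋙ tensorLeft A :=
    NatIso.ofComponents (fun _ => Iso.refl _) (fun _ => by simp)
  have : (Functor.const WalkingReflexivePair).obj A ◁ f =
      (e N).hom ≫ Functor.whiskerRight f (tensorLeft A) ≫ (e N').inv := by
    exact NatTrans.ext (funext fun j => ((Category.id_comp _).trans (Category.comp_id _)).symm)
  rw [this]
  change IsIso ((reflCoeq Y).map _)
  have h' : IsIso ((reflCoeq Y).map (Functor.whiskerRight f (tensorLeft A))) := h
  rw [Functor.map_comp, Functor.map_comp]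
  infer_instance

theorem reflW_const_whiskerRight (A : C) {N N' : WalkingReflexivePair ⥤ C} (f : N ⟶ N')
    (hf : reflW Y f) : reflW Y (f ▷ (Functor.const WalkingReflexivePair).obj A) := by
  obtain ⟨A', ⟨adj⟩⟩ := exists_tensorRight_adj' A
  have h := reflW_whiskerRight Y adj (fun hZ => hZ.tensor_right A') f hf
  let e (M : WalkingReflexivePair ⥤ C) :
      M ⊗ (Functor.const WalkingReflexivePair).obj A ≅ M ⋙ tensorRight A :=
    NatIso.ofComponents (fun _ => Iso.refl _) (fun _ => by simp)
  have : f ▷ (Functor.const WalkingReflexivePair).obj A =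
      (e N).hom ≫ Functor.whiskerRight f (tensorRight A) ≫ (e N').inv := by
    exact NatTrans.ext (funext fun j => ((Category.id_comp _).trans (Category.comp_id _)).symm)
  rw [this]
  change IsIso ((reflCoeq Y).map _)
  have h' : IsIso ((reflCoeq Y).map (Functor.whiskerRight f (tensorRight A))) := h
  rw [Functor.map_comp, Functor.map_comp]
  infer_instance

/-- The morphisms inverted by taking coequalizers are stable under tensor products: the case of a
constant pair is given by duality, and the coequalizer of `R ⊗ N` is the coequalizer of those of
`R₁ ⊗ N` and `R₀ ⊗ N`. -/
instance reflW_isMonoidal : (reflW Y).IsMonoidal where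
  toIsMultiplicative := inferInstanceAs
    ((MorphismProperty.isomorphisms T).inverseImage (reflCoeq Y)).IsMultiplicative
  whiskerLeft R N N' f hf := by
    have h₀ : IsIso ((reflCoeq Y).map _) := reflW_const_whiskerLeft Y (R.obj zero) f hf
    have h₁ : IsIso ((reflCoeq Y).map _) := reflW_const_whiskerLeft Y (R.obj one) f hf
    refine (isCoker_reflCoeq_whiskerRight Y R N).isIso (isCoker_reflCoeq_whiskerRight Y R N')
      ((reflCoeq Y).map ((Functor.const _).obj (R.obj one) ◁ f))
      ((reflCoeq Y).map ((Functor.const _).obj (R.obj zero) ◁ f)) _ ?_ ?_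
    · simp only [Preadditive.sub_comp, Preadditive.comp_sub, ← Functor.map_comp,
        whisker_exchange]
    · simp only [← Functor.map_comp, whisker_exchange]
  whiskerRight {N N'} f hf R := by
    have h₀ : IsIso ((reflCoeq Y).map _) := reflW_const_whiskerRight Y (R.obj zero) f hf
    have h₁ : IsIso ((reflCoeq Y).map _) := reflW_const_whiskerRight Y (R.obj one) f hf
    refine (isCoker_reflCoeq_whiskerLeft Y R N).isIso (isCoker_reflCoeq_whiskerLeft Y R N')
      ((reflCoeq Y).map (f ▷ (Functor.const _).obj (R.obj one)))
      ((reflCoeq Y).map (f ▷ (Functor.const _).obj (R.obj zero))) _ ?_ ?_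
    · simp only [Preadditive.sub_comp, Preadditive.comp_sub, ← Functor.map_comp,
        whisker_exchange]
    · simp only [← Functor.map_comp, whisker_exchange]

end IsMonoidal

/-! ### The monoidal structure on the category of coequalizers -/

section MonoidalStructure

variable {B : Type u₁} [Category.{v₁} B] [Preadditive B] [MonoidalCategory B]
  [MonoidalPreadditive B] {T : Type u₂} [Category.{v₂} T] [Preadditive T] [MonoidalCategory T]
  (L : B ⥤ T) [L.Monoidal] [L.Additive]

open Functor.LaxMonoidal Functor.OplaxMonoidal

/-- The tensor product of `M` with a morphism which lifts along `L`, in terms of the lift. -/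
theorem whiskerLeft_conj {R P P' : B} {M N N' : T} (c : L.obj R ≅ M) (a : L.obj P ≅ N)
    (b : L.obj P' ≅ N') (φ : P ⟶ P') : M ◁ (a.inv ≫ L.map φ ≫ b.hom) =
      ((c.inv ⊗ₘ a.inv) ≫ μ L R P) ≫ L.map (R ◁ φ) ≫ δ L R P' ≫ (c.hom ⊗ₘ b.hom) := by
  rw [Functor.Monoidal.map_whiskerLeft]
  simp only [Category.assoc, Functor.Monoidal.μ_δ_assoc]
  rw [← id_tensorHom, ← id_tensorHom, tensorHom_comp_tensorHom, tensorHom_comp_tensorHom,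
    Category.id_comp, Iso.inv_hom_id]

/-- The tensor product with `M` of a morphism which lifts along `L`, in terms of the lift. -/
theorem whiskerRight_conj {R P P' : B} {M N N' : T} (c : L.obj R ≅ M) (a : L.obj P ≅ N)
    (b : L.obj P' ≅ N') (φ : P ⟶ P') : (a.inv ≫ L.map φ ≫ b.hom) ▷ M =
      ((a.inv ⊗ₘ c.inv) ≫ μ L P R) ≫ L.map (φ ▷ R) ≫ δ L P' R ≫ (b.hom ⊗ₘ c.hom) := by
  rw [Functor.Monoidal.map_whiskerRight]
  simp only [Category.assoc, Functor.Monoidal.μ_δ_assoc]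
  rw [← tensorHom_id, ← tensorHom_id, tensorHom_comp_tensorHom, tensorHom_comp_tensorHom,
    Category.id_comp, Iso.inv_hom_id]

variable (hf : ∀ {N N' : T} (f g : N ⟶ N'), ∃ (P P' : B) (a : L.obj P ≅ N) (b : L.obj P' ≅ N')
  (φ ψ : P ⟶ P'), f = a.inv ≫ L.map φ ≫ b.hom ∧ g = a.inv ≫ L.map ψ ≫ b.hom)

include hf in
/-- If every pair of parallel morphisms lifts along a monoidal additive functor, then the
target is monoidal preadditive. -/
theorem monoidalPreadditive_of_lift : MonoidalPreadditive T := by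
  have hl {M N N' : T} (f g : N ⟶ N') : M ◁ (f + g) = M ◁ f + M ◁ g := by
    obtain ⟨P, P', a, b, φ, ψ, rfl, rfl⟩ := hf f g
    obtain ⟨R, _, c, _⟩ := hf (𝟙 M) (𝟙 M)
    rw [← Preadditive.comp_add, ← Preadditive.add_comp, ← L.map_add, whiskerLeft_conj L c,
      whiskerLeft_conj L c, whiskerLeft_conj L c, MonoidalPreadditive.whiskerLeft_add, L.map_add,
      Preadditive.add_comp, Preadditive.comp_add]
  have hr {M N N' : T} (f g : N ⟶ N') : (f + g) ▷ M = f ▷ M + g ▷ M := by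
    obtain ⟨P, P', a, b, φ, ψ, rfl, rfl⟩ := hf f g
    obtain ⟨R, _, c, _⟩ := hf (𝟙 M) (𝟙 M)
    rw [← Preadditive.comp_add, ← Preadditive.add_comp, ← L.map_add, whiskerRight_conj L c,
      whiskerRight_conj L c, whiskerRight_conj L c, MonoidalPreadditive.add_whiskerRight, L.map_add,
      Preadditive.add_comp, Preadditive.comp_add]
  refine ⟨fun {X Y Z} => ?_, fun {X Y Z} => ?_, fun f g => hl f g, fun f g => hr f g⟩
  · simpa using hl (M := X) (0 : Y ⟶ Z) 0
  · simpa using hr (M := X) (0 : Y ⟶ Z) 0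

include hf in
theorem monoidalLinear_of_lift (k : Type t) [Field k] [Linear k B] [Linear k T] [MonoidalLinear k B]
    [L.Linear k] [MonoidalPreadditive T] : MonoidalLinear k T where
  whiskerLeft_smul M N N' r f := by
    obtain ⟨P, P', a, b, φ, -, rfl, -⟩ := hf f f
    obtain ⟨R, _, c, _⟩ := hf (𝟙 M) (𝟙 M)
    rw [← Linear.comp_smul, ← Linear.smul_comp, ← L.map_smul, whiskerLeft_conj L c,
      whiskerLeft_conj L c, MonoidalLinear.whiskerLeft_smul, L.map_smul, Linear.smul_comp,
      Linear.comp_smul]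
  smul_whiskerRight r N N' f M := by
    obtain ⟨P, P', a, b, φ, -, rfl, -⟩ := hf f f
    obtain ⟨R, _, c, _⟩ := hf (𝟙 M) (𝟙 M)
    rw [← Linear.comp_smul, ← Linear.smul_comp, ← L.map_smul, whiskerRight_conj L c,
      whiskerRight_conj L c, MonoidalLinear.smul_whiskerRight, L.map_smul, Linear.smul_comp,
      Linear.comp_smul]

end MonoidalStructure

section FunctorCategory

variable {J : Type u₁} [Category.{v₁} J] {C : Type u₂} [Category.{v₂} C] [MonoidalCategory C]

instance [Preadditive C] [MonoidalPreadditive C] : MonoidalPreadditive (J ⥤ C) where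
  whiskerLeft_zero := by
    intros
    ext j
    exact MonoidalPreadditive.whiskerLeft_zero
  zero_whiskerRight := by
    intros
    ext j
    exact MonoidalPreadditive.zero_whiskerRight
  whiskerLeft_add _ _ := by
    ext j
    exact MonoidalPreadditive.whiskerLeft_add _ _
  add_whiskerRight _ _ := by
    ext j
    exact MonoidalPreadditive.add_whiskerRight _ _

instance (k : Type t) [Field k] [Preadditive C] [Linear k C] [MonoidalPreadditive C]
    [MonoidalLinear k C] : MonoidalLinear k (J ⥤ C) where
  whiskerLeft_smul _ _ _ _ _ := by
    ext j
    exact MonoidalLinear.whiskerLeft_smul _ _ _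
  smul_whiskerRight _ _ _ _ _ := by
    ext j
    exact MonoidalLinear.smul_whiskerRight _ _ _

variable (J C) in
/-- The diagonal functor is monoidal. -/
instance constMonoidal : (Functor.const J : C ⥤ J ⥤ C).Monoidal :=
  Functor.CoreMonoidal.toMonoidal
    { εIso := Iso.refl _
      μIso := fun X Y => NatIso.ofComponents (fun _ => Iso.refl _) (fun _ => by
        exact (Category.comp_id _).trans ((id_tensorHom_id _ _).trans (Category.id_comp _).symm))
      μIso_hom_natural_left := fun f X' => by
        ext j
        exact (Category.comp_id _).trans (Category.id_comp _).symm
      μIso_hom_natural_right := fun X' f => by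
        ext j
        exact (Category.comp_id _).trans (Category.id_comp _).symm
      associativity := fun X Y Z => by
        ext j
        have : (𝟙 (X ⊗ Y)) ▷ Z ≫ 𝟙 _ ≫ (α_ X Y Z).hom = (α_ X Y Z).hom ≫ X ◁ 𝟙 _ ≫ 𝟙 _ := by
          simp
        exact this
      left_unitality := fun X => by
        ext j
        have : (λ_ X).hom = 𝟙 _ ▷ X ≫ 𝟙 _ ≫ (λ_ X).hom := by simp
        exact this
      right_unitality := fun X => by
        ext j
        have : (ρ_ X).hom = X ◁ 𝟙 _ ≫ 𝟙 _ ≫ (ρ_ X).hom := by simp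
        exact this }

end FunctorCategory

section Refl

open WalkingReflexivePair WalkingReflexivePair.Hom

variable {C : Type u₁} [Category.{v₁} C] {T : Type u₂} [Category.{v₂} T]
  [HasColimitsOfShape WalkingReflexivePair T] (Y : C ⥤ T)

instance isIso_reflπ_const (A : C) :
    IsIso (reflπ Y ((Functor.const WalkingReflexivePair).obj A)) := by
  let R := (Functor.const WalkingReflexivePair).obj A
  obtain ⟨s, hs⟩ := exists_reflπ_desc Y R (𝟙 (Y.obj A)) rfl
  refine ⟨s, hs, (cancel_epi (reflπ Y R)).1 ?_⟩
  exact (Category.assoc _ _ _).symm.trans ((congrArg (· ≫ reflπ Y R) hs).trans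
    ((Category.id_comp _).trans (Category.comp_id _).symm))

/-- The coequalizer of a constant reflexive pair. -/
noncomputable def constReflCoeqIso : Functor.const WalkingReflexivePair ⋙ reflCoeq Y ≅ Y :=
  (NatIso.ofComponents (fun A => (asIso (reflπ Y ((Functor.const WalkingReflexivePair).obj A)) :
    Y.obj A ≅ (Functor.const WalkingReflexivePair ⋙ reflCoeq Y).obj A)) fun f =>
      (reflπ_naturality Y ((Functor.const WalkingReflexivePair).map f)).symm).symm

instance (k : Type t) [Field k] [Preadditive C] [Linear k C] [Preadditive T] [Linear k T]
    [Y.Additive] [Y.Linear k] : (reflCoeq Y).Linear k where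
  map_smul {R R'} f r := by
    rw [← cancel_epi (reflπ Y R), Linear.comp_smul, reflπ_naturality, reflπ_naturality,
      ← Linear.smul_comp, ← Y.map_smul]
    rfl

end Refl

section Exists

open WalkingReflexivePair WalkingReflexivePair.Hom

variable {C : Type u₁} [Category.{v₁} C] [Preadditive C] [MonoidalCategory C]
  [MonoidalPreadditive C] [HasFiniteBiproducts C] [HasDuals C]
  {T : Type u₂} [Category.{v₂} T] [Abelian T] (Y : C ⥤ T) [Y.Additive] [Y.Full] [Y.Faithful]
  [hY : IsProjectiveRealization Y]

/-- There is a monoidal structure on `T` for which the coequalizer functor is monoidal: the one of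
the monoidal localization, which is a type synonym of `T`. -/
theorem exists_monoidalCategory :
    ∃ _ : MonoidalCategory T, Nonempty (reflCoeq Y).Monoidal := by
  have := isLocalization_reflCoeq Y
  let ε : (reflCoeq Y).obj (𝟙_ _) ≅ _ := Iso.refl _
  exact ⟨(inferInstance : MonoidalCategory (LocalizedMonoidal (reflCoeq Y) (reflW Y) ε)),
    ⟨(inferInstance :
      (Localization.Monoidal.toMonoidalCategory (reflCoeq Y) (reflW Y) ε).Monoidal)⟩⟩

/-- Every pair of parallel morphisms of `T` lifts to reflexive pairs. -/
theorem exists_lift_pair {N N' : T} (f g : N ⟶ N') :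
    ∃ (P P' : WalkingReflexivePair ⥤ C) (a : (reflCoeq Y).obj P ≅ N) (b : (reflCoeq Y).obj P' ≅ N')
      (φ ψ : P ⟶ P'), f = a.inv ≫ (reflCoeq Y).map φ ≫ b.hom ∧
        g = a.inv ≫ (reflCoeq Y).map ψ ≫ b.hom := by
  have := hasBinaryBiproducts_of_finite_biproducts C
  obtain ⟨P, hP, ⟨a⟩⟩ := exists_cofibrant_iso Y (fun h h' => h.biprod h') N
  obtain ⟨P', hP', ⟨b⟩⟩ := exists_cofibrant_iso Y (fun h h' => h.biprod h') N'
  obtain ⟨φ, hφ⟩ := exists_map_eq_of_cofibrant Y hP (a.hom ≫ f ≫ b.inv)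
  obtain ⟨ψ, hψ⟩ := exists_map_eq_of_cofibrant Y hP (a.hom ≫ g ≫ b.inv)
  exact ⟨P, P', a, b, φ, ψ, by rw [hφ]; simp, by rw [hψ]; simp⟩

variable [MonoidalCategory T] [(reflCoeq Y).Monoidal]

include Y in
theorem monoidalPreadditive_of_reflCoeq : MonoidalPreadditive T :=
  monoidalPreadditive_of_lift (reflCoeq Y) (exists_lift_pair Y)

include Y in
theorem monoidalLinear_of_reflCoeq (k : Type t) [Field k] [Linear k C] [MonoidalLinear k C]
    [Linear k T] [Y.Linear k] [MonoidalPreadditive T] : MonoidalLinear k T :=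
  monoidalLinear_of_lift (reflCoeq Y) (exists_lift_pair Y) k

/-- The monoidal structure on `Y` induced by a monoidal structure on the coequalizer functor. -/
@[reducible]
noncomputable def monoidalOfReflCoeq : Y.Monoidal :=
  Functor.Monoidal.transport (constReflCoeqIso Y)

end Exists

/-! ### Exactness of the tensor product -/

section Exactness

variable {T : Type u₂} [Category.{v₂} T] [Abelian T] {T' : Type u₃} [Category.{v₃} T'] [Abelian T']

/-- An exact functor with projective values sends exact complexes to split exact complexes. -/
theorem isSplitExact_map_of_projective {S : ShortComplex T} (hS : S.Exact) (G : T ⥤ T')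
    [G.Additive] [PreservesFiniteLimits G] [PreservesFiniteColimits G]
    (hG : ∀ M, Projective (G.obj M)) :
    IsSplitExact (G.map S.f) (G.map S.g) := by
  have := hG S.X₂
  have := hG S.X₃
  have := hG (cokernel S.g)
  let c := G.map (cokernel.π S.g)
  have : Epi c := inferInstance
  let σ := Projective.factorThru (𝟙 _) c
  have hσ : σ ≫ c = 𝟙 _ := Projective.factorThru_comp _ _
  have hgc : G.map S.g ≫ c = 0 := by rw [← G.map_comp, cokernel.condition, G.map_zero]
  -- the complex is exact at `S.X₃` after adding the cokernel of `S.g`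
  have h₃ := (ShortComplex.exact_of_g_is_cokernel (ShortComplex.mk S.g _ (cokernel.condition S.g))
    (cokernelIsCokernel S.g)).map G
  have h₂ := hS.map G
  have ht : (𝟙 _ - c ≫ σ) ≫ c = 0 := by simp [hσ]
  let t : G.obj S.X₃ ⟶ G.obj S.X₂ := h₃.liftFromProjective (𝟙 _ - c ≫ σ) ht
  have ht' : t ≫ G.map S.g = 𝟙 _ - c ≫ σ := h₃.liftFromProjective_comp _ ht
  have hr : (𝟙 _ - G.map S.g ≫ t) ≫ G.map S.g = 0 := by
    simp [ht', reassoc_of% hgc]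
  let r : G.obj S.X₂ ⟶ G.obj S.X₁ := h₂.liftFromProjective (𝟙 _ - G.map S.g ≫ t) hr
  have hr' : r ≫ G.map S.f = 𝟙 _ - G.map S.g ≫ t := h₂.liftFromProjective_comp _ hr
  exact ⟨by rw [← G.map_comp, S.zero, G.map_zero], r, t, by rw [hr', sub_add_cancel]⟩

theorem IsSplitExact.shortComplex_exact {X Y Z : T} {f : X ⟶ Y} {g : Y ⟶ Z}
    (h : IsSplitExact f g) : (ShortComplex.mk f g h.1).Exact := by
  rw [ShortComplex.exact_iff_exact_up_to_refinements]
  intro A y hy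
  obtain ⟨x, hx⟩ := h.exact y hy
  exact ⟨A, 𝟙 A, inferInstance, x, by rw [hx, Category.id_comp]⟩

/-- An additive functor is exact as soon as it is compatible with an exact functor with projective
values and with a faithful exact functor. -/
theorem exact_of_projective (F : T ⥤ T') [F.Additive] (G : T ⥤ T) [G.Additive]
    [PreservesFiniteLimits G] [PreservesFiniteColimits G] (hG : ∀ M, Projective (G.obj M))
    (G' : T' ⥤ T') [G'.Additive] [G'.Faithful] (e : G ⋙ F ≅ F ⋙ G') :
    PreservesFiniteLimits F ∧ PreservesFiniteColimits F := by
  refine (Functor.exact_tfae F).out 1 3 |>.1 fun S hS => ?_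
  apply G'.reflects_exact_of_faithful
  have h := ((isSplitExact_map_of_projective hS G hG).map F).shortComplex_exact
  exact ShortComplex.exact_of_iso (ShortComplex.isoMk (e.app _) (e.app _) (e.app _)
    (e.hom.naturality S.f).symm (e.hom.naturality S.g).symm) h

end Exactness

section Duals

variable {C : Type u₁} [Category.{v₁} C] [MonoidalCategory C] {D : Type u₂} [Category.{v₂} D]
  [MonoidalCategory D]

open Functor.LaxMonoidal Functor.OplaxMonoidal Functor.Monoidal

/-- A monoidal functor preserves exact pairings. -/
@[reducible]
def mapExactPairing (F : C ⥤ D) [F.Monoidal] (X X' : C) [ExactPairing X X'] :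
    ExactPairing (F.obj X) (F.obj X') where
  coevaluation' := ε F ≫ F.map (η_ X X') ≫ δ F X X'
  evaluation' := μ F X' X ≫ F.map (ε_ X X') ≫ η F
  coevaluation_evaluation' := by
    have h := congrArg F.map (ExactPairing.coevaluation_evaluation X X')
    rw [map_associator_inv' F]
    simp only [MonoidalCategory.whiskerLeft_comp, comp_whiskerRight, Category.assoc,
      whiskerLeft_δ_μ_assoc, whiskerRight_δ_μ_assoc, μ_natural_right_assoc,
      δ_natural_left_assoc]
    rw [← F.map_comp_assoc, ← F.map_comp_assoc, Category.assoc, h]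
    simp
  evaluation_coevaluation' := by
    have h := congrArg F.map (ExactPairing.evaluation_coevaluation X X')
    rw [map_associator' F]
    simp only [MonoidalCategory.whiskerLeft_comp, comp_whiskerRight, Category.assoc,
      whiskerLeft_δ_μ_assoc, whiskerRight_δ_μ_assoc, μ_natural_left_assoc,
      δ_natural_right_assoc]
    rw [← F.map_comp_assoc, ← F.map_comp_assoc, Category.assoc, h]
    simp

end Duals

/-! ### Duals of cokernels -/

section Duals

variable {T : Type u₂} [Category.{v₂} T] [Abelian T] [MonoidalCategory T] [MonoidalPreadditive T]

theorem exists_lift_map_kernel_ι (G : T ⥤ T) [G.Additive] [PreservesFiniteLimits G] {X Z W : T}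
    (f : X ⟶ Z) (w : W ⟶ G.obj X) (hw : w ≫ G.map f = 0) : ∃ x, x ≫ G.map (kernel.ι f) = w :=
  ⟨_, (KernelFork.IsLimit.lift' (KernelFork.mapIsLimit _ (kernelIsKernel f) G) w hw).2⟩

variable [∀ M : T, PreservesFiniteLimits (tensorLeft M)]
  [∀ M : T, PreservesFiniteLimits (tensorRight M)]
  [∀ M : T, PreservesFiniteColimits (tensorLeft M)]
  [∀ M : T, PreservesFiniteColimits (tensorRight M)]

/-- The kernel `K` of the dual morphism is a right dual of a cokernel `M` of `a : P ⟶ Q`: the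
coevaluation of `Q` lifts to `M ⊗ K`, and the evaluation of `Q` descends to `K ⊗ M`. -/
theorem exists_rightDual_of_isCoker {P Q M : T} [HasRightDual P] [HasRightDual Q] {a : P ⟶ Q}
    {q : Q ⟶ M} (h : IsCoker a q) : ∃ K, Nonempty (ExactPairing M K) := by
  let K := kernel (aᘁ)
  let i : K ⟶ Qᘁ := kernel.ι (aᘁ)
  have := h.epi
  have hMi : Mono (𝟙_ T ◁ i) := inferInstanceAs (Mono ((tensorLeft _).map (kernel.ι (aᘁ))))
  have hq : Epi (𝟙_ T ◁ q) := inferInstanceAs (Epi ((tensorLeft _).map q))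
  obtain ⟨(c : 𝟙_ T ⟶ M ⊗ K), (hc : c ≫ M ◁ i = _)⟩ := exists_lift_map_kernel_ι (tensorLeft M) (aᘁ)
    (η_ Q (Qᘁ) ≫ q ▷ Qᘁ) (by
      have : (η_ Q (Qᘁ) ≫ q ▷ Qᘁ) ≫ M ◁ aᘁ = 0 := by
        rw [Category.assoc, ← whisker_exchange, coevaluation_comp_rightAdjointMate_assoc,
          ← comp_whiskerRight, h.zero, MonoidalPreadditive.zero_whiskerRight, comp_zero]
      exact this)
  obtain ⟨(e : K ⊗ M ⟶ 𝟙_ T), (he : K ◁ q ≫ e = i ▷ Q ≫ ε_ Q (Qᘁ))⟩ :=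
    (h.map (tensorLeft K)).exists_desc
    (i ▷ Q ≫ ε_ Q (Qᘁ)) (by
      have : K ◁ a ≫ i ▷ Q ≫ ε_ Q (Qᘁ) = 0 := by
        rw [whisker_exchange_assoc, ← rightAdjointMate_comp_evaluation, ← comp_whiskerRight_assoc,
          kernel.condition, MonoidalPreadditive.zero_whiskerRight, zero_comp]
      exact this)
  refine ⟨K, ⟨ExactPairing.mk c e ?_ ?_⟩⟩
  · rw [← cancel_mono (𝟙_ T ◁ i)]
    calc (K ◁ c ≫ (α_ _ _ _).inv ≫ e ▷ K) ≫ 𝟙_ T ◁ i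
        = K ◁ (c ≫ M ◁ i) ≫ (α_ _ _ _).inv ≫ e ▷ _ := by
          rw [Category.assoc, Category.assoc, ← whisker_exchange, tensor_whiskerLeft]
          simp
      _ = K ◁ η_ Q (Qᘁ) ≫ (α_ _ _ _).inv ≫ (K ◁ q ≫ e) ▷ _ := by
          rw [hc]
          simp
      _ = i ▷ _ ≫ Qᘁ ◁ η_ Q (Qᘁ) ≫ (α_ _ _ _).inv ≫ ε_ Q (Qᘁ) ▷ _ := by
          rw [he, ← whisker_exchange_assoc, whiskerRight_tensor]
          simp
      _ = _ := by
          simp [id_whiskerLeft]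
  · rw [← cancel_epi (𝟙_ T ◁ q)]
    calc 𝟙_ T ◁ q ≫ c ▷ M ≫ (α_ _ _ _).hom ≫ M ◁ e
        = c ▷ Q ≫ (α_ _ _ _).hom ≫ M ◁ (K ◁ q ≫ e) := by
          rw [whisker_exchange_assoc]
          simp
      _ = (c ≫ M ◁ i) ▷ Q ≫ (α_ _ _ _).hom ≫ M ◁ ε_ Q (Qᘁ) := by
          rw [he]
          simp
      _ = (η_ Q (Qᘁ) ▷ Q ≫ (α_ _ _ _).hom ≫ Q ◁ ε_ Q (Qᘁ)) ≫ q ▷ _ := by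
          rw [hc, Category.assoc, Category.assoc, whisker_exchange, whiskerRight_tensor]
          simp
      _ = _ := by
          simp

/-- The kernel `K` of the dual morphism is a left dual of a cokernel `M` of `a : P ⟶ Q`. -/
theorem exists_leftDual_of_isCoker {P Q M : T} [HasLeftDual P] [HasLeftDual Q] {a : P ⟶ Q}
    {q : Q ⟶ M} (h : IsCoker a q) : ∃ K, Nonempty (ExactPairing K M) := by
  let a' : (ᘁQ : T) ⟶ (ᘁP : T) := leftAdjointMate a
  let K := kernel a'
  let i : K ⟶ (ᘁQ : T) := kernel.ι a'
  have := h.epi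
  have hMi : Mono (i ▷ 𝟙_ T) := inferInstanceAs (Mono ((tensorRight _).map (kernel.ι a')))
  have hq : Epi (q ▷ 𝟙_ T) := inferInstanceAs (Epi ((tensorRight _).map q))
  obtain ⟨(c : 𝟙_ T ⟶ K ⊗ M), (hc : c ≫ i ▷ M = _)⟩ := exists_lift_map_kernel_ι (tensorRight M) a'
    (η_ (ᘁQ : T) Q ≫ (ᘁQ : T) ◁ q) (by
      have : (η_ (ᘁQ : T) Q ≫ (ᘁQ : T) ◁ q) ≫ a' ▷ M = 0 := by
        rw [Category.assoc, whisker_exchange, coevaluation_comp_leftAdjointMate_assoc,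
          ← MonoidalCategory.whiskerLeft_comp, h.zero, MonoidalPreadditive.whiskerLeft_zero,
          comp_zero]
      exact this)
  obtain ⟨(e : M ⊗ K ⟶ 𝟙_ T), (he : q ▷ K ≫ e = Q ◁ i ≫ ε_ (ᘁQ : T) Q)⟩ :=
    (h.map (tensorRight K)).exists_desc
    (Q ◁ i ≫ ε_ (ᘁQ : T) Q) (by
      have : a ▷ K ≫ Q ◁ i ≫ ε_ (ᘁQ : T) Q = 0 := by
        rw [← whisker_exchange_assoc, ← leftAdjointMate_comp_evaluation,
          ← MonoidalCategory.whiskerLeft_comp_assoc,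
          kernel.condition, MonoidalPreadditive.whiskerLeft_zero, zero_comp]
      exact this)
  refine ⟨K, ⟨ExactPairing.mk c e ?_ ?_⟩⟩
  · rw [← cancel_epi (q ▷ 𝟙_ T)]
    calc q ▷ 𝟙_ T ≫ M ◁ c ≫ (α_ _ _ _).inv ≫ e ▷ M
        = Q ◁ c ≫ (α_ _ _ _).inv ≫ (q ▷ K ≫ e) ▷ M := by
          rw [← whisker_exchange_assoc]
          simp
      _ = Q ◁ (c ≫ i ▷ M) ≫ (α_ _ _ _).inv ≫ ε_ (ᘁQ : T) Q ▷ M := by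
          rw [he]
          simp
      _ = (Q ◁ η_ (ᘁQ : T) Q ≫ (α_ _ _ _).inv ≫ ε_ (ᘁQ : T) Q ▷ Q) ≫ _ ◁ q := by
          rw [hc, Category.assoc, Category.assoc, ← whisker_exchange, tensor_whiskerLeft]
          simp
      _ = _ := by
          simp
  · rw [← cancel_mono (i ▷ 𝟙_ T)]
    calc (c ▷ K ≫ (α_ _ _ _).hom ≫ K ◁ e) ≫ i ▷ 𝟙_ T
        = (c ≫ i ▷ M) ▷ K ≫ (α_ _ _ _).hom ≫ _ ◁ e := by
          rw [Category.assoc, Category.assoc, whisker_exchange, whiskerRight_tensor]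
          simp
      _ = η_ (ᘁQ : T) Q ▷ K ≫ (α_ _ _ _).hom ≫ _ ◁ (q ▷ K ≫ e) := by
          rw [hc]
          simp
      _ = _ ◁ i ≫ η_ (ᘁQ : T) Q ▷ _ ≫ (α_ _ _ _).hom ≫ _ ◁ ε_ (ᘁQ : T) Q := by
          rw [he, whisker_exchange_assoc]
          simp
      _ = _ := by
          simp

end Duals

/-! ### Tensoring with the images of global splitting objects -/

section Projective

variable {C : Type u₁} [Category.{v₁} C] [Preadditive C] [MonoidalCategory C]
  [MonoidalPreadditive C] [HasDuals C] [IsIdempotentComplete C]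
  {T : Type u₂} [Category.{v₂} T] [Abelian T] [MonoidalCategory T] [MonoidalPreadditive T]
  (Y : C ⥤ T) [Y.Additive] [Y.Full] [Y.Faithful] [Y.Monoidal] [hY : IsProjectiveRealization Y]

open Functor.LaxMonoidal Functor.OplaxMonoidal Functor.Monoidal

section Preserves

variable {C : Type u₁} [Category.{v₁} C] [MonoidalCategory C] [HasDuals C]
  {T : Type u₂} [Category.{v₂} T] [MonoidalCategory T] (Y : C ⥤ T) [Y.Monoidal] (X : C)

theorem exists_rightDual_map : ∃ X', Nonempty (ExactPairing (Y.obj X) X') := by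
  obtain ⟨X', ⟨_⟩⟩ := HasDuals.exists_right X
  exact ⟨_, ⟨mapExactPairing Y X X'⟩⟩

theorem exists_leftDual_map : ∃ X', Nonempty (ExactPairing X' (Y.obj X)) := by
  obtain ⟨X', ⟨_⟩⟩ := HasDuals.exists_left X
  exact ⟨_, ⟨mapExactPairing Y X' X⟩⟩

theorem preservesFiniteColimits_tensorLeft_map :
    PreservesFiniteColimits (tensorLeft (Y.obj X)) := by
  obtain ⟨X', ⟨_⟩⟩ := exists_leftDual_map Y X
  have := (tensorLeftAdjunction X' (Y.obj X)).leftAdjoint_preservesColimits.{0, 0}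
  infer_instance

theorem preservesFiniteLimits_tensorLeft_map :
    PreservesFiniteLimits (tensorLeft (Y.obj X)) := by
  obtain ⟨X', ⟨_⟩⟩ := exists_rightDual_map Y X
  have := (tensorLeftAdjunction (Y.obj X) X').rightAdjoint_preservesLimits.{0, 0}
  infer_instance

theorem preservesFiniteColimits_tensorRight_map :
    PreservesFiniteColimits (tensorRight (Y.obj X)) := by
  obtain ⟨X', ⟨_⟩⟩ := exists_rightDual_map Y X
  have := (tensorRightAdjunction (Y.obj X) X').leftAdjoint_preservesColimits.{0, 0}
  infer_instance

theorem preservesFiniteLimits_tensorRight_map :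
    PreservesFiniteLimits (tensorRight (Y.obj X)) := by
  obtain ⟨X', ⟨_⟩⟩ := exists_leftDual_map Y X
  have := (tensorRightAdjunction X' (Y.obj X)).rightAdjoint_preservesLimits.{0, 0}
  infer_instance

end Preserves

include hY in
/-- The image of a split morphism of global splitting objects has a projective cokernel. -/
theorem projective_of_isCoker_map {X₁ X₀ : C} {a : X₁ ⟶ X₀} (ha : IsSplit a)
    (h₀ : globalSplitting C X₀) {M : T} {p : Y.obj X₀ ⟶ M} (h : IsCoker (Y.map a) p) :
    Projective M := by
  obtain ⟨Z, g, s, hg, hs⟩ := ha.exists_isCoker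
  have hZ : globalSplitting C Z := h₀.of_retract s g hs
  have h' : IsCoker (Y.map a) (Y.map g) := ((hg.isSplitExact ha).1.map Y).isCoker
    (s := Y.map s) (by rw [← Y.map_comp, hs, Y.map_id])
  obtain ⟨e, -⟩ := h.exists_iso h'
  have := hY.projective hZ
  exact Projective.of_iso e.symm inferInstance

/-- For a presentation `X₁ ⟶ X₀` of `M`, the object `M ⊗ Y S` is the cokernel of the image of the
split morphism `X₁ ⊗ S ⟶ X₀ ⊗ S`. -/
theorem projective_tensor_map {S : C} (hS : globalSplitting C S) (M : T) :
    Projective (M ⊗ Y.obj S) := by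
  obtain ⟨X₁, X₀, a, p, h₁, h₀, h⟩ := exists_presentation Y M
  have := preservesFiniteColimits_tensorRight_map Y S
  have h' : IsCoker (Y.map a ▷ Y.obj S) (p ▷ Y.obj S) := h.map (tensorRight (Y.obj S))
  refine projective_of_isCoker_map Y (hS a).2 (hS.tensor_left X₀)
    (p := δ Y _ _ ≫ p ▷ Y.obj S) (h'.of_iso (μIso Y _ _) (μIso Y _ _) (Iso.refl _) ?_ ?_)
  · simp
  · simp

theorem projective_map_tensor {S : C} (hS : globalSplitting C S) (M : T) :
    Projective (Y.obj S ⊗ M) := by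
  obtain ⟨X₁, X₀, a, p, h₁, h₀, h⟩ := exists_presentation Y M
  have := preservesFiniteColimits_tensorLeft_map Y S
  have h' : IsCoker (Y.obj S ◁ Y.map a) (Y.obj S ◁ p) := h.map (tensorLeft (Y.obj S))
  refine projective_of_isCoker_map Y (hS a).1 (hS.tensor_right X₀)
    (p := δ Y _ _ ≫ Y.obj S ◁ p) (h'.of_iso (μIso Y _ _) (μIso Y _ _) (Iso.refl _) ?_ ?_)
  · simp
  · simp

end Projective

/-! ### Essential smallness -/

section Small

variable {C : Type u₁} [Category.{v₁} C] [Preadditive C] [MonoidalCategory C]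
  {T : Type u₂} [Category.{v₂} T] [Abelian T] (Y : C ⥤ T) [Y.Additive] [Y.Full] [Y.Faithful]
  [hY : IsProjectiveRealization Y]

include hY in
theorem essentiallySmall_of_realization [EssentiallySmall.{w} C] : EssentiallySmall.{w} T := by
  rw [essentiallySmall_iff]
  constructor
  · let e := equivSmallModel.{w} C
    let Φ (a : Σ X₁ X₀ : SmallModel.{w} C, X₁ ⟶ X₀) : Skeleton T :=
      toSkeleton (cokernel (Y.map (e.inverse.map a.2.2)))
    refine small_of_surjective (f := Φ) fun M => ?_
    obtain ⟨X₁, X₀, a, p, -, -, h⟩ := exists_presentation Y ((fromSkeleton T).obj M)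
    refine ⟨⟨e.functor.obj X₁, e.functor.obj X₀, e.functor.map a⟩, ?_⟩
    let i := cokernel.mapIso (Y.map a) (Y.map (e.inverse.map (e.functor.map a)))
      (Y.mapIso (e.unitIso.app X₁)) (Y.mapIso (e.unitIso.app X₀)) (by
        have := e.unitIso.hom.naturality a
        exact (Y.map_comp _ _).symm.trans ((congrArg Y.map this).trans (Y.map_comp _ _)))
    let j := (cokernelIsCokernel (Y.map a)).coconePointUniqueUpToIso h.isColimit
    have k : toSkeleton ((fromSkeleton T).obj M) = M := Quotient.out_eq M
    rw [← k]
    exact Quotient.sound ⟨i.symm ≪≫ j⟩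
  · refine ⟨fun M N => ?_⟩
    obtain ⟨X, p, hX, _⟩ := hY.exists_epi M
    obtain ⟨X', q, -, _⟩ := hY.exists_epi N
    have := hY.projective hX
    have : Small.{w} (Y.obj X ⟶ N) :=
      small_of_surjective (f := fun f : X ⟶ X' => Y.map f ≫ q) fun g =>
        ⟨Y.preimage (Projective.factorThru g q), by simp⟩
    exact small_of_injective (f := fun g : M ⟶ N => p ≫ g) fun g g' h => by
      simpa [cancel_epi] using h

end Small

/-! ### The realization is a tensor category -/

section TensorCategory

/-- Tensoring with `U` is faithful if some `U ⟶ 𝟙` remains an epimorphism after tensoring. -/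
theorem faithful_tensorRight_of_epi {T : Type u₂} [Category.{v₂} T] [MonoidalCategory T] {U : T}
    (g : U ⟶ 𝟙_ T) (hg : ∀ M : T, Epi (M ◁ g)) : (tensorRight U).Faithful where
  map_injective {M N} f f' h := by
    have h : f ▷ U = f' ▷ U := h
    have := hg M
    have : f ▷ 𝟙_ T = f' ▷ 𝟙_ T := by
      rw [← cancel_epi (M ◁ g), whisker_exchange, h, whisker_exchange]
    simpa [cancel_epi, cancel_mono] using this

theorem faithful_tensorLeft_of_epi {T : Type u₂} [Category.{v₂} T] [MonoidalCategory T] {U : T}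
    (g : U ⟶ 𝟙_ T) (hg : ∀ M : T, Epi (g ▷ M)) : (tensorLeft U).Faithful where
  map_injective {M N} f f' h := by
    have h : U ◁ f = U ◁ f' := h
    have := hg M
    have : 𝟙_ T ◁ f = 𝟙_ T ◁ f' := by
      rw [← cancel_epi (g ▷ M), ← whisker_exchange, h, whisker_exchange]
    simpa [cancel_epi, cancel_mono] using this

variable {C : Type u₁} [Category.{v₁} C] [Preadditive C] [MonoidalCategory C]
  [MonoidalPreadditive C] [HasDuals C] [IsIdempotentComplete C]
  {T : Type u₂} [Category.{v₂} T] [Abelian T] [MonoidalCategory T] [MonoidalPreadditive T]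
  (Y : C ⥤ T) [Y.Additive] [Y.Full] [Y.Faithful] [Y.Monoidal] [hY : IsProjectiveRealization Y]
  (hC : UnitHasSplittingPresentation C)

open Functor.LaxMonoidal Functor.OplaxMonoidal Functor.Monoidal

include hY in
/-- The unit is a quotient of the image of a global splitting object, and it remains so after
tensoring with any object. -/
theorem exists_epi_unit (hC : UnitHasSplittingPresentation C) :
    ∃ (S : C) (g : S ⟶ 𝟙_ C), globalSplitting C S ∧
      ∀ M : T, Epi (M ◁ (Y.map g ≫ η Y)) ∧ Epi ((Y.map g ≫ η Y) ▷ M) := by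
  obtain ⟨S', S, f, g, zero, hS', hS, ⟨h⟩⟩ := hC
  have hg := isCoker_of_isColimit zero h
  refine ⟨S, g, hS, fun M => ?_⟩
  obtain ⟨X, p, hX, _⟩ := hY.exists_epi M
  obtain ⟨-, s, hs⟩ := (hg.whiskerLeft X).isSplitExact (hX f).1
  obtain ⟨-, s', hs'⟩ := (hg.whiskerRight X).isSplitExact (hX f).2
  constructor
  · have : Epi (Y.obj X ◁ (Y.map g ≫ η Y)) := by
      have : IsSplitEpi (Y.map (X ◁ g)) := ⟨⟨Y.map s, by rw [← Y.map_comp, hs, Y.map_id]⟩⟩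
      have e : Y.obj X ◁ (Y.map g ≫ η Y) = μ Y _ _ ≫ Y.map (X ◁ g) ≫ δ Y _ _ ≫ Y.obj X ◁ η Y := by
        rw [map_whiskerLeft]
        simp only [Category.assoc, μ_δ_assoc, MonoidalCategory.whiskerLeft_comp]
      rw [e]
      infer_instance
    have : Epi (p ▷ 𝟙_ T) := by
      have e : p ▷ 𝟙_ T = (ρ_ _).hom ≫ p ≫ (ρ_ _).inv := by simp
      rw [e]
      infer_instance
    have e := whisker_exchange p (Y.map g ≫ η Y)
    have : Epi (p ▷ Y.obj S ≫ M ◁ (Y.map g ≫ η Y)) := by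
      rw [← e]
      infer_instance
    exact epi_of_epi (p ▷ Y.obj S) _
  · have : Epi ((Y.map g ≫ η Y) ▷ Y.obj X) := by
      have : IsSplitEpi (Y.map (g ▷ X)) := ⟨⟨Y.map s', by rw [← Y.map_comp, hs', Y.map_id]⟩⟩
      have e : (Y.map g ≫ η Y) ▷ Y.obj X = μ Y _ _ ≫ Y.map (g ▷ X) ≫ δ Y _ _ ≫ η Y ▷ Y.obj X := by
        rw [map_whiskerRight]
        simp only [Category.assoc, μ_δ_assoc, comp_whiskerRight]
      rw [e]
      infer_instance
    have : Epi (𝟙_ T ◁ p) := by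
      have e : 𝟙_ T ◁ p = (λ_ _).hom ≫ p ≫ (λ_ _).inv := by simp
      rw [e]
      infer_instance
    have e := whisker_exchange (Y.map g ≫ η Y) p
    have : Epi (Y.obj S ◁ p ≫ (Y.map g ≫ η Y) ▷ M) := by
      rw [e]
      infer_instance
    exact epi_of_epi (Y.obj S ◁ p) _

include hY hC

theorem exact_tensorLeft (M : T) :
    PreservesFiniteLimits (tensorLeft M) ∧ PreservesFiniteColimits (tensorLeft M) := by
  obtain ⟨S, g, hS, hg⟩ := exists_epi_unit Y hC
  have := preservesFiniteColimits_tensorRight_map Y S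
  have := preservesFiniteLimits_tensorRight_map Y S
  have := faithful_tensorRight_of_epi _ fun M => (hg M).1
  exact exact_of_projective (tensorLeft M) (tensorRight (Y.obj S))
    (fun N => projective_tensor_map Y hS N) (tensorRight (Y.obj S))
    (NatIso.ofComponents (fun N => (α_ M N (Y.obj S)).symm) fun f => by simp)

theorem exact_tensorRight (M : T) :
    PreservesFiniteLimits (tensorRight M) ∧ PreservesFiniteColimits (tensorRight M) := by
  obtain ⟨S, g, hS, hg⟩ := exists_epi_unit Y hC
  have := preservesFiniteColimits_tensorLeft_map Y S
  have := preservesFiniteLimits_tensorLeft_map Y S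
  have := faithful_tensorLeft_of_epi _ fun M => (hg M).2
  exact exact_of_projective (tensorRight M) (tensorLeft (Y.obj S))
    (fun N => projective_map_tensor Y hS N) (tensorLeft (Y.obj S))
    (NatIso.ofComponents (fun N => α_ (Y.obj S) N M) fun f => by simp)

theorem hasDuals_of_realization : HasDuals T := by
  have := fun M : T => (exact_tensorLeft Y hC M).1
  have := fun M : T => (exact_tensorLeft Y hC M).2
  have := fun M : T => (exact_tensorRight Y hC M).1
  have := fun M : T => (exact_tensorRight Y hC M).2
  constructor
  · intro M
    obtain ⟨X₁, X₀, a, p, h₁, h₀, h⟩ := exists_presentation Y M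
    obtain ⟨X₁', ⟨e₁⟩⟩ := exists_rightDual_map Y X₁
    obtain ⟨X₀', ⟨e₀⟩⟩ := exists_rightDual_map Y X₀
    let : HasRightDual (Y.obj X₁) := ⟨X₁'⟩
    let : HasRightDual (Y.obj X₀) := ⟨X₀'⟩
    exact exists_rightDual_of_isCoker h
  · intro M
    obtain ⟨X₁, X₀, a, p, h₁, h₀, h⟩ := exists_presentation Y M
    obtain ⟨X₁', ⟨e₁⟩⟩ := exists_leftDual_map Y X₁
    obtain ⟨X₀', ⟨e₀⟩⟩ := exists_leftDual_map Y X₀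
    let : HasLeftDual (Y.obj X₁) := ⟨X₁'⟩
    let : HasLeftDual (Y.obj X₀) := ⟨X₀'⟩
    exact exists_leftDual_of_isCoker h

theorem isTensorCategory_of_realization (k : Type t) [Field k] [Linear k C]
    [h : IsPseudoTensorCategory.{w} k C] [Linear k T] [MonoidalLinear k T] [Y.Linear k] :
    IsTensorCategory.{w} k T := by
  have := hasDuals_of_realization Y hC
  have := h.essentiallySmall
  have := essentiallySmall_of_realization.{w} Y
  let e : (𝟙_ C ⟶ 𝟙_ C) ≃ₗ[k] (𝟙_ T ⟶ 𝟙_ T) :=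
    (LinearEquiv.ofBijective (Y.mapLinearMap k) ⟨Y.map_injective, Y.map_surjective⟩).trans
      (Linear.homCongr k (εIso Y).symm (εIso Y).symm)
  have := Abelian.hasFiniteBiproducts (C := T)
  exact
    { nonempty_hasLeftDual := fun X => by
        obtain ⟨X', ⟨_⟩⟩ := HasDuals.exists_left X
        exact ⟨⟨X'⟩⟩
      nonempty_hasRightDual := fun X => by
        obtain ⟨X', ⟨_⟩⟩ := HasDuals.exists_right X
        exact ⟨⟨X'⟩⟩
      finrank_end_unit := by rw [← e.finrank_eq, h.finrank_end_unit] }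

end TensorCategory

/-! ### The unit of a tensor category -/

section EndUnit

variable {C : Type u} [Category.{v} C] [Preadditive C] [MonoidalCategory C]

variable (C) in
/-- The endomorphism ring of the unit is a division ring. -/
class IsDivisionUnit : Prop where
  id_ne_zero : 𝟙 (𝟙_ C) ≠ 0
  isIso : ∀ f : 𝟙_ C ⟶ 𝟙_ C, f ≠ 0 → IsIso f

theorem isDivisionUnit_of_isPseudoTensorCategory (k : Type t) [Field k] [Linear k C]
    [h : IsPseudoTensorCategory.{w} k C] : IsDivisionUnit C := by
  have h1 := h.finrank_end_unit
  have h0 : 𝟙 (𝟙_ C) ≠ 0 := by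
    intro h0
    have : Subsingleton (𝟙_ C ⟶ 𝟙_ C) :=
      ⟨fun f g => by rw [← Category.comp_id f, ← Category.comp_id g, h0, comp_zero, comp_zero]⟩
    rw [Module.finrank_zero_of_subsingleton] at h1
    exact zero_ne_one h1
  refine ⟨h0, fun f hf => ?_⟩
  obtain ⟨c, hc⟩ := (finrank_eq_one_iff_of_nonzero' (𝟙 (𝟙_ C)) h0).1 h1 f
  have hc0 : c ≠ 0 := by
    rintro rfl
    exact hf (by rw [← hc, zero_smul])
  refine ⟨c⁻¹ • 𝟙 _, ?_, ?_⟩ <;> simp [← hc, smul_smul, hc0]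

end EndUnit

theorem evaluation_ne_zero {C : Type u} [Category.{v} C] [Preadditive C] [MonoidalCategory C]
    [MonoidalPreadditive C] {M M' : C} [ExactPairing M M'] (hM : ¬ IsZero M) : ε_ M M' ≠ 0 := by
  intro h
  have e := ExactPairing.evaluation_coevaluation M M'
  rw [h, MonoidalPreadditive.whiskerLeft_zero, comp_zero, comp_zero] at e
  have e' : 𝟙 M = (λ_ M).inv ≫ ((λ_ M).hom ≫ (ρ_ M).inv) ≫ (ρ_ M).hom := by simp
  rw [← e, zero_comp, comp_zero] at e'
  exact hM ((IsZero.iff_id_eq_zero _).2 e')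

section IsZero

theorem isZero_of_epi_mono_zero {T : Type u} [Category.{v} T] [Preadditive T] {X Y Z : T}
    (p : X ⟶ Y) (i : Y ⟶ Z) [Epi p] [Mono i]
    (h : p ≫ i = 0) : IsZero Y := by
  rw [IsZero.iff_id_eq_zero, ← cancel_epi p, ← cancel_mono i]
  simpa using h

variable {T : Type u} [Category.{v} T] [Preadditive T] [MonoidalCategory T] [MonoidalPreadditive T]

theorem IsZero.tensor_left {X : T} (hX : IsZero X) (A : T) : IsZero (A ⊗ X) := by
  rw [IsZero.iff_id_eq_zero, ← MonoidalCategory.whiskerLeft_id, hX.eq_of_src (𝟙 X) 0]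
  simp

theorem IsZero.tensor_right {X : T} (hX : IsZero X) (A : T) : IsZero (X ⊗ A) := by
  rw [IsZero.iff_id_eq_zero, ← id_whiskerRight, hX.eq_of_src (𝟙 X) 0]
  simp

end IsZero

section Abelian

/-- A tensor category is abelian. -/
@[reducible]
noncomputable def abelianOfIsTensorCategory (k : Type t) [Field k] (T : Type u) [Category.{v} T]
    [Preadditive T] [Linear k T] [MonoidalCategory T] [h : IsTensorCategory.{w} k T] :
    Abelian T :=
  haveI := h.hasFiniteBiproducts
  haveI := h.hasKernels
  haveI := h.hasCokernels
  haveI := h.isNormalMonoCategory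
  haveI := h.isNormalEpiCategory
  { has_finite_products := inferInstance }

variable {T : Type u} [Category.{v} T] [Abelian T] [MonoidalCategory T] [MonoidalPreadditive T]
  [HasDuals T]

/-- A subobject `U` of the unit is orthogonal to the quotient `V` of the unit by `U`. -/
theorem isZero_tensor_cokernel {U : T} (i : U ⟶ 𝟙_ T) [Mono i] : IsZero (U ⊗ cokernel i) := by
  have := epi_whiskerLeft U (cokernel.π i)
  have := mono_whiskerRight (cokernel i) i
  refine isZero_of_epi_mono_zero (U ◁ cokernel.π i) (i ▷ cokernel i) ?_
  rw [whisker_exchange]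
  simp [unitors_equal]

theorem isZero_cokernel_tensor {U : T} (i : U ⟶ 𝟙_ T) [Mono i] : IsZero (cokernel i ⊗ U) := by
  have := epi_whiskerRight U (cokernel.π i)
  have := mono_whiskerLeft (cokernel i) i
  refine isZero_of_epi_mono_zero (cokernel.π i ▷ U) (cokernel i ◁ i) ?_
  rw [← whisker_exchange]
  simp [← unitors_equal]

/-- An object annihilated by a subobject of the unit and by the corresponding quotient is zero. -/
theorem isZero_of_tensor {U : T} (i : U ⟶ 𝟙_ T) {I : T} (h₁ : IsZero (U ⊗ I))
    (h₂ : IsZero (cokernel i ⊗ I)) : IsZero I := by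
  have h : IsCoker i (cokernel.π i) :=
    isCoker_of_isColimit (cokernel.condition i) (cokernelIsCokernel i)
  have h' := h.whiskerRight I
  obtain ⟨s, hs⟩ := h'.exists_desc (𝟙 _) (h₁.eq_of_src _ _)
  have : 𝟙 (𝟙_ T ⊗ I) = 0 := by rw [← hs, h₂.eq_of_tgt (cokernel.π i ▷ I) 0, zero_comp]
  exact ((IsZero.iff_id_eq_zero _).2 this).of_iso (λ_ I).symm

/-- The dual `U'` of a subobject `U` of the unit is orthogonal to the quotient of the unit by
`U`. -/
theorem isZero_dual_tensor_cokernel {U U' : T} [ExactPairing U U'] (i : U ⟶ 𝟙_ T) [Mono i] :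
    IsZero (U' ⊗ cokernel i) := by
  -- `U` annihilates the image of `f` as a quotient of `cokernel i`, and `cokernel i` annihilates it
  -- as a subobject of `U ⊗ X`
  have key {X : T} (f : cokernel i ⟶ U ⊗ X) : f = 0 := by
    have := epi_whiskerLeft U (factorThruImage f)
    have := mono_whiskerLeft (cokernel i) (image.ι f)
    have hI : IsZero (image f) := by
      refine isZero_of_tensor i ?_ ?_
      · exact IsZero.of_epi (U ◁ factorThruImage f) (isZero_tensor_cokernel i)
      · exact IsZero.of_mono (cokernel i ◁ image.ι f)
          ((IsZero.tensor_right (isZero_cokernel_tensor i) X).of_iso (α_ _ _ _).symm)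
    rw [← image.fac f, hI.eq_of_src (image.ι f) 0, comp_zero]
  rw [IsZero.iff_id_eq_zero]
  apply (tensorLeftHomEquiv _ U U' _).injective
  rw [key (tensorLeftHomEquiv _ U U' _ _), key (tensorLeftHomEquiv _ U U' _ _)]

/-- The unit of a tensor category is simple. For a nonzero subobject `U` with right dual `U'`, the
morphism `U' ⊗ U ⟶ U'` is invertible, so that the evaluation extends to `p : U' ⟶ 𝟙`; composing with
the transpose of `i` gives an endomorphism `c` of the unit which is the identity on `U` and factors
through `U ⊗ U'`. As `c - 𝟙` kills `U`, it is not invertible, so `c = 𝟙`. But `c` kills the quotient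
of the unit by `U`, which therefore vanishes. -/
theorem isIso_of_mono_unit [IsDivisionUnit T] {U : T} (i : U ⟶ 𝟙_ T) [Mono i] (hi : i ≠ 0) :
    IsIso i := by
  obtain ⟨U', ⟨_⟩⟩ := HasDuals.exists_right U
  have hV := isZero_dual_tensor_cokernel (U' := U') i
  have h : IsCoker i (cokernel.π i) :=
    isCoker_of_isColimit (cokernel.condition i) (cokernelIsCokernel i)
  have hmono := mono_whiskerLeft U' i
  have hepi : Epi (U' ◁ i) := by
    refine Preadditive.epi_of_cancel_zero _ fun {W} t ht => ?_
    obtain ⟨s, rfl⟩ := (h.whiskerLeft U').exists_desc t ht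
    rw [hV.eq_of_src s 0, comp_zero]
  have : IsIso (U' ◁ i) := isIso_of_mono_of_epi _
  let p : U' ⊗ 𝟙_ T ⟶ 𝟙_ T := inv (U' ◁ i) ≫ ε_ U U'
  have hp : U' ◁ i ≫ p = ε_ U U' := by simp [p]
  let c : 𝟙_ T ⟶ 𝟙_ T := η_ U U' ≫ i ▷ U' ≫ (λ_ U').hom ≫ (ρ_ U').inv ≫ p
  have hc : i ≫ c = i := by
    let f : U ⊗ U' ⟶ U' := i ▷ U' ≫ (λ_ U').hom
    calc i ≫ c = (λ_ U).inv ≫ 𝟙_ T ◁ i ≫ η_ U U' ▷ 𝟙_ T ≫ (ρ_ _).hom ≫ f ≫ (ρ_ _).inv ≫ p := by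
          simp [c, f, ← unitors_equal]
      _ = (λ_ U).inv ≫ η_ U U' ▷ U ≫ ((U ⊗ U') ◁ i ≫ f ▷ 𝟙_ T) ≫ p := by
          rw [whisker_exchange_assoc]
          simp
      _ = (λ_ U).inv ≫ η_ U U' ▷ U ≫ f ▷ U ≫ ε_ U U' := by
          rw [whisker_exchange, Category.assoc, hp]
      _ = (λ_ U).inv ≫ η_ U U' ▷ U ≫ (α_ _ _ _).hom ≫ i ▷ (U' ⊗ U) ≫ 𝟙_ T ◁ ε_ U U' ≫
            (λ_ _).hom := by
          simp [f]
      _ = (λ_ U).inv ≫ (η_ U U' ▷ U ≫ (α_ _ _ _).hom ≫ U ◁ ε_ U U') ≫ i ▷ _ ≫ (λ_ _).hom := by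
          rw [← whisker_exchange_assoc]
          simp only [Category.assoc]
      _ = i := by
          rw [ExactPairing.evaluation_coevaluation]
          simp [unitors_equal]
  -- `c` kills `cokernel i`, as `U ⊗ U' ⊗ cokernel i = 0`
  by_cases hc1 : c = 𝟙 _
  · have hz : IsZero (cokernel i) := by
      rw [IsZero.iff_id_eq_zero]
      have : c ▷ cokernel i = 0 := by
        have e : c ▷ cokernel i = (η_ U U' ▷ cokernel i ≫ (α_ _ _ _).hom) ≫ (α_ _ _ _).inv ≫
            (i ▷ U' ≫ (λ_ U').hom ≫ (ρ_ U').inv ≫ p) ▷ cokernel i := by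
          simp [c]
        rw [e, (IsZero.tensor_left hV U).eq_of_tgt (η_ U U' ▷ cokernel i ≫ (α_ _ _ _).hom) 0,
          zero_comp]
      rw [hc1, id_whiskerRight] at this
      have h0 := (IsZero.iff_id_eq_zero _).2 this
      exact (IsZero.iff_id_eq_zero _).1 (h0.of_iso (λ_ _).symm)
    have : Epi i := Preadditive.epi_of_cancel_zero _ fun {W} t ht => by
      obtain ⟨s, rfl⟩ := h.exists_desc t ht
      rw [hz.eq_of_src s 0, comp_zero]
    exact isIso_of_mono_of_epi i
  · exfalso
    have := IsDivisionUnit.isIso (c - 𝟙 _) (sub_ne_zero.2 hc1)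
    apply hi
    rw [← cancel_mono (c - 𝟙 _), zero_comp, Preadditive.comp_sub, hc, Category.comp_id, sub_self]

theorem epi_of_ne_zero [IsDivisionUnit T] {U : T} (u : U ⟶ 𝟙_ T) (hu : u ≠ 0) : Epi u := by
  have : IsIso (image.ι u) := isIso_of_mono_unit _ fun h => hu (by
    rw [← image.fac u, h, comp_zero])
  rw [← image.fac u]
  infer_instance

/-- An epimorphism `u : U ⟶ 𝟙` is the coequalizer of `u ⊗ U` and `U ⊗ u`. -/
theorem isCoker_of_epi_unit {U : T} (u : U ⟶ 𝟙_ T) [Epi u] :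
    IsCoker (u ▷ U ≫ (λ_ U).hom - U ◁ u ≫ (ρ_ U).hom) u := by
  refine ⟨?_, inferInstance, fun {W} t ht => ?_⟩
  · rw [Preadditive.sub_comp, Category.assoc, Category.assoc, ← leftUnitor_naturality,
      ← rightUnitor_naturality, ← whisker_exchange_assoc, unitors_equal, sub_self]
  · have h : IsCoker (kernel.ι u) u := isCoker_kernel_ι u
    apply h.exists_desc
    have := epi_whiskerLeft (kernel u) u
    rw [← cancel_epi (ρ_ _).hom, ← cancel_epi (kernel u ◁ u), comp_zero, comp_zero]
    have e := congrArg (kernel.ι u ▷ U ≫ ·) ht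
    simp only [Preadditive.sub_comp, Preadditive.comp_sub, ← comp_whiskerRight_assoc,
      kernel.condition, comp_zero, Category.assoc, MonoidalPreadditive.zero_whiskerRight,
      zero_comp, zero_sub, neg_eq_zero] at e
    rw [← e, ← whisker_exchange_assoc, rightUnitor_naturality_assoc]

end Abelian

section Faithful

variable {T : Type u₂} [Category.{v₂} T] [Abelian T] [MonoidalCategory T] [MonoidalPreadditive T]
  [HasDuals T] [IsDivisionUnit T] {T' : Type u₃} [Category.{v₃} T'] [Abelian T']
  [MonoidalCategory T'] [MonoidalPreadditive T'] [IsDivisionUnit T']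

open Functor.LaxMonoidal Functor.OplaxMonoidal Functor.Monoidal

/-- An exact monoidal functor between tensor categories is faithful: it does not annihilate a
nonzero object `M`, as the evaluation of `M` is an epimorphism onto the unit. -/
theorem faithful_of_exact (F : T ⥤ T') [F.Monoidal] [F.Additive] [PreservesFiniteLimits F]
    [PreservesFiniteColimits F] : F.Faithful := by
  have key {M : T} (hM : IsZero (F.obj M)) : IsZero M := by
    obtain ⟨M', ⟨_⟩⟩ := HasDuals.exists_right M
    by_contra h
    have hε : ε_ M M' ≠ 0 := evaluation_ne_zero h
    have := epi_of_ne_zero _ hε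
    have hz : IsZero (F.obj (M' ⊗ M)) := (IsZero.tensor_left hM (F.obj M')).of_iso (μIso F _ _).symm
    have h1 : IsZero (F.obj (𝟙_ T)) := IsZero.of_epi (F.map (ε_ M M')) hz
    have h2 : IsZero (𝟙_ T') := h1.of_iso (εIso F)
    exact IsDivisionUnit.id_ne_zero ((IsZero.iff_id_eq_zero _).1 h2)
  refine ⟨fun {X Z} f g h => ?_⟩
  rw [← sub_eq_zero] at h ⊢
  rw [← F.map_sub] at h
  have hz : IsZero (F.obj (image (f - g))) := by
    refine isZero_of_epi_mono_zero (F.map (factorThruImage (f - g))) (F.map (image.ι (f - g))) ?_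
    rw [← F.map_comp, image.fac, h]
  rw [← image.fac (f - g), (key hz).eq_of_src (image.ι _) 0, comp_zero]

end Faithful

section Comparison

variable {C : Type u₁} [Category.{v₁} C] [Preadditive C] [MonoidalCategory C]

/-- Fully faithful additive functors reflect cokernels. -/
theorem IsCoker.of_map {D : Type u₂} [Category.{v₂} D] [Preadditive D] (F : C ⥤ D) [F.Full]
    [F.Faithful] [F.Additive] {X Y Z : C} {f : X ⟶ Y} {g : Y ⟶ Z}
    (h : IsCoker (F.map f) (F.map g)) : IsCoker f g := by
  have := h.epi
  refine ⟨F.map_injective (by rw [F.map_comp, h.zero, F.map_zero]), F.epi_of_epi_map this,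
    fun t ht => ?_⟩
  obtain ⟨s, hs⟩ := h.exists_desc (F.map t) (by rw [← F.map_comp, ht, F.map_zero])
  exact ⟨F.preimage s, F.map_injective (by simpa using hs)⟩

theorem mem_morUex_iff (p : Σ U : C, U ⟶ 𝟙_ C) : p ∈ morUex C ↔
    p ∈ morU C ∧ IsCoker (p.2 ▷ p.1 ≫ (λ_ p.1).hom - p.1 ◁ p.2 ≫ (ρ_ p.1).hom) p.2 := by
  refine and_congr_right fun _ => ⟨fun ⟨h, ⟨hc⟩⟩ => ⟨?_, Cofork.IsColimit.epi hc, fun t ht => ?_⟩,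
    fun h => ?_⟩
  · rw [Preadditive.sub_comp, h, sub_self]
  · exact ⟨_, (Cofork.IsColimit.desc' hc t
      (by rwa [Preadditive.sub_comp, sub_eq_zero] at ht)).2⟩
  · have := h.epi
    have hz := h.zero
    rw [Preadditive.sub_comp, sub_eq_zero] at hz
    refine ⟨hz, ⟨Cofork.IsColimit.mk' _ fun s => ?_⟩⟩
    have hs := h.exists_desc s.π (by rw [Preadditive.sub_comp, s.condition, sub_self])
    exact ⟨hs.choose, hs.choose_spec, fun hm => by
      rw [← cancel_epi p.2, hs.choose_spec]
      exact hm⟩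

open Functor.LaxMonoidal Functor.OplaxMonoidal Functor.Monoidal

/-- A nonzero morphism to the unit satisfies the exactness condition if there is a fully faithful
monoidal functor to a tensor category. -/
theorem morU_eq_morUex {T : Type u₂} [Category.{v₂} T] [Abelian T] [MonoidalCategory T]
    [MonoidalPreadditive T] [HasDuals T] [IsDivisionUnit T] (Y : C ⥤ T) [Y.Full] [Y.Faithful]
    [Y.Additive] [Y.Monoidal] : morU C = morUex C := by
  ext p
  rw [mem_morUex_iff]
  refine ⟨fun hp => ⟨hp, ?_⟩, fun h => h.1⟩
  obtain ⟨U, u⟩ := p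
  have hu : Y.map u ≫ η Y ≠ 0 := fun h => hp (Y.map_injective (by
    have := congrArg (· ≫ ε Y) h
    simpa using this))
  have := epi_of_ne_zero _ hu
  refine IsCoker.of_map Y ((isCoker_of_epi_unit (Y.map u ≫ η Y)).of_iso (μIso Y U U) (Iso.refl _)
    (εIso Y) ?_ ?_)
  · simp only [Iso.refl_hom, Category.comp_id, μIso_hom, Y.map_sub, Y.map_comp,
      Preadditive.comp_sub, ← μ_natural_left_assoc, ← μ_natural_right_assoc, map_leftUnitor,
      map_rightUnitor, μ_δ_assoc, comp_whiskerRight, MonoidalCategory.whiskerLeft_comp,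
      Category.assoc]
  · simp

/-- A presentation of the unit contains a nonzero global splitting object, as `𝟙 ≠ 0`. -/
theorem exists_not_isZero (hC : UnitHasSplittingPresentation C) [IsDivisionUnit C] :
    ∃ S : C, globalSplitting C S ∧ ¬ IsZero S := by
  obtain ⟨S, T, f, g, zero, -, hT, ⟨h⟩⟩ := hC
  refine ⟨T, hT, fun hz => IsDivisionUnit.id_ne_zero (C := C) ?_⟩
  have := (isCoker_of_isColimit zero h).epi
  rw [← cancel_epi g]
  exact hz.eq_of_src _ _

/-- If the evaluation `u : S' ⊗ S ⟶ 𝟙` of a nonzero global splitting object satisfies the exactness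
condition, then it is the last morphism of a presentation of the unit. -/
theorem unitHasSplittingPresentation [HasDuals C] [MonoidalPreadditive C]
    (hS : ∃ S : C, globalSplitting C S ∧ ¬ IsZero S) (h : morU C = morUex C) :
    UnitHasSplittingPresentation C := by
  obtain ⟨S, hS, hz⟩ := hS
  obtain ⟨S', ⟨_⟩⟩ := HasDuals.exists_right S
  have hε : ε_ S S' ≠ 0 := evaluation_ne_zero hz
  have hm : (⟨S' ⊗ S, ε_ S S'⟩ : Σ U : C, U ⟶ 𝟙_ C) ∈ morUex C := by
    rw [← h]
    exact hε
  have hc := ((mem_morUex_iff _).1 hm).2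
  exact ⟨_, _, _, _, hc.zero, (hS.tensor_left S').tensor_left _, hS.tensor_left S',
    ⟨hc.isColimit⟩⟩

end Comparison

/-! ### Cokernels of representable objects -/

section Presentable

variable {A : Type u₁} [Category.{v₁} A] {E : Type u₂} [Category.{v₂} E] [Preadditive E]

/-- The objects which are a cokernel of a morphism in the image of `Y`. -/
def cokernelOfMap (Y : A ⥤ E) : ObjectProperty E :=
  fun M => ∃ (X₁ X₀ : A) (α : X₁ ⟶ X₀) (π : Y.obj X₀ ⟶ M), IsCoker (Y.map α) π

/-- A functor `Y` behaves like the Yoneda embedding of a category with weak kernels, relative to a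
class `Q` of objects, which for the Yoneda embedding consists of the additive presheaves: the
objects `Y X` are projective relative to `Q` and detect epimorphisms. -/
structure IsYonedaLike [Preadditive A] (Y : A ⥤ E) (Q : ObjectProperty E) : Prop where
  prop_obj : ∀ X, Q (Y.obj X)
  of_mono : ∀ {M N : E} (f : M ⟶ N) [Mono f], Q N → Q M
  of_epi : ∀ {M N : E} (f : M ⟶ N) [Epi f], Q M → Q N
  exists_lift : ∀ {X : A} {M N : E} (f : M ⟶ N) [Epi f], Q M → Q N → ∀ z : Y.obj X ⟶ N,
    ∃ y, y ≫ f = z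
  epi_of_lift : ∀ {M N : E} (f : M ⟶ N), Q N → (∀ {X : A} (z : Y.obj X ⟶ N), ∃ y, y ≫ f = z) →
    Epi f
  exists_weakKernel : ∀ {X Z : A} (f : X ⟶ Z), ∃ (K : A) (κ : K ⟶ X), κ ≫ f = 0 ∧
    ∀ {W : A} (z : W ⟶ X), z ≫ f = 0 → ∃ y, y ≫ κ = z

end Presentable

theorem isClosedUnderFiniteProducts_of_biprod {E : Type u₂} [Category.{v₂} E] [Preadditive E]
    [HasFiniteProducts E] [HasZeroObject E] [HasBinaryBiproducts E] {P : ObjectProperty E}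
    (of_iso : ∀ {M N : E} (_ : M ≅ N), P M → P N)
    (of_isZero : ∀ {M : E}, IsZero M → P M)
    (biprod : ∀ {M N : E}, P M → P N → P (M ⊞ N)) : P.IsClosedUnderFiniteProducts := by
  have h₀ : P.IsClosedUnderLimitsOfShape (Discrete.{0} PEmpty) := ⟨by
    rintro M ⟨p⟩
    have e := p.isLimit.conePointsIsoOfNatIso (isZero_zero E).isTerminal (Functor.uniqueFromEmpty _)
    exact of_isZero ((isZero_zero E).of_iso e)⟩
  have h₂ : P.IsClosedUnderBinaryProducts := ⟨by
    rintro M ⟨p⟩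
    have e := p.isLimit.conePointsIsoOfNatIso (BinaryBiproduct.isLimit _ _) (diagramIsoPair _)
    exact of_iso e.symm (biprod (p.prop_diag_obj _) (p.prop_diag_obj _))⟩
  exact .mk'

namespace IsYonedaLike

variable {A : Type u₁} [Category.{v₁} A] [Preadditive A] {E : Type u₂} [Category.{v₂} E]
  [Abelian E] {Y : A ⥤ E} {Q : ObjectProperty E} (hY : IsYonedaLike Y Q)
  [Y.Full] [Y.Faithful] [Y.Additive]

include hY

theorem prop_of_isCoker {X₁ X₀ : A} {α : X₁ ⟶ X₀} {M : E} {p : Y.obj X₀ ⟶ M}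
    (h : IsCoker (Y.map α) p) : Q M :=
  haveI := h.epi
  hY.of_epi p (hY.prop_obj X₀)

theorem exists_lift_of_isCoker {X₁ X₀ : A} {α : X₁ ⟶ X₀} {M : E} {p : Y.obj X₀ ⟶ M}
    (h : IsCoker (Y.map α) p) {Z : A} (z : Y.obj Z ⟶ M) : ∃ y : Z ⟶ X₀, Y.map y ≫ p = z := by
  have := h.epi
  obtain ⟨y, hy⟩ := hY.exists_lift p (hY.prop_obj X₀) (hY.prop_of_isCoker h) z
  exact ⟨Y.preimage y, by rw [Y.map_preimage, hy]⟩

theorem exact_of_isCoker {X₁ X₀ : A} {α : X₁ ⟶ X₀} {M : E} {p : Y.obj X₀ ⟶ M}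
    (h : IsCoker (Y.map α) p) {Z : A} (z : Z ⟶ X₀) (hz : Y.map z ≫ p = 0) :
    ∃ y : Z ⟶ X₁, y ≫ α = z := by
  have hex : (ShortComplex.mk (Y.map α) p h.zero).Exact :=
    ShortComplex.exact_of_g_is_cokernel _ h.isColimit
  have he : Epi (kernel.lift p (Y.map α) h.zero) :=
    (ShortComplex.exact_iff_epi_kernel_lift _).1 hex
  obtain ⟨y, hy⟩ := hY.exists_lift (kernel.lift p (Y.map α) h.zero) (hY.prop_obj _)
    (hY.of_mono (kernel.ι p) (hY.prop_obj _)) (kernel.lift p (Y.map z) hz)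
  refine ⟨Y.preimage y, Y.map_injective ?_⟩
  have := congrArg (· ≫ kernel.ι p) hy
  simpa using this

theorem isCoker_of_exact {X₁ X₀ : A} {α : X₁ ⟶ X₀} {M : E} {p : Y.obj X₀ ⟶ M} [Epi p]
    (w : Y.map α ≫ p = 0)
    (h : ∀ {Z : A} (z : Z ⟶ X₀), Y.map z ≫ p = 0 → ∃ y : Z ⟶ X₁, y ≫ α = z) :
    IsCoker (Y.map α) p := by
  have he : Epi (kernel.lift p (Y.map α) w) :=
    hY.epi_of_lift _ (hY.of_mono (kernel.ι p) (hY.prop_obj _)) fun z => by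
      obtain ⟨y, hy⟩ := h (Y.preimage (z ≫ kernel.ι p)) (by simp)
      refine ⟨Y.map y, ?_⟩
      rw [← cancel_mono (kernel.ι p), Category.assoc, kernel.lift_ι, ← Y.map_comp, hy,
        Y.map_preimage]
  refine ⟨w, inferInstance, fun t ht => ?_⟩
  have h0 : kernel.ι p ≫ t = 0 := by
    rw [← cancel_epi (kernel.lift p (Y.map α) w), kernel.lift_ι_assoc, ht, comp_zero]
  exact (isCoker_kernel_ι p).exists_desc t h0

variable [HasBinaryBiproducts A]

/-- Cokernels of presentable objects are presentable: lift `η` to `f : M₀ ⟶ N₀` and use the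
presentation `M₀ ⊞ N₁ ⟶ N₀`. -/
theorem cokernelOfMap_of_isCoker {M N L : E} (η : M ⟶ N) (q : N ⟶ L) (h : IsCoker η q)
    (hM : cokernelOfMap Y M) (hN : cokernelOfMap Y N) : cokernelOfMap Y L := by
  obtain ⟨M₁, M₀, α, p, hp⟩ := hM
  obtain ⟨N₁, N₀, β, p', hp'⟩ := hN
  obtain ⟨f, hf⟩ := hY.exists_lift_of_isCoker hp' (p ≫ η)
  have := hp.epi
  have := hp'.epi
  have := h.epi
  refine ⟨M₀ ⊞ N₁, N₀, biprod.desc f β, p' ≫ q, ?_, inferInstance, fun t ht => ?_⟩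
  · have e : biprod.desc f β = biprod.fst ≫ f + biprod.snd ≫ β := by
      ext <;> simp
    rw [e, Y.map_add, Preadditive.add_comp, Y.map_comp, Y.map_comp, Category.assoc,
      Category.assoc, reassoc_of% hf, h.zero, reassoc_of% hp'.zero]
    simp
  · have h1 : Y.map f ≫ t = 0 := by
      rw [← biprod.inl_desc f β, Y.map_comp, Category.assoc, ht, comp_zero]
    have h2 : Y.map β ≫ t = 0 := by
      rw [← biprod.inr_desc f β, Y.map_comp, Category.assoc, ht, comp_zero]
    obtain ⟨s, rfl⟩ := hp'.exists_desc t h2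
    obtain ⟨s, rfl⟩ := h.exists_desc s (by
      rw [← cancel_epi p, ← reassoc_of% hf, h1, comp_zero])
    exact ⟨s, Category.assoc _ _ _⟩

/-- Kernels of presentable objects are presentable, by two weak pullbacks: the first covers the
kernel, and the second covers the relations. -/
theorem cokernelOfMap_kernel {M N : E} (η : M ⟶ N)
    (hM : cokernelOfMap Y M) (hN : cokernelOfMap Y N) : cokernelOfMap Y (kernel η) := by
  obtain ⟨M₁, M₀, α, p, hp⟩ := hM
  obtain ⟨N₁, N₀, β, p', hp'⟩ := hN
  obtain ⟨f, hf⟩ := hY.exists_lift_of_isCoker hp' (p ≫ η)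
  -- `W` is a weak pullback of `f` and `β`
  obtain ⟨W, w, hw, hw'⟩ := hY.exists_weakKernel
    (biprod.fst ≫ f - biprod.snd ≫ β : M₀ ⊞ N₁ ⟶ N₀)
  rw [Preadditive.comp_sub, sub_eq_zero] at hw
  have hK : (Y.map (w ≫ biprod.fst) ≫ p) ≫ η = 0 := by
    rw [Category.assoc, ← hf, ← Category.assoc, ← Y.map_comp, Category.assoc, hw,
      ← Category.assoc, Y.map_comp, Category.assoc, hp'.zero, comp_zero]
  let r : Y.obj W ⟶ kernel η := kernel.lift η _ hK
  have hr : r ≫ kernel.ι η = Y.map (w ≫ biprod.fst) ≫ p := kernel.lift_ι _ _ _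
  have hepi : Epi r := hY.epi_of_lift r (hY.of_mono (kernel.ι η) (hY.prop_of_isCoker hp))
    fun z => by
    obtain ⟨y, hy⟩ := hY.exists_lift_of_isCoker hp (z ≫ kernel.ι η)
    obtain ⟨y', hy'⟩ := hY.exact_of_isCoker hp' (y ≫ f) (by
      rw [Y.map_comp, Category.assoc, hf, reassoc_of% hy, kernel.condition, comp_zero])
    obtain ⟨x, hx⟩ := hw' (biprod.lift y y') (by simp [hy'])
    refine ⟨Y.map x, ?_⟩
    rw [← cancel_mono (kernel.ι η), Category.assoc, hr, ← Category.assoc, ← Y.map_comp,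
      reassoc_of% hx, biprod.lift_fst, hy]
  -- `V` is a weak pullback of `W ⟶ M₀` and `α`
  obtain ⟨V, x, hx, hx'⟩ := hY.exists_weakKernel
    (biprod.fst ≫ w ≫ biprod.fst - biprod.snd ≫ α : W ⊞ M₁ ⟶ M₀)
  rw [Preadditive.comp_sub, sub_eq_zero] at hx
  refine ⟨V, W, x ≫ biprod.fst, r, hY.isCoker_of_exact ?_ fun z hz => ?_⟩
  · rw [← cancel_mono (kernel.ι η), Category.assoc, hr, ← Category.assoc, ← Y.map_comp,
      Category.assoc, hx, ← Category.assoc, Y.map_comp, Category.assoc, hp.zero, comp_zero,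
      zero_comp]
  · obtain ⟨y, hy⟩ := hY.exact_of_isCoker hp (z ≫ w ≫ biprod.fst) (by
      rw [Y.map_comp, Category.assoc, ← hr, reassoc_of% hz, zero_comp])
    obtain ⟨y', hy'⟩ := hx' (biprod.lift z y) (by simp [hy])
    exact ⟨y', by rw [reassoc_of% hy', biprod.lift_fst]⟩

theorem cokernelOfMap_of_iso {M N : E} (e : M ≅ N) (hM : cokernelOfMap Y M) :
    cokernelOfMap Y N := by
  obtain ⟨M₁, M₀, α, p, hp⟩ := hM
  exact ⟨M₁, M₀, α, p ≫ e.hom, hp.of_iso (Iso.refl _) (Iso.refl _) e (by simp) (by simp)⟩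

theorem cokernelOfMap_biprod {M N : E} (hM : cokernelOfMap Y M) (hN : cokernelOfMap Y N) :
    cokernelOfMap Y (M ⊞ N) := by
  obtain ⟨M₁, M₀, α, p, hp⟩ := hM
  obtain ⟨N₁, N₀, β, p', hp'⟩ := hN
  have := hp.epi
  have := hp'.epi
  have hi : ∀ {W : E} (t : Y.obj (M₀ ⊞ N₀) ⟶ W),
      Y.map biprod.fst ≫ Y.map biprod.inl ≫ t + Y.map biprod.snd ≫ Y.map biprod.inr ≫ t = t := by
    intro W t
    rw [← Category.assoc, ← Category.assoc, ← Preadditive.add_comp, ← Y.map_comp, ← Y.map_comp,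
      ← Y.map_add, biprod.total, Y.map_id, Category.id_comp]
  refine ⟨M₁ ⊞ N₁, M₀ ⊞ N₀, biprod.map α β,
    Y.map biprod.fst ≫ p ≫ biprod.inl + Y.map biprod.snd ≫ p' ≫ biprod.inr, ?_, ⟨fun s t h => ?_⟩,
    fun t ht => ?_⟩
  · rw [Preadditive.comp_add, ← Y.map_comp_assoc, ← Y.map_comp_assoc,
      biprod.map_fst, biprod.map_snd, Y.map_comp, Y.map_comp, Category.assoc, Category.assoc,
      reassoc_of% hp.zero, reassoc_of% hp'.zero]
    simp
  · have h1 := congrArg (Y.map biprod.inl ≫ ·) h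
    have h2 := congrArg (Y.map biprod.inr ≫ ·) h
    simp only [Preadditive.add_comp, Preadditive.comp_add, Category.assoc, ← Y.map_comp_assoc,
      biprod.inl_fst, biprod.inl_snd, biprod.inr_fst, biprod.inr_snd, Y.map_id, Y.map_zero,
      zero_comp, add_zero, zero_add, Category.id_comp, cancel_epi] at h1 h2
    ext
    · exact h1
    · exact h2
  · obtain ⟨a, ha⟩ := hp.exists_desc (Y.map biprod.inl ≫ t) (by
      rw [← Category.assoc, ← Y.map_comp, ← biprod.inl_map α β, Y.map_comp, Category.assoc, ht,
        comp_zero])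
    obtain ⟨b, hb⟩ := hp'.exists_desc (Y.map biprod.inr ≫ t) (by
      rw [← Category.assoc, ← Y.map_comp, ← biprod.inr_map α β, Y.map_comp, Category.assoc, ht,
        comp_zero])
    refine ⟨biprod.desc a b, ?_⟩
    simp only [Preadditive.add_comp, Category.assoc, biprod.inl_desc, biprod.inr_desc, ha, hb]
    exact hi t

theorem cokernelOfMap_of_isZero [HasZeroObject A] {M : E} (hM : IsZero M) :
    cokernelOfMap Y M := by
  obtain ⟨O, hO⟩ := HasZeroObject.zero (C := A)
  have h : IsZero (Y.obj O) := Y.map_isZero hO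
  exact ⟨O, O, 𝟙 O, 0, comp_zero, ⟨fun _ _ _ => hM.eq_of_src _ _⟩,
    fun t _ => ⟨0, h.eq_of_src _ _⟩⟩

theorem isClosedUnderKernels : (cokernelOfMap Y).IsClosedUnderKernels where
  kernels_le := by
    rintro _ ⟨f, k, hk, h₁, h₂⟩
    exact hY.cokernelOfMap_of_iso (limit.isLimit _ |>.conePointUniqueUpToIso hk)
      (hY.cokernelOfMap_kernel f h₁ h₂)

theorem isClosedUnderCokernels : (cokernelOfMap Y).IsClosedUnderCokernels where
  cokernels_le := by
    rintro _ ⟨f, k, hk, h₁, h₂⟩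
    exact hY.cokernelOfMap_of_isCoker f (Cofork.π k)
      (isCoker_of_isColimit (CokernelCofork.condition k)
        (hk.ofIsoColimit (Cofork.isoCoforkOfπ k))) h₁ h₂

theorem containsZero [HasZeroObject A] : (cokernelOfMap Y).ContainsZero where
  exists_zero := ⟨_, isZero_zero E, hY.cokernelOfMap_of_isZero (isZero_zero E)⟩

theorem isClosedUnderFiniteProducts [HasZeroObject A] :
    (cokernelOfMap Y).IsClosedUnderFiniteProducts :=
  isClosedUnderFiniteProducts_of_biprod hY.cokernelOfMap_of_iso hY.cokernelOfMap_of_isZero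
    hY.cokernelOfMap_biprod

end IsYonedaLike

/-! ### The category of finitely presented functors -/

section Pointwise

variable {J : Type u₁} [Category.{v₁} J] {E : Type u₂} [Category.{v₂} E] [Abelian E]

theorem isCoker_iff_app {F G H : J ⥤ E} (f : F ⟶ G) (g : G ⟶ H) :
    IsCoker f g ↔ ∀ j, IsCoker (f.app j) (g.app j) := by
  refine ⟨fun h j => ?_, fun h => ?_⟩
  · have : ((evaluation J E).obj j).PreservesZeroMorphisms := ⟨fun _ _ => rfl⟩
    exact h.map ((evaluation J E).obj j)
  · have (j : J) : Epi (g.app j) := (h j).epi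
    refine ⟨by ext j; exact (h j).zero, NatTrans.epi_of_epi_app _, fun t ht => ?_⟩
    have hd (j : J) := (h j).exists_desc (t.app j) (congrArg (fun a => a.app j) ht)
    choose s hs using hd
    refine ⟨{ app := s, naturality := fun i j a => ?_ }, by ext j; exact hs j⟩
    rw [← cancel_epi (g.app i), ← g.naturality_assoc, hs, t.naturality, reassoc_of% hs]

theorem isCoker_ab_iff {X Y Z : AddCommGrpCat.{v}} (f : X ⟶ Y) (g : Y ⟶ Z) :
    IsCoker f g ↔ Function.Exact f g ∧ Function.Surjective g := by
  constructor
  · intro h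
    have := h.epi
    exact ⟨(ShortComplex.ab_exact_iff_function_exact _).1
      (ShortComplex.exact_of_g_is_cokernel (.mk f g h.zero) h.isColimit),
      (AddCommGrpCat.epi_iff_surjective g).1 h.epi⟩
  · rintro ⟨h, hg⟩
    have w : f ≫ g = 0 := by
      ext x
      exact (h (f x)).2 ⟨x, rfl⟩
    have := (AddCommGrpCat.epi_iff_surjective g).2 hg
    have hex : (ShortComplex.mk f g w).Exact := (ShortComplex.ab_exact_iff_function_exact _).2 h
    exact isCoker_of_isColimit w hex.gIsCokernel

end Pointwise

section Additive

variable {A : Type u} [Category.{v} A] [Preadditive A]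

theorem finitelyPresented_eq_cokernelOfMap :
    finitelyPresented A = cokernelOfMap (preadditiveYoneda (C := A)) := by
  ext M
  constructor
  · rintro ⟨Y, X, α, π, h⟩
    exact ⟨Y, X, α, π, (isCoker_iff_app _ _).2 fun Z => (isCoker_ab_iff _ _).2 (h Z)⟩
  · rintro ⟨Y, X, α, π, h⟩
    exact ⟨Y, X, α, π, fun Z => (isCoker_ab_iff _ _).1 ((isCoker_iff_app _ _).1 h Z)⟩

variable (A) in
/-- The presheaves of abelian groups which are additive functors. -/
def additivePresheaf : ObjectProperty (Aᵒᵖ ⥤ AddCommGrpCat.{v}) :=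
  fun M => ∀ ⦃X Y : A⦄ (f g : X ⟶ Y), M.map (f + g).op = M.map f.op + M.map g.op

/-- The morphism from a representable functor to an additive presheaf given by an element. -/
def yonedaHom {M : Aᵒᵖ ⥤ AddCommGrpCat.{v}} (hM : additivePresheaf A M) {X : A}
    (x : M.obj (op X)) : preadditiveYoneda.obj X ⟶ M where
  app Z := AddCommGrpCat.ofHom (AddMonoidHom.mk' (fun f : Z.unop ⟶ X => M.map f.op x) fun f g =>
    ConcreteCategory.congr_hom (hM f g) x)
  naturality Z W a := by
    ext f
    exact ConcreteCategory.congr_hom (M.map_comp (Quiver.Hom.op (X := Z.unop) f) a) x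

theorem yonedaHom_app {M : Aᵒᵖ ⥤ AddCommGrpCat.{v}} (hM : additivePresheaf A M) {X : A}
    (x : M.obj (op X)) : (yonedaHom hM x).app (op X) (𝟙 X) = x :=
  ConcreteCategory.congr_hom (M.map_id (op X)) x

theorem preadditiveYoneda_hom_ext {M : Aᵒᵖ ⥤ AddCommGrpCat.{v}} {X : A}
    {a b : preadditiveYoneda.obj X ⟶ M} (h : a.app (op X) (𝟙 X) = b.app (op X) (𝟙 X)) : a = b := by
  have key : ∀ (c : preadditiveYoneda.obj X ⟶ M) (Z : A) (f : Z ⟶ X),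
      c.app (op Z) f = M.map f.op (c.app (op X) (𝟙 X)) := fun c Z f => by
    refine Eq.trans ?_ (ConcreteCategory.congr_hom (c.naturality f.op) (𝟙 X))
    exact congrArg (c.app (op Z)) (Category.comp_id f).symm
  ext Z f
  exact (key a Z.unop f).trans ((congrArg _ h).trans (key b Z.unop f).symm)

instance : (preadditiveYoneda (C := A)).Additive where
  map_add {X Y f g} := by
    ext Z h
    exact Preadditive.comp_add _ _ _ h f g

/-- The Yoneda embedding of a preadditive category with weak kernels. -/
theorem isYonedaLike_preadditiveYoneda
    (hA : ∀ {X Z : A} (f : X ⟶ Z), ∃ (K : A) (κ : K ⟶ X), κ ≫ f = 0 ∧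
      ∀ {W : A} (z : W ⟶ X), z ≫ f = 0 → ∃ y, y ≫ κ = z) :
    IsYonedaLike (preadditiveYoneda (C := A)) (additivePresheaf A) where
  prop_obj X Y Z f g := by
    ext h
    exact Preadditive.add_comp _ _ _ f g h
  of_mono {M N} f _ hN X Y a b := by
    have : Mono (f.app (op X)) := inferInstance
    rw [← cancel_mono (f.app (op X)), Preadditive.add_comp, f.naturality, f.naturality,
      f.naturality, hN a b, Preadditive.comp_add]
  of_epi {M N} f _ hM X Y a b := by
    have : Epi (f.app (op Y)) := inferInstance
    rw [← cancel_epi (f.app (op Y)), Preadditive.comp_add, ← f.naturality, ← f.naturality,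
      ← f.naturality, hM a b, Preadditive.add_comp]
  exists_lift {X M N} f _ hM hN z := by
    have : Epi (f.app (op X)) := inferInstance
    obtain ⟨m, hm⟩ := (AddCommGrpCat.epi_iff_surjective (f.app (op X))).1 this
      (z.app (op X) (𝟙 X))
    refine ⟨yonedaHom hM m, preadditiveYoneda_hom_ext ?_⟩
    exact (congrArg (f.app (op X)) (yonedaHom_app hM m)).trans hm
  epi_of_lift {M N} f hN h := by
    have (Z : Aᵒᵖ) : Epi (f.app Z) := (AddCommGrpCat.epi_iff_surjective _).2 fun x => by
      obtain ⟨y, hy⟩ := h (X := Z.unop) (yonedaHom hN (X := Z.unop) x)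
      refine ⟨y.app Z (𝟙 Z.unop), ?_⟩
      have := ConcreteCategory.congr_hom (congrArg (fun a => NatTrans.app a Z) hy) (𝟙 Z.unop)
      exact this.trans (yonedaHom_app hN (X := Z.unop) x)
    exact NatTrans.epi_of_epi_app _
  exists_weakKernel := hA

end Additive

section Abelian

variable {A : Type u} [Category.{v} A] [Preadditive A] [HasBinaryBiproducts A] [HasZeroObject A]
  (hA : IsYonedaLike (preadditiveYoneda (C := A)) (additivePresheaf A))

include hA

/-- Finitely presented functors on an additive category with weak kernels form an abelian
category. -/
noncomputable abbrev abelianModCat : Abelian (ModCat A) := by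
  have e := finitelyPresented_eq_cokernelOfMap (A := A)
  have : (finitelyPresented A).IsClosedUnderKernels := e ▸ hA.isClosedUnderKernels
  have : (finitelyPresented A).IsClosedUnderCokernels := e ▸ hA.isClosedUnderCokernels
  have : (finitelyPresented A).IsClosedUnderFiniteProducts := e ▸ hA.isClosedUnderFiniteProducts
  have : (finitelyPresented A).ContainsZero := e ▸ hA.containsZero
  infer_instance

theorem preservesEpimorphisms_finitelyPresented_ι :
    (finitelyPresented A).ι.PreservesEpimorphisms := by
  have e := finitelyPresented_eq_cokernelOfMap (A := A)
  have : (finitelyPresented A).IsClosedUnderCokernels := e ▸ hA.isClosedUnderCokernels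
  have : (finitelyPresented A).ContainsZero := e ▸ hA.containsZero
  exact (finitelyPresented A).preservesEpimorphisms_ι_of_isNormalMonoCategory

end Abelian

/-! ### The restricted Yoneda functor -/

section RestrictedYoneda

variable {C : Type u} [Category.{v} C] [Preadditive C]

/-- On objects of the full subcategory, the restricted Yoneda functor is the Yoneda embedding. -/
noncomputable def restrictedYonedaIso {P : ObjectProperty C} (S : P.FullSubcategory) :
    preadditiveYoneda.obj S ≅ (restrictedYoneda P).obj S.obj :=
  NatIso.ofComponents (fun Z => AddEquiv.toAddCommGrpIso (X := AddCommGrpCat.of (Z.unop ⟶ S))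
    (Y := AddCommGrpCat.of (Z.unop.obj ⟶ S.obj))
    { toFun := fun f => f.hom
      invFun := fun f => P.homMk f
      left_inv := fun _ => rfl
      right_inv := fun _ => rfl
      map_add' := fun _ _ => rfl }) fun f => by
    ext
    rfl

instance (P : ObjectProperty C) : (restrictedYoneda P).Additive where
  map_add {X Y f g} := by
    ext Z h
    exact Preadditive.comp_add _ _ _ h f g

theorem isCoker_restrictedYoneda {P : ObjectProperty C} {X Y Z : C} {f : X ⟶ Y} {g : Y ⟶ Z}
    (w : f ≫ g = 0) (h : ∀ {S : C}, P S → (∀ z : S ⟶ Z, ∃ y, y ≫ g = z) ∧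
      ∀ y : S ⟶ Y, y ≫ g = 0 → ∃ x, x ≫ f = y) :
    IsCoker ((restrictedYoneda P).map f) ((restrictedYoneda P).map g) :=
  (isCoker_iff_app _ _).2 fun S => (isCoker_ab_iff _ _).2
    ⟨fun y => ⟨(h S.unop.property).2 y, by
      rintro ⟨x, rfl⟩
      exact (Category.assoc _ _ _).trans ((congrArg _ w).trans comp_zero)⟩,
      (h S.unop.property).1⟩

/-- The restricted Yoneda functor is full if every object has a presentation by objects of `P` whose
augmentation is surjective on morphisms from objects of `P`. -/
theorem full_restrictedYoneda {P : ObjectProperty C}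
    (h : ∀ X : C, ∃ (S T : C) (f : S ⟶ T) (g : T ⟶ X), P S ∧ P T ∧ IsCoker f g ∧
      ∀ {Z : C}, P Z → ∀ z : Z ⟶ X, ∃ y, y ≫ g = z) : (restrictedYoneda P).Full where
  map_surjective {X X'} φ := by
    obtain ⟨S, T, f, g, hS, hT, hfg, hg⟩ := h X
    let φ' (Z : P.FullSubcategory) (z : Z.obj ⟶ X) : Z.obj ⟶ X' := φ.app (op Z) z
    have nat {Z W : P.FullSubcategory} (a : Z.obj ⟶ W.obj) (z : W.obj ⟶ X) :
        φ' Z (a ≫ z) = a ≫ φ' W z :=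
      ConcreteCategory.congr_hom (φ.naturality (Quiver.Hom.op (P.homMk a))) z
    obtain ⟨x, hx⟩ := hfg.exists_desc (φ' ⟨T, hT⟩ g) (by
      rw [← nat (Z := ⟨S, hS⟩) (W := ⟨T, hT⟩), hfg.zero]
      exact (φ.app (op ⟨S, hS⟩)).hom.map_zero)
    refine ⟨x, ?_⟩
    ext Z z
    obtain ⟨y, hy⟩ := hg Z.unop.property z
    have e : z ≫ x = φ' Z.unop z := by
      rw [← hy, Category.assoc, hx, ← nat (Z := Z.unop) (W := ⟨T, hT⟩)]
    exact e

theorem faithful_restrictedYoneda {P : ObjectProperty C}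
    (h : ∀ X : C, ∃ (T : C) (g : T ⟶ X), P T ∧ Epi g) : (restrictedYoneda P).Faithful where
  map_injective {X X'} a b hab := by
    obtain ⟨T, g, hT, hg⟩ := h X
    rw [← cancel_epi g]
    have e : ((restrictedYoneda P).map a).app (op ⟨T, hT⟩) =
      ((restrictedYoneda P).map b).app (op ⟨T, hT⟩) := by rw [hab]
    exact ConcreteCategory.congr_hom e g

variable {k : Type t} [Field k] [Linear k C]

instance linear_lift_restrictedYoneda (P : ObjectProperty C)
    (h : ∀ X, finitelyPresented P.FullSubcategory ((restrictedYoneda P).obj X)) :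
    ((finitelyPresented P.FullSubcategory).lift (restrictedYoneda P) h).Linear k where
  map_smul {X X'} f r := by
    ext Z z
    have e (z : Z.unop.obj ⟶ X) : z ≫ (r • f) = ((r • 𝟙 Z.unop.obj) ≫ z) ≫ f := by simp
    exact e z

end RestrictedYoneda

section SplittingYoneda

variable {C : Type u} [Category.{v} C] [Preadditive C] [MonoidalCategory C] [MonoidalPreadditive C]
  [HasDuals C] [HasFiniteBiproducts C] [IsIdempotentComplete C]
  (hC : UnitHasSplittingPresentation C)

theorem isClosedUnderFiniteProducts_globalSplitting :
    (globalSplitting C).IsClosedUnderFiniteProducts :=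
  haveI := hasBinaryBiproducts_of_finite_biproducts C
  isClosedUnderFiniteProducts_of_biprod (fun e h => h.of_iso e.symm) .of_isZero .biprod

instance : HasFiniteBiproducts (globalSplitting C).FullSubcategory :=
  haveI := isClosedUnderFiniteProducts_globalSplitting (C := C)
  HasFiniteBiproducts.of_hasFiniteProducts

include hC

theorem finitelyPresented_restrictedYoneda (X : C) :
    finitelyPresented (globalSplitting C).FullSubcategory
      ((restrictedYoneda (globalSplitting C)).obj X) := by
  obtain ⟨S, T, f, g, hS, hT, h⟩ := exists_splitting_presentation hC X
  rw [finitelyPresented_eq_cokernelOfMap]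
  refine ⟨⟨S, hS⟩, ⟨T, hT⟩, ObjectProperty.homMk f,
    (restrictedYonedaIso ⟨T, hT⟩).hom ≫ (restrictedYoneda (globalSplitting C)).map g, ?_⟩
  refine (isCoker_restrictedYoneda h.zero fun hZ => hZ.hom_exact h).of_iso
    (restrictedYonedaIso ⟨S, hS⟩).symm (restrictedYonedaIso ⟨T, hT⟩).symm (Iso.refl _) ?_ (by simp)
  ext Z z
  rfl

theorem full_restrictedYoneda_globalSplitting : (restrictedYoneda (globalSplitting C)).Full :=
  full_restrictedYoneda fun X => by
    obtain ⟨S, T, f, g, hS, hT, h⟩ := exists_splitting_presentation hC X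
    exact ⟨S, T, f, g, hS, hT, h, fun hZ => (hZ.hom_exact h).1⟩

theorem faithful_restrictedYoneda_globalSplitting :
    (restrictedYoneda (globalSplitting C)).Faithful :=
  faithful_restrictedYoneda fun X => by
    obtain ⟨S, T, f, g, hS, hT, h⟩ := exists_splitting_presentation hC X
    exact ⟨T, g, hT, h.epi⟩

theorem isYonedaLike_globalSplitting :
    IsYonedaLike (preadditiveYoneda (C := (globalSplitting C).FullSubcategory))
      (additivePresheaf _) :=
  isYonedaLike_preadditiveYoneda fun {X Z} f => by
    obtain ⟨K, κ, hK, w, h⟩ := exists_weakKernel hC f.hom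
    refine ⟨⟨K, hK⟩, ObjectProperty.homMk κ, by ext; exact w, fun {W} z hz => ?_⟩
    obtain ⟨y, hy⟩ := h W.property z.hom (congrArg (fun a => a.hom) hz)
    exact ⟨ObjectProperty.homMk y, by ext; exact hy⟩

/-- Finitely presented functors on the global splitting objects form an abelian category. -/
noncomputable abbrev abelianModCatGlobalSplitting :
    Abelian (ModCat (globalSplitting C).FullSubcategory) :=
  haveI := hasBinaryBiproducts_of_finite_biproducts (globalSplitting C).FullSubcategory
  haveI : HasZeroObject (globalSplitting C).FullSubcategory := inferInstance
  abelianModCat (isYonedaLike_globalSplitting hC)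

theorem epi_hom_of_epi {M N : ModCat (globalSplitting C).FullSubcategory} (f : M ⟶ N)
    [Epi f] : Epi f.hom := by
  have := hasBinaryBiproducts_of_finite_biproducts (globalSplitting C).FullSubcategory
  have := preservesEpimorphisms_finitelyPresented_ι (isYonedaLike_globalSplitting hC)
  exact (finitelyPresented (globalSplitting C).FullSubcategory).ι.map_epi f

/-- Representable functors are projective by the Yoneda lemma, as epimorphisms of finitely presented
functors are pointwise surjective. -/
theorem isProjectiveRealization_restrictedYoneda
    (h : ∀ X, finitelyPresented (globalSplitting C).FullSubcategory
      ((restrictedYoneda (globalSplitting C)).obj X)) :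
    IsProjectiveRealization ((finitelyPresented (globalSplitting C).FullSubcategory).lift
      (restrictedYoneda (globalSplitting C)) h) where
  projective {S} hS := ⟨fun {M N} z f _ => by
    have := epi_hom_of_epi hC f
    obtain ⟨y, hy⟩ := (isYonedaLike_globalSplitting hC).exists_lift (X := ⟨S, hS⟩) f.hom
      (fun _ _ => M.property.map_add) (fun _ _ => N.property.map_add)
      ((restrictedYonedaIso ⟨S, hS⟩).hom ≫ z.hom)
    refine ⟨ObjectProperty.homMk ((restrictedYonedaIso ⟨S, hS⟩).inv ≫ y), ?_⟩
    ext1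
    have : ((restrictedYonedaIso ⟨S, hS⟩).inv ≫ y) ≫ f.hom = z.hom := by
      rw [Category.assoc, hy, Iso.inv_hom_id_assoc]
    exact this⟩
  exists_epi M := by
    obtain ⟨Y, X, α, π, hπ⟩ := finitelyPresented_eq_cokernelOfMap.le _ M.property
    have := hπ.epi
    refine ⟨X.obj, ObjectProperty.homMk ((restrictedYonedaIso X).inv ≫ π), X.property,
      ⟨fun a b hab => ?_⟩⟩
    ext1
    rw [← cancel_epi ((restrictedYonedaIso X).inv ≫ π)]
    exact congrArg (fun c => c.hom) hab

end SplittingYoneda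

theorem IsProjectiveRealization.enoughProjectives {C : Type u₁} [Category.{v₁} C]
    [MonoidalCategory C] {T : Type u₂} [Category.{v₂} T] (Y : C ⥤ T)
    [hY : IsProjectiveRealization Y] : EnoughProjectives T where
  presentation M := by
    obtain ⟨S, p, hS, hp⟩ := hY.exists_epi M
    exact ⟨{ p := Y.obj S, projective := hY.projective hS, f := p, epi := hp }⟩

/-! ### Coequalizers of reflexive pairs form a monoidal functor -/

section ReflMonoidal

open WalkingReflexivePair WalkingReflexivePair.Hom Functor.LaxMonoidal Functor.OplaxMonoidal

section Colim

variable {E : Type u₂} [Category.{v₂} E] [MonoidalCategory E]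
  [HasColimitsOfShape WalkingReflexivePair E]

/-- Taking colimits is oplax monoidal, as a left adjoint of the monoidal diagonal functor. -/
noncomputable instance colimOplaxMonoidal :
    (colim : (WalkingReflexivePair ⥤ E) ⥤ E).OplaxMonoidal :=
  colimConstAdj.leftAdjointOplaxMonoidal

theorem colimit_ι_δ (R N : WalkingReflexivePair ⥤ E) :
    colimit.ι (R ⊗ N) zero ≫ δ (colim : (WalkingReflexivePair ⥤ E) ⥤ E) R N =
      (colimit.ι R zero ⊗ₘ colimit.ι N zero) := by
  have h := congrArg (fun a => NatTrans.app a zero)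
    ((colimConstAdj.homEquiv _ _).apply_symm_apply
      ((colimConstAdj.unit.app R ⊗ₘ colimConstAdj.unit.app N) ≫
        μ (Functor.const WalkingReflexivePair : E ⥤ _) _ _))
  exact h.trans (Category.comp_id _)

theorem colimit_ι_η :
    colimit.ι (𝟙_ (WalkingReflexivePair ⥤ E)) zero ≫
      η (colim : (WalkingReflexivePair ⥤ E) ⥤ E) = 𝟙 (𝟙_ E) :=
  congrArg (fun a => NatTrans.app a zero)
    ((colimConstAdj.homEquiv _ _).apply_symm_apply
      (ε (Functor.const WalkingReflexivePair : E ⥤ _)))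

end Colim

variable {C : Type u₁} [Category.{v₁} C] [MonoidalCategory C]
  {E : Type u₂} [Category.{v₂} E] [MonoidalCategory E]
  [HasColimitsOfShape WalkingReflexivePair E] (F : C ⥤ E) [F.Monoidal]

theorem reflπ_δ (R N : WalkingReflexivePair ⥤ C) :
    reflπ F (R ⊗ N) ≫ δ (reflCoeq F) R N =
      δ F (R.obj zero) (N.obj zero) ≫ (reflπ F R ⊗ₘ reflπ F N) := by
  have h := ι_colimMap (δ ((Functor.whiskeringRight WalkingReflexivePair C E).obj F) R N) zero
  refine (Category.assoc _ _ _).symm.trans ((congrArg (· ≫ δ colim (R ⋙ F) (N ⋙ F)) h).trans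
    ((Category.assoc _ _ _).trans ?_))
  exact congrArg (δ F (R.obj zero) (N.obj zero) ≫ ·) (colimit_ι_δ (R ⋙ F) (N ⋙ F))

theorem reflπ_η : reflπ F (𝟙_ (WalkingReflexivePair ⥤ C)) ≫ η (reflCoeq F) = η F := by
  have h := ι_colimMap (η ((Functor.whiskeringRight WalkingReflexivePair C E).obj F)) zero
  refine (Category.assoc _ _ _).symm.trans ((congrArg (· ≫ η colim) h).trans
    ((Category.assoc _ _ _).trans ?_))
  exact (congrArg (η F ≫ ·) colimit_ι_η).trans (Category.comp_id _)

instance : IsIso (η (reflCoeq F)) := by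
  have h := reflπ_η F
  have : IsIso (reflπ F (𝟙_ (WalkingReflexivePair ⥤ C))) := isIso_reflπ_const F (𝟙_ C)
  have : IsIso (reflπ F (𝟙_ (WalkingReflexivePair ⥤ C)) ≫ η (reflCoeq F)) := by
    rw [h]
    infer_instance
  exact IsIso.of_isIso_comp_left (reflπ F (𝟙_ (WalkingReflexivePair ⥤ C))) _

variable [Preadditive C] [Preadditive E] [MonoidalPreadditive E] [HasDuals E] [F.Additive]

/-- Since the tensor product of `E` is right exact in each variable, the tensor product of two
reflexive coequalizers is the coequalizer of the tensor product of the pairs. -/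
theorem isCoker_reflπ_tensor (R N : WalkingReflexivePair ⥤ C) :
    IsCoker ((F.map (R.map left) ⊗ₘ F.map (N.map left)) -
      (F.map (R.map right) ⊗ₘ F.map (N.map right))) (reflπ F R ⊗ₘ reflπ F N) := by
  refine (isCoker_diagonal (G := curriedTensor E) (R := R ⋙ F) (N := N ⋙ F)
    (p₀ := F.obj (R.obj zero) ◁ reflπ F N) (p₁ := F.obj (R.obj one) ◁ reflπ F N)
    (al := F.map (R.map left) ▷ (reflCoeq F).obj N)
    (ar := F.map (R.map right) ▷ (reflCoeq F).obj N)
    (q := reflπ F R ▷ (reflCoeq F).obj N) ?_ (epi_whiskerLeft _ _) (whisker_exchange _ _).symm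
    (whisker_exchange _ _).symm ?_).congr ?_ (MonoidalCategory.tensorHom_def' _ _).symm
  · refine ((isCoker_reflπ' F N).whiskerLeft (F.obj (R.obj zero))).congr ?_ rfl
    exact ((tensorLeft (F.obj (R.obj zero))).map_sub)
  · refine ((isCoker_reflπ' F R).whiskerRight ((reflCoeq F).obj N)).congr ?_ rfl
    exact ((tensorRight ((reflCoeq F).obj N)).map_sub)
  · exact congrArg₂ (· - ·) (MonoidalCategory.tensorHom_def _ _).symm
      (MonoidalCategory.tensorHom_def _ _).symm

instance isIso_δ_reflCoeq (R N : WalkingReflexivePair ⥤ C) : IsIso (δ (reflCoeq F) R N) := by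
  have h₁ : IsIso (δ F (R.obj one) (N.obj one)) :=
    inferInstanceAs (IsIso (Functor.Monoidal.μIso F (R.obj one) (N.obj one)).inv)
  have h₀ : IsIso (δ F (R.obj zero) (N.obj zero)) :=
    inferInstanceAs (IsIso (Functor.Monoidal.μIso F (R.obj zero) (N.obj zero)).inv)
  refine @IsCoker.isIso _ _ _ _ _ _ _ _ _ _ _ _ _ (isCoker_reflπ' F (R ⊗ N))
    (isCoker_reflπ_tensor F R N) _ (@IsIso.epi_of_iso _ _ _ _ _ h₁) _ h₀ _ ?_ (reflπ_δ F R N)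
  have e (h : one ⟶ zero) : F.map ((R ⊗ N).map h) ≫ δ F (R.obj zero) (N.obj zero) =
      δ F (R.obj one) (N.obj one) ≫ (F.map (R.map h) ⊗ₘ F.map (N.map h)) :=
    (δ_natural F _ _).symm
  exact (Preadditive.sub_comp _ _ _).trans ((congrArg₂ (· - ·) (e left) (e right)).trans
    (Preadditive.comp_sub _ _ _).symm)

/-- For a monoidal functor to a rigid category, taking coequalizers of reflexive pairs is a
monoidal functor. -/
@[reducible]
noncomputable def reflCoeqMonoidal : (reflCoeq F).Monoidal :=
  .ofOplaxMonoidal (reflCoeq F)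

/-- The isomorphism between `F` and the coequalizers of constant pairs is monoidal. -/
theorem constReflCoeqIso_isMonoidal :
    letI := reflCoeqMonoidal F
    (constReflCoeqIso F).hom.IsMonoidal := by
  let := reflCoeqMonoidal F
  have : NatTrans.IsMonoidal (constReflCoeqIso F).inv := by
    refine ⟨?_, fun A B => ?_⟩
    · have e : ε (Functor.const WalkingReflexivePair ⋙ reflCoeq F) = ε (reflCoeq F) :=
        (congrArg (ε (reflCoeq F) ≫ ·) ((reflCoeq F).map_id _)).trans (Category.comp_id _)
      rw [e, ← cancel_mono (η (reflCoeq F)), Category.assoc]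
      exact (congrArg (ε F ≫ ·) (reflπ_η F)).trans
        ((Functor.Monoidal.ε_η F).trans (Functor.Monoidal.ε_η (reflCoeq F)).symm)
    · let cA := (Functor.const WalkingReflexivePair).obj A
      let cB := (Functor.const WalkingReflexivePair).obj B
      have h₁ : reflπ F (cA ⊗ cB) ≫ (reflCoeq F).map (μ (Functor.const _) A B) =
          reflπ F ((Functor.const _).obj (A ⊗ B)) :=
        (reflπ_naturality F _).trans
          ((congrArg (· ≫ reflπ F ((Functor.const _).obj (A ⊗ B))) (F.map_id (A ⊗ B))).trans
            (Category.id_comp _))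
      let p : F.obj (A ⊗ B) ⟶ (reflCoeq F).obj (cA ⊗ cB) := reflπ F (cA ⊗ cB)
      let pA : F.obj A ⟶ (reflCoeq F).obj cA := reflπ F cA
      let pB : F.obj B ⟶ (reflCoeq F).obj cB := reflπ F cB
      have h₂ : μ F A B ≫ p = (pA ⊗ₘ pB) ≫ μ (reflCoeq F) cA cB := by
        have h₃ : p ≫ δ (reflCoeq F) cA cB = δ F A B ≫ (pA ⊗ₘ pB) := reflπ_δ F cA cB
        rw [← cancel_mono (δ (reflCoeq F) cA cB), Category.assoc, h₃, Functor.Monoidal.μ_δ_assoc,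
          Category.assoc]
        exact ((congrArg ((pA ⊗ₘ pB) ≫ ·) (Functor.Monoidal.μ_δ (reflCoeq F) cA cB)).trans
          (Category.comp_id _)).symm
      have h₄ := (congrArg (μ F A B ≫ ·) h₁).symm.trans ((Category.assoc _ _ _).symm.trans
        ((congrArg (· ≫ (reflCoeq F).map (μ (Functor.const _) A B)) h₂).trans
          (Category.assoc _ _ _)))
      exact h₄
  have h : NatTrans.IsMonoidal (constReflCoeqIso F).symm.hom := this
  exact (inferInstance : NatTrans.IsMonoidal (constReflCoeqIso F).symm.inv)

end ReflMonoidal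

/-! ### Extending monoidal functors along a projective realization -/

section Split

open WalkingReflexivePair WalkingReflexivePair.Hom

variable {C : Type u₁} [Category.{v₁} C] [Preadditive C] {T : Type u₂} [Category.{v₂} T]
  [Preadditive T] [HasColimitsOfShape WalkingReflexivePair T] (F : C ⥤ T) [F.Additive]

/-- If `F` preserves the cokernels `q`, `q'` of two reflexive pairs in `C`, then a morphism of pairs
is inverted by taking coequalizers if and only if the induced morphism of cokernels is inverted. -/
theorem isIso_reflCoeq_map_iff {R R' : WalkingReflexivePair ⥤ C} (f : R ⟶ R') {Q Q' : C}
    {q : R.obj zero ⟶ Q} {q' : R'.obj zero ⟶ Q'} {s : Q ⟶ Q'} (hs : q ≫ s = f.app zero ≫ q')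
    (h : IsCoker (F.map (R.map left - R.map right)) (F.map q))
    (h' : IsCoker (F.map (R'.map left - R'.map right)) (F.map q')) :
    IsIso ((reflCoeq F).map f) ↔ IsIso (F.map s) := by
  obtain ⟨e, he⟩ := (isCoker_reflπ F R).exists_iso h
  obtain ⟨e', he'⟩ := (isCoker_reflπ F R').exists_iso h'
  have key : (reflCoeq F).map f ≫ e'.hom = e.hom ≫ F.map s := by
    rw [← cancel_epi (reflπ F R), ← Category.assoc, reflπ_naturality, Category.assoc, he',
      reassoc_of% he, ← F.map_comp,
      ← F.map_comp, hs]
  have k1 : (reflCoeq F).map f = e.hom ≫ F.map s ≫ e'.inv := by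
    rw [← Category.assoc, ← key, Category.assoc, e'.hom_inv_id, Category.comp_id]
  have k2 : F.map s = e.inv ≫ (reflCoeq F).map f ≫ e'.hom := by
    rw [key, e.inv_hom_id_assoc]
  constructor
  · intro
    rw [k2]
    infer_instance
  · intro
    rw [k1]
    infer_instance

end Split

section Inverts

open WalkingReflexivePair WalkingReflexivePair.Hom Functor.LaxMonoidal Functor.OplaxMonoidal

variable {C : Type u₁} [Category.{v₁} C] [Preadditive C] [MonoidalCategory C]
  [MonoidalPreadditive C] [HasFiniteBiproducts C] [HasDuals C] [IsIdempotentComplete C]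
  {T : Type u₂} [Category.{v₂} T] [Abelian T] (Y : C ⥤ T) [Y.Additive] [Y.Full] [Y.Faithful]
  [hY : IsProjectiveRealization Y]
  {T' : Type u₃} [Category.{v₃} T'] [Abelian T'] [MonoidalCategory T'] [MonoidalPreadditive T']
  [HasDuals T'] (F : C ⥤ T') [F.Monoidal] [F.Additive]

/-- A monoidal functor `F` inverts the morphisms of reflexive pairs that become invertible in `T`:
after tensoring with a global splitting object, all reflexive pairs have split coequalizers
in `C`, and these are preserved both by `Y` and by `F`. -/
theorem reflW_isInvertedBy {S : C} (hS : globalSplitting C S) (g : S ⟶ 𝟙_ C)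
    (hg : Epi (F.map g ≫ η F)) : (reflW Y).IsInvertedBy (reflCoeq F) := by
  intro R R' f hf
  let cS := (Functor.const WalkingReflexivePair).obj S
  have hsplit (R : WalkingReflexivePair ⥤ C) :
      IsSplit ((cS ⊗ R).map left - (cS ⊗ R).map right) := by
    have e : (cS ⊗ R).map left - (cS ⊗ R).map right = S ◁ (R.map left - R.map right) := by
      have e' (h : one ⟶ zero) : (cS ⊗ R).map h = S ◁ R.map h := id_tensorHom _ _
      exact (congrArg₂ (· - ·) (e' left) (e' right)).trans ((tensorLeft S).map_sub).symm
    rw [e]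
    exact (hS _).1
  have hcok (R : WalkingReflexivePair ⥤ C) : ∃ (Q : C) (q : (cS ⊗ R).obj zero ⟶ Q),
      IsCoker ((cS ⊗ R).map left - (cS ⊗ R).map right) q ∧
      IsCoker (Y.map ((cS ⊗ R).map left - (cS ⊗ R).map right)) (Y.map q) ∧
      IsCoker (F.map ((cS ⊗ R).map left - (cS ⊗ R).map right)) (F.map q) := by
    obtain ⟨Q, q, s, hq, hs⟩ := (hsplit R).exists_isCoker
    have hex := (hq.isSplitExact (hsplit R)).1
    exact ⟨Q, q, hq, (hex.map Y).isCoker (s := Y.map s) (by rw [← Y.map_comp, hs, Y.map_id]),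
      (hex.map F).isCoker (s := F.map s) (by rw [← F.map_comp, hs, F.map_id])⟩
  obtain ⟨Q, q, hq, hYq, hFq⟩ := hcok R
  obtain ⟨Q', q', hq', hYq', hFq'⟩ := hcok R'
  have nat (h : one ⟶ zero) : (cS ⊗ R).map h ≫ (cS ◁ f).app zero =
      (cS ◁ f).app one ≫ (cS ⊗ R').map h := (cS ◁ f).naturality h
  obtain ⟨s, hs⟩ := hq.exists_desc ((cS ◁ f).app zero ≫ q') (by
    rw [Preadditive.sub_comp, ← Category.assoc, ← Category.assoc, nat left, nat right,
      Category.assoc, Category.assoc, ← Preadditive.comp_sub, ← Preadditive.sub_comp, hq'.zero,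
      comp_zero])
  have h₁ : IsIso ((reflCoeq Y).map (cS ◁ f)) := reflW_const_whiskerLeft Y S f hf
  have h₂ : IsIso (Y.map s) := (isIso_reflCoeq_map_iff Y (cS ◁ f) hs hYq hYq').1 h₁
  have h₃ : IsIso s := isIso_of_fully_faithful Y s
  have h₄ : IsIso ((reflCoeq F).map (cS ◁ f)) :=
    (isIso_reflCoeq_map_iff F (cS ◁ f) hs hFq hFq').2 inferInstance
  let := reflCoeqMonoidal F
  have h₅ : IsIso ((reflCoeq F).obj cS ◁ (reflCoeq F).map f) := by
    have e := Functor.LaxMonoidal.μ_natural_right (reflCoeq F) cS f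
    have e' : (reflCoeq F).obj cS ◁ (reflCoeq F).map f =
        μ (reflCoeq F) cS R ≫ (reflCoeq F).map (cS ◁ f) ≫
          inv (μ (reflCoeq F) cS R') := by
      rw [← Category.assoc, ← e, Category.assoc, IsIso.hom_inv_id, Category.comp_id]
    rw [e']
    infer_instance
  have h₆ : IsIso (F.obj S ◁ (reflCoeq F).map f) := by
    let e : (reflCoeq F).obj cS ≅ F.obj S := (constReflCoeqIso F).app S
    have e' : F.obj S ◁ (reflCoeq F).map f = e.inv ▷ _ ≫ (reflCoeq F).obj cS ◁ (reflCoeq F).map f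
        ≫ e.hom ▷ _ := by
      rw [whisker_exchange, inv_hom_whiskerRight_assoc]
    rw [e']
    infer_instance
  have := faithful_tensorLeft_of_epi (F.map g ≫ η F) fun M => epi_whiskerRight _ _
  have : IsIso ((tensorLeft (F.obj S)).map ((reflCoeq F).map f)) := h₆
  exact isIso_of_reflects_iso _ (tensorLeft (F.obj S))

end Inverts

section Lift

variable {B : Type u₁} [Category.{v₁} B] [Preadditive B] {T : Type u₂} [Category.{v₂} T]
  [Preadditive T] {T' : Type u₃} [Category.{v₃} T'] [Preadditive T'] (L : B ⥤ T) [L.Additive]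
  (hL : ∀ {N N' : T} (f g : N ⟶ N'), ∃ (P P' : B) (a : L.obj P ≅ N) (b : L.obj P' ≅ N')
    (φ ψ : P ⟶ P'), f = a.inv ≫ L.map φ ≫ b.hom ∧ g = a.inv ≫ L.map ψ ≫ b.hom)
  (G : B ⥤ T') [G.Additive] (H : T ⥤ T') (e : L ⋙ H ≅ G)

include hL e

/-- A functor on `T` is additive if its restriction along `L` is. -/
theorem additive_of_lift : H.Additive where
  map_add {N N' f g} := by
    obtain ⟨P, P', a, b, φ, ψ, rfl, rfl⟩ := hL f g
    have key (χ : P ⟶ P') : H.map (L.map χ) = e.hom.app P ≫ G.map χ ≫ e.inv.app P' := by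
      rw [← e.hom.naturality_assoc, Iso.hom_inv_id_app, Category.comp_id, Functor.comp_map]
    rw [← Preadditive.comp_add, ← Preadditive.add_comp, ← L.map_add]
    simp only [H.map_comp, key, G.map_add, Preadditive.add_comp, Preadditive.comp_add]

theorem linear_of_lift (k : Type t) [Field k] [Linear k B] [Linear k T] [Linear k T']
    [L.Linear k] [G.Linear k] : H.Linear k where
  map_smul {N N'} f r := by
    obtain ⟨P, P', a, b, φ, ψ, rfl, -⟩ := hL f f
    have key (χ : P ⟶ P') : H.map (L.map χ) = e.hom.app P ≫ G.map χ ≫ e.inv.app P' := by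
      rw [← e.hom.naturality_assoc, Iso.hom_inv_id_app, Category.comp_id, Functor.comp_map]
    rw [← Linear.comp_smul, ← Linear.smul_comp, ← L.map_smul]
    simp only [H.map_comp, key, G.map_smul, Linear.smul_comp, Linear.comp_smul]

end Lift

section Extension

open WalkingReflexivePair WalkingReflexivePair.Hom Functor.LaxMonoidal Functor.OplaxMonoidal

variable {C : Type u₁} [Category.{v₁} C] [Preadditive C] [MonoidalCategory C]
  [MonoidalPreadditive C] [HasFiniteBiproducts C] [HasDuals C] [IsIdempotentComplete C]
  {T : Type u₂} [Category.{v₂} T] [Abelian T] (Y : C ⥤ T) [Y.Additive] [Y.Full] [Y.Faithful]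
  [hY : IsProjectiveRealization Y] [MonoidalCategory T] [(reflCoeq Y).Monoidal]
  {T' : Type u₃} [Category.{v₃} T'] [Abelian T'] [MonoidalCategory T'] [MonoidalPreadditive T']
  [HasDuals T'] (F : C ⥤ T') [F.Monoidal] [F.Additive]

/-- A tensor functor `F` which preserves epimorphisms to the unit extends to an exact tensor functor
on `T`: the functor of coequalizers after `F` factors through the localization. -/
theorem exists_extension (hC : UnitHasSplittingPresentation C)
    (hF : ∀ {S : C} (g : S ⟶ 𝟙_ C) [Epi g], Epi (F.map g ≫ η F))
    (k : Type t) [Field k] [Linear k C] [MonoidalLinear k C] [Linear k T] [Linear k T']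
    [Y.Linear k] [F.Linear k] :
    letI := monoidalOfReflCoeq Y
    ∃ (H : T ⥤ T') (_ : H.Monoidal) (e : Y ⋙ H ≅ F), H.Additive ∧ H.Linear k ∧
      NatTrans.IsMonoidal e.hom ∧ PreservesFiniteLimits H ∧ PreservesFiniteColimits H := by
  have hinv : (reflW Y).IsInvertedBy (reflCoeq F) := by
    obtain ⟨S', S, f, g, zero, hS', hS, ⟨h⟩⟩ := hC
    have := (isCoker_of_isColimit zero h).epi
    exact reflW_isInvertedBy Y F hS g (hF g)
  let := monoidalOfReflCoeq Y
  let := reflCoeqMonoidal F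
  have := isLocalization_reflCoeq Y
  let H : T ⥤ T' := Localization.lift (reflCoeq F) hinv (reflCoeq Y)
  let : Localization.Lifting (reflCoeq Y) (reflW Y) (reflCoeq F) H := inferInstance
  let eH : reflCoeq Y ⋙ H ≅ reflCoeq F :=
    Localization.Lifting.iso (reflCoeq Y) (reflW Y) (reflCoeq F) H
  let : H.Monoidal := Localization.Monoidal.functorMonoidalOfComp (reflCoeq Y) (reflW Y) H
    (reflCoeq F)
  have heH : NatTrans.IsMonoidal eH.hom :=
    Localization.Monoidal.lifting_isMonoidal (reflCoeq Y) (reflW Y) H (reflCoeq F)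
  have hadd : H.Additive := additive_of_lift (reflCoeq Y) (exists_lift_pair Y) (reflCoeq F) H eH
  have hlin : H.Linear k := linear_of_lift (reflCoeq Y) (exists_lift_pair Y) (reflCoeq F) H eH k
  let e₁ : Y ⋙ H ≅ (Functor.const WalkingReflexivePair ⋙ reflCoeq Y) ⋙ H :=
    Functor.isoWhiskerRight (constReflCoeqIso Y).symm H
  let e : Y ⋙ H ≅ F := e₁ ≪≫ Functor.associator _ _ _ ≪≫
    Functor.isoWhiskerLeft (Functor.const WalkingReflexivePair) eH ≪≫ constReflCoeqIso F
  have h₀ := Functor.Monoidal.natTransIsMonoidal_of_transport (constReflCoeqIso Y)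
  have h₁ : NatTrans.IsMonoidal (constReflCoeqIso Y).symm.hom :=
    (inferInstance : NatTrans.IsMonoidal (constReflCoeqIso Y).inv)
  have h₂ : NatTrans.IsMonoidal e₁.hom := NatTrans.IsMonoidal.whiskerRight _
  have h₃ : NatTrans.IsMonoidal
      (Functor.isoWhiskerLeft (Functor.const WalkingReflexivePair) eH).hom :=
    NatTrans.IsMonoidal.whiskerLeft (F₁ := Functor.const WalkingReflexivePair) eH.hom
  have h₄ := constReflCoeqIso_isMonoidal F
  have he : NatTrans.IsMonoidal e.hom := inferInstanceAs (NatTrans.IsMonoidal (e₁.hom ≫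
    (Functor.associator (Functor.const WalkingReflexivePair) (reflCoeq Y) H).hom ≫
    (Functor.isoWhiskerLeft (Functor.const WalkingReflexivePair) eH).hom ≫
    (constReflCoeqIso F).hom))
  refine ⟨H, inferInstance, e, hadd, hlin, he, ?_⟩
  obtain ⟨S', S, f, g, zero, hS', hS, ⟨h⟩⟩ := hC
  have hg := (isCoker_of_isColimit zero h).epi
  have := monoidalPreadditive_of_reflCoeq Y
  have := preservesFiniteLimits_tensorRight_map Y S
  have := preservesFiniteColimits_tensorRight_map Y S
  have hg' : Epi (e.hom.app S ≫ F.map g ≫ η F) := by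
    have := hF g
    infer_instance
  have : (tensorRight (H.obj (Y.obj S))).Faithful :=
    faithful_tensorRight_of_epi (e.hom.app S ≫ F.map g ≫ η F) fun M => epi_whiskerLeft M _
  exact exact_of_projective H (tensorRight (Y.obj S)) (projective_tensor_map Y hS)
    (tensorRight (H.obj (Y.obj S)))
    (NatIso.ofComponents (fun M => (Functor.Monoidal.μIso H M (Y.obj S)).symm) fun f =>
      (δ_natural_left H f (Y.obj S)).symm)

end Extension

/-! ### The universal property -/

section NatTrans

variable {C : Type u₁} [Category.{v₁} C] [Preadditive C] [MonoidalCategory C]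
  {T : Type u₂} [Category.{v₂} T] [Abelian T] (Y : C ⥤ T) [Y.Additive] [Y.Full] [Y.Faithful]
  [hY : IsProjectiveRealization Y]
  {T' : Type u₃} [Category.{v₃} T'] [Abelian T'] {H₁ H₂ : T ⥤ T'} [H₁.Additive] [H₂.Additive]
  [PreservesFiniteColimits H₁]

include hY in
/-- A natural transformation on `T` with right exact source is determined by its restriction
along `Y`. -/
theorem natTrans_ext_of_realization {β β' : H₁ ⟶ H₂}
    (h : Functor.whiskerLeft Y β = Functor.whiskerLeft Y β') : β = β' := by
  ext M
  obtain ⟨S, p, hS, hp⟩ := hY.exists_epi M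
  rw [← cancel_epi (H₁.map p), β.naturality, β'.naturality]
  exact congrArg (fun a => NatTrans.app a S ≫ H₂.map p) h

/-- A natural transformation `Y ⋙ H₁ ⟶ Y ⋙ H₂` with `H₁` right exact extends to `T`: on `M` it is
induced by its value on a presentation of `M`, and it is natural since morphisms lift to
presentations. -/
theorem exists_natTrans_of_realization (α : Y ⋙ H₁ ⟶ Y ⋙ H₂) :
    ∃ β : H₁ ⟶ H₂, Functor.whiskerLeft Y β = α := by
  choose X₁ X₀ a p h₁ h₀ hp using exists_presentation Y
  have nat {A B : C} (f : A ⟶ B) : H₁.map (Y.map f) ≫ α.app B = α.app A ≫ H₂.map (Y.map f) :=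
    α.naturality f
  have hH (M : T) : IsCoker (H₁.map (Y.map (a M))) (H₁.map (p M)) := (hp M).map H₁
  have hdesc (M : T) := (hH M).exists_desc (α.app (X₀ M) ≫ H₂.map (p M)) (by
    have e := reassoc_of% (nat (a M))
    rw [e, ← H₂.map_comp, (hp M).zero, H₂.map_zero, comp_zero])
  choose b hb using hdesc
  have key {M N : T} (A : C) (q : Y.obj A ⟶ N) (f : A ⟶ X₀ N) (hf : Y.map f ≫ p N = q) :
      H₁.map q ≫ b N = α.app A ≫ H₂.map q := by
    have e := reassoc_of% (nat f)
    rw [← hf, H₁.map_comp, Category.assoc, hb, e, H₂.map_comp]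
  have lift {N : T} (A : C) (hA : globalSplitting C A) (q : Y.obj A ⟶ N) :
      ∃ f : A ⟶ X₀ N, Y.map f ≫ p N = q := by
    have := hY.projective hA
    have := (hp N).epi
    exact ⟨Y.preimage (Projective.factorThru q (p N)), by simp⟩
  refine ⟨{ app := b, naturality := fun M N η => ?_ }, ?_⟩
  · have := (hH M).epi
    obtain ⟨f, hf⟩ := lift (X₀ M) (h₀ M) (p M ≫ η)
    rw [← cancel_epi (H₁.map (p M)), ← Category.assoc, ← H₁.map_comp,
      key (M := M) _ _ f hf, reassoc_of% (hb M), H₂.map_comp]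
  · ext A
    have := (hH (Y.obj A)).epi
    have e : H₁.map (p (Y.obj A)) ≫ b (Y.obj A) = H₁.map (p (Y.obj A)) ≫ α.app A := by
      rw [hb, ← Y.map_preimage (p (Y.obj A)), nat]
    exact (cancel_epi _).1 e

open Functor.LaxMonoidal Functor.OplaxMonoidal

variable [MonoidalCategory T] [Y.Monoidal] [MonoidalCategory T'] [MonoidalPreadditive T']
  [HasDuals T'] [H₁.Monoidal] [H₂.Monoidal]

include hY in
/-- An extension of a monoidal transformation along `Y` is monoidal, as tensor products of
epimorphisms of `T'` are epimorphisms. -/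
theorem isMonoidal_of_realization (β : H₁ ⟶ H₂)
    (h : NatTrans.IsMonoidal (Functor.whiskerLeft Y β)) : NatTrans.IsMonoidal β := by
  refine ⟨?_, fun M N => ?_⟩
  · have e : (ε H₁ ≫ H₁.map (ε Y)) ≫ β.app (Y.obj (𝟙_ C)) = ε H₂ ≫ H₂.map (ε Y) := h.unit
    rw [Category.assoc, β.naturality, ← Category.assoc] at e
    exact (cancel_mono _).1 e
  · obtain ⟨A, p, -, hp⟩ := hY.exists_epi M
    obtain ⟨B, q, -, hq⟩ := hY.exists_epi N
    have e : (μ H₁ (Y.obj A) (Y.obj B) ≫ H₁.map (μ Y A B)) ≫ β.app (Y.obj (A ⊗ B)) =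
        (β.app (Y.obj A) ⊗ₘ β.app (Y.obj B)) ≫ μ H₂ (Y.obj A) (Y.obj B) ≫ H₂.map (μ Y A B) :=
      h.tensor A B
    rw [Category.assoc, β.naturality, ← Category.assoc, ← Category.assoc, cancel_mono] at e
    have : Epi (H₁.map p ⊗ₘ H₁.map q) := by
      have := epi_whiskerRight (H₁.obj (Y.obj B)) (H₁.map p)
      have := epi_whiskerLeft (H₁.obj M) (H₁.map q)
      rw [MonoidalCategory.tensorHom_def]
      infer_instance
    rw [← cancel_epi (H₁.map p ⊗ₘ H₁.map q), μ_natural_assoc, β.naturality, reassoc_of% e,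
      ← μ_natural, tensorHom_comp_tensorHom_assoc, tensorHom_comp_tensorHom_assoc, β.naturality,
      β.naturality]

end NatTrans

section Envelope

open Functor.LaxMonoidal Functor.OplaxMonoidal

variable {k : Type t} [Field k] {C : Type u₁} [Category.{v₁} C] [Preadditive C] [Linear k C]
  [MonoidalCategory C] [hC : IsPseudoTensorCategory.{w} k C]
  {T : Type u₂} [Category.{v₂} T] [Abelian T] [Linear k T] (Y : C ⥤ T) [Y.Additive] [Y.Linear k]
  [Y.Full] [Y.Faithful] [hY : IsProjectiveRealization Y]

/-- A projective realization of a pseudo-tensor category is a monoidal abelian envelope, for a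
suitable monoidal structure. -/
theorem exists_envelope (hpres : UnitHasSplittingPresentation C) :
    ∃ (_ : MonoidalCategory T) (F : TensorFunctor k C T), F.toFunctor = Y ∧
      IsMonoidalAbelianEnvelope.{w} F := by
  have := hC.monoidalPreadditive
  have := hC.monoidalLinear
  have := hC.hasFiniteBiproducts
  have := hC.isIdempotentComplete
  have := hasDuals_of_isPseudoTensorCategory.{w} k C
  obtain ⟨_, ⟨_⟩⟩ := exists_monoidalCategory Y
  let := monoidalOfReflCoeq Y
  have := monoidalPreadditive_of_reflCoeq Y
  have := monoidalLinear_of_reflCoeq Y k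
  have hT : IsTensorCategory.{w} k T := isTensorCategory_of_realization Y hpres k
  refine ⟨inferInstance, ⟨Y⟩, rfl, hT, inferInstance, inferInstance, fun T' _ _ _ _ hT' => ?_⟩
  have := hasDuals_of_realization Y hpres
  have := isDivisionUnit_of_isPseudoTensorCategory.{w} k (C := T)
  have := isDivisionUnit_of_isPseudoTensorCategory.{w} k (C := C)
  have := isDivisionUnit_of_isPseudoTensorCategory.{w} k (C := T')
  have := hasDuals_of_isPseudoTensorCategory.{w} k T'
  have := hT'.monoidalPreadditive
  let := abelianOfIsTensorCategory.{w} k T'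
  have hfaith (G : (TensorFunctor.exact k T T').FullSubcategory) :
      (Y ⋙ G.obj.toFunctor).Faithful := by
    have := G.property.1
    have := G.property.2
    have := faithful_of_exact G.obj.toFunctor
    infer_instance
  refine ⟨hfaith, ⟨⟨fun {G G' a b} h => ?_⟩, ⟨fun {G G'} α => ?_⟩, ⟨fun F => ?_⟩⟩⟩
  · have := G.property.2
    ext1
    apply TensorFunctor.Hom.ext
    exact natTrans_ext_of_realization Y (congrArg (fun c => c.hom.hom) h)
  · have := G.property.2
    obtain ⟨β, hβ⟩ := exists_natTrans_of_realization Y (H₁ := G.obj.toFunctor)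
      (H₂ := G'.obj.toFunctor) α.hom.hom
    have hβ' : NatTrans.IsMonoidal β := isMonoidal_of_realization Y β (hβ ▸ α.hom.isMonoidal)
    refine ⟨ObjectProperty.homMk ⟨β, hβ'⟩, ?_⟩
    ext1
    apply TensorFunctor.Hom.ext
    exact hβ
  · have hF : F.obj.toFunctor.Faithful := F.property
    obtain ⟨H, _, e, _, _, he, h₁, h₂⟩ := exists_extension Y F.obj.toFunctor hpres
      (fun {S} g _ => epi_of_ne_zero _ fun h => by
        have h' : F.obj.toFunctor.map g = F.obj.toFunctor.map 0 := by
          rw [← cancel_mono (η F.obj.toFunctor), h, Functor.map_zero, zero_comp]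
        refine IsDivisionUnit.id_ne_zero (C := C) ?_
        rw [← cancel_epi g, F.obj.toFunctor.map_injective h', zero_comp, zero_comp]) k
    have he' : NatTrans.IsMonoidal e.inv := inferInstance
    refine ⟨⟨⟨H⟩, h₁, h₂⟩, ⟨?_⟩⟩
    refine ObjectProperty.isoMk _ ⟨⟨e.hom, he⟩, ⟨e.inv, he'⟩, ?_, ?_⟩
    · exact TensorFunctor.Hom.ext e.hom_inv_id
    · exact TensorFunctor.Hom.ext e.inv_hom_id

end Envelope

/-! ### Subquotients of the image of a monoidal functor -/

section Mates

variable {T : Type u} [Category.{v} T] [MonoidalCategory T] [HasDuals T]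

theorem epi_rightAdjointMate {X Y : T} [HasRightDual X] [HasRightDual Y] (f : X ⟶ Y) [Mono f] :
    Epi (fᘁ) where
  left_cancellation {Z} s s' h := by
    have := mono_whiskerRight Z f
    have e (s : Xᘁ ⟶ Z) : (η_ X Xᘁ ≫ X ◁ s) ≫ f ▷ Z = η_ Y Yᘁ ≫ Y ◁ (fᘁ ≫ s) := by
      rw [Category.assoc, whisker_exchange, MonoidalCategory.whiskerLeft_comp,
        reassoc_of% (coevaluation_comp_rightAdjointMate f)]
    have e' : η_ X Xᘁ ≫ X ◁ s = η_ X Xᘁ ≫ X ◁ s' := by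
      rw [← cancel_mono (f ▷ Z), e, e, h]
    rw [← cancel_epi (ρ_ (Xᘁ)).hom]
    apply (tensorLeftHomEquiv (𝟙_ T) X Xᘁ Z).injective
    simpa [tensorLeftHomEquiv] using e'

theorem mono_rightAdjointMate {X Y : T} [HasRightDual X] [HasRightDual Y] (f : X ⟶ Y) [Epi f] :
    Mono (fᘁ) where
  right_cancellation {Z} s s' h := by
    have := epi_whiskerLeft Z f
    have e (s : Z ⟶ Yᘁ) : Z ◁ f ≫ s ▷ Y ≫ ε_ Y Yᘁ = (s ≫ fᘁ) ▷ X ≫ ε_ X Xᘁ := by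
      rw [whisker_exchange_assoc, comp_whiskerRight, Category.assoc,
        rightAdjointMate_comp_evaluation]
    have e' : s ▷ Y ≫ ε_ Y Yᘁ = s' ▷ Y ≫ ε_ Y Yᘁ := by
      rw [← cancel_epi (Z ◁ f), e, e, h]
    rw [← cancel_mono (λ_ (Yᘁ)).inv]
    apply (tensorRightHomEquiv Z Y Yᘁ (𝟙_ T)).symm.injective
    simpa [tensorRightHomEquiv, unitors_inv_equal] using e'

theorem epi_leftAdjointMate {X Y : T} [HasLeftDual X] [HasLeftDual Y] (f : X ⟶ Y) [Mono f] :
    Epi (ᘁf) where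
  left_cancellation {Z} s s' h := by
    have := mono_whiskerLeft Z f
    have e (s : (ᘁX) ⟶ Z) : (η_ (ᘁX) X ≫ s ▷ X) ≫ Z ◁ f = η_ (ᘁY) Y ≫ ((ᘁf) ≫ s) ▷ Y := by
      rw [Category.assoc, ← whisker_exchange, comp_whiskerRight,
        reassoc_of% (coevaluation_comp_leftAdjointMate f)]
    have e' : η_ (ᘁX) X ≫ s ▷ X = η_ (ᘁX) X ≫ s' ▷ X := by
      rw [← cancel_mono (Z ◁ f), e, e, h]
    rw [← cancel_epi (λ_ (ᘁX)).hom]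
    apply (tensorRightHomEquiv (𝟙_ T) (ᘁX) X Z).injective
    simpa [tensorRightHomEquiv] using e'

theorem mono_leftAdjointMate {X Y : T} [HasLeftDual X] [HasLeftDual Y] (f : X ⟶ Y) [Epi f] :
    Mono (ᘁf) where
  right_cancellation {Z} s s' h := by
    have := epi_whiskerRight Z f
    have e (s : Z ⟶ (ᘁY)) : f ▷ Z ≫ Y ◁ s ≫ ε_ (ᘁY) Y = X ◁ (s ≫ (ᘁf)) ≫ ε_ (ᘁX) X := by
      rw [← whisker_exchange_assoc, MonoidalCategory.whiskerLeft_comp, Category.assoc,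
        leftAdjointMate_comp_evaluation]
    have e' : Y ◁ s ≫ ε_ (ᘁY) Y = Y ◁ s' ≫ ε_ (ᘁY) Y := by
      rw [← cancel_epi (f ▷ Z), e, e, h]
    rw [← cancel_mono (ρ_ (ᘁY)).inv]
    apply (tensorLeftHomEquiv Z (ᘁY) Y (𝟙_ T)).symm.injective
    simpa [tensorLeftHomEquiv, unitors_equal] using e'

end Mates

section Subquotient

variable {C : Type u₁} [Category.{v₁} C] {T : Type u₂} [Category.{v₂} T]

/-- The subquotients of the objects in the image of `F`. -/
def subquotient (F : C ⥤ T) : ObjectProperty T :=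
  fun X => ∃ (A : C) (B : T) (i : B ⟶ F.obj A) (p : B ⟶ X), Mono i ∧ Epi p

variable (F : C ⥤ T)

theorem subquotient_map (A : C) : subquotient F (F.obj A) :=
  ⟨A, _, 𝟙 _, 𝟙 _, inferInstance, inferInstance⟩

variable {F}

theorem subquotient.of_epi {X X' : T} (f : X ⟶ X') [Epi f] (h : subquotient F X) :
    subquotient F X' := by
  obtain ⟨A, B, i, p, hi, hp⟩ := h
  exact ⟨A, B, i, p ≫ f, hi, inferInstance⟩

variable [Abelian T]

theorem subquotient.of_mono {X X' : T} (f : X' ⟶ X) [Mono f] (h : subquotient F X) :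
    subquotient F X' := by
  obtain ⟨A, B, i, p, hi, hp⟩ := h
  exact ⟨A, pullback p f, pullback.fst p f ≫ i, pullback.snd p f, inferInstance, inferInstance⟩

theorem subquotient.of_isZero [Nonempty C] {X : T} (hX : IsZero X) : subquotient F X := by
  have A := Classical.arbitrary C
  have : Mono (0 : X ⟶ F.obj A) := ⟨fun _ _ _ => hX.eq_of_tgt _ _⟩
  exact .of_mono (0 : X ⟶ F.obj A) (subquotient_map F A)

theorem subquotient.biprod [Preadditive C] [HasBinaryBiproducts C] [F.Additive] {X X' : T}
    (h : subquotient F X) (h' : subquotient F X') : subquotient F (X ⊞ X') := by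
  obtain ⟨A, B, i, p, hi, hp⟩ := h
  obtain ⟨A', B', i', p', hi', hp'⟩ := h'
  have := preservesBinaryBiproducts_of_preservesBiproducts F
  have : Mono (biprod.map i i') := inferInstance
  have : Epi (biprod.map p p') := inferInstance
  exact ⟨A ⊞ A', B ⊞ B', biprod.map i i' ≫ (F.mapBiprod A A').inv, biprod.map p p', inferInstance,
    inferInstance⟩

variable [MonoidalCategory C] [MonoidalCategory T] [F.Monoidal] [HasDuals T]

theorem subquotient.tensor {X X' : T} (h : subquotient F X) (h' : subquotient F X') :
    subquotient F (X ⊗ X') := by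
  obtain ⟨A, B, i, p, hi, hp⟩ := h
  obtain ⟨A', B', i', p', hi', hp'⟩ := h'
  have := mono_whiskerRight B' i
  have := mono_whiskerLeft (F.obj A) i'
  have := epi_whiskerRight B' p
  have := epi_whiskerLeft X p'
  refine ⟨A ⊗ A', B ⊗ B', (i ▷ B' ≫ F.obj A ◁ i') ≫ (Functor.Monoidal.μIso F A A').hom,
    p ▷ B' ≫ X ◁ p', inferInstance, inferInstance⟩

theorem subquotient.unit : subquotient F (𝟙_ T) :=
  .of_epi (Functor.Monoidal.εIso F).inv (subquotient_map F (𝟙_ C))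

variable [HasDuals C]

theorem subquotient.of_exactPairing_right {X X' : T} (e : ExactPairing X X')
    (h : subquotient F X) : subquotient F X' := by
  obtain ⟨A, B, i, p, hi, hp⟩ := h
  obtain ⟨A', ⟨_⟩⟩ := HasDuals.exists_right A
  obtain ⟨B', ⟨_⟩⟩ := HasDuals.exists_right B
  let : HasRightDual X := ⟨X'⟩
  let : HasRightDual B := ⟨B'⟩
  let : HasRightDual (F.obj A) := { rightDual := F.obj A', exact := mapExactPairing F A A' }
  have := epi_rightAdjointMate i
  have := mono_rightAdjointMate p
  exact .of_mono (pᘁ) (.of_epi (iᘁ) (subquotient_map F A'))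

theorem subquotient.of_exactPairing_left {X X' : T} (e : ExactPairing X' X)
    (h : subquotient F X) : subquotient F X' := by
  obtain ⟨A, B, i, p, hi, hp⟩ := h
  obtain ⟨A', ⟨_⟩⟩ := HasDuals.exists_left A
  obtain ⟨B', ⟨_⟩⟩ := HasDuals.exists_left B
  let : HasLeftDual X := ⟨X'⟩
  let : HasLeftDual B := ⟨B'⟩
  let : HasLeftDual (F.obj A) := { leftDual := F.obj A', exact := mapExactPairing F A' A }
  have := epi_leftAdjointMate i
  have := mono_leftAdjointMate p
  exact .of_mono (ᘁp) (.of_epi (ᘁi) (subquotient_map F A'))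

end Subquotient

section LiftMonoidal

open Functor.LaxMonoidal Functor.OplaxMonoidal Functor.Monoidal

variable {C : Type u₁} [Category.{v₁} C] [MonoidalCategory C] {T : Type u₂} [Category.{v₂} T]
  [MonoidalCategory T] (P : ObjectProperty T) [P.IsMonoidal] (F : C ⥤ T) [F.Monoidal]
  (hF : ∀ A, P (F.obj A))

/-- The monoidal structure on a functor factored through a monoidal full subcategory. -/
@[reducible]
noncomputable def liftMonoidal : (P.lift F hF).Monoidal :=
  Functor.CoreMonoidal.toMonoidal
    { εIso := P.isoMk (εIso F)
      μIso := fun X Y => P.isoMk (μIso F X Y)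
      μIso_hom_natural_left := fun f X' => by
        ext1
        exact μ_natural_left F f X'
      μIso_hom_natural_right := fun X' f => by
        ext1
        exact μ_natural_right F X' f
      associativity := fun X Y Z => by
        ext1
        exact associativity F X Y Z
      left_unitality := fun X => by
        ext1
        exact left_unitality F X
      right_unitality := fun X => by
        ext1
        exact right_unitality F X }

/-- The identification of `P.lift F hF ⋙ P.ι` with `F` is monoidal. -/
theorem liftMonoidal_comp_ι :
    letI := liftMonoidal P F hF
    NatTrans.IsMonoidal (F₁ := P.lift F hF ⋙ P.ι) (F₂ := F) { app := fun X => 𝟙 (F.obj X) } := by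
  let := liftMonoidal P F hF
  refine ⟨?_, fun X Y => ?_⟩
  · have e : (𝟙 _ ≫ ε F) ≫ 𝟙 (F.obj (𝟙_ C)) = ε F := by simp
    exact e
  · have e : (𝟙 _ ≫ μ F X Y) ≫ 𝟙 (F.obj (X ⊗ Y)) =
        (𝟙 (F.obj X) ⊗ₘ 𝟙 (F.obj Y)) ≫ μ F X Y := by simp
    exact e

end LiftMonoidal

/-- An exact pairing in a monoidal full subcategory. -/
@[reducible]
def fullSubcategoryExactPairing {T : Type u₂} [Category.{v₂} T] [MonoidalCategory T]
    (P : ObjectProperty T) [P.IsMonoidal] (X Y : P.FullSubcategory) [ExactPairing X.obj Y.obj] :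
    ExactPairing X Y :=
  ExactPairing.mk (ObjectProperty.homMk (η_ X.obj Y.obj)) (ObjectProperty.homMk (ε_ X.obj Y.obj))
    (by ext1; exact ExactPairing.coevaluation_evaluation X.obj Y.obj)
    (by ext1; exact ExactPairing.evaluation_coevaluation X.obj Y.obj)

section TensorCategory

variable {k : Type t} [Field k] {C : Type u₁} [Category.{v₁} C] [Preadditive C] [MonoidalCategory C]
  [HasBinaryBiproducts C] [HasDuals C]
  {T : Type u₂} [Category.{v₂} T] [Abelian T] [Linear k T] [MonoidalCategory T] [HasDuals T]
  [hT : IsTensorCategory.{w} k T]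
  (F : C ⥤ T) [F.Additive] [F.Monoidal]

instance subquotient_isMonoidal : (subquotient F).IsMonoidal where
  prop_unit := .unit
  prop_tensor _ _ h h' := h.tensor h'

instance : (subquotient F).ContainsZero where
  exists_zero := ⟨_, isZero_zero T, haveI : Nonempty C := ⟨𝟙_ C⟩; .of_isZero (isZero_zero T)⟩

instance : (subquotient F).IsClosedUnderKernels where
  kernels_le := by
    rintro _ ⟨f, c, hc, h₁, h₂⟩
    have := Fork.IsLimit.mono hc
    exact h₁.of_mono c.ι

instance : (subquotient F).IsClosedUnderCokernels where
  cokernels_le := by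
    rintro _ ⟨f, c, hc, h₁, h₂⟩
    have := Cofork.IsColimit.epi hc
    exact h₂.of_epi c.π

instance : (subquotient F).IsClosedUnderFiniteProducts :=
  haveI : Nonempty C := ⟨𝟙_ C⟩
  isClosedUnderFiniteProducts_of_biprod (fun e h => h.of_epi e.hom) .of_isZero .biprod

/-- The subquotients of the image of a monoidal functor to a tensor category form a tensor
category. -/
theorem isTensorCategory_subquotient : IsTensorCategory.{w} k (subquotient F).FullSubcategory := by
  have := hT.monoidalPreadditive
  have := hT.monoidalLinear
  have := hT.essentiallySmall
  have : EssentiallySmall.{w} (subquotient F).FullSubcategory :=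
    essentiallySmall_of_fully_faithful (subquotient F).ι
  have := Abelian.hasFiniteBiproducts (C := (subquotient F).FullSubcategory)
  let e : (𝟙_ (subquotient F).FullSubcategory ⟶ 𝟙_ _) ≃ₗ[k] (𝟙_ T ⟶ 𝟙_ T) :=
    LinearEquiv.ofBijective ((subquotient F).ι.mapLinearMap k)
      ⟨(subquotient F).ι.map_injective, (subquotient F).ι.map_surjective⟩
  exact
    { nonempty_hasLeftDual := fun X => by
        obtain ⟨X', ⟨e⟩⟩ := HasDuals.exists_left X.obj
        let X'' : (subquotient F).FullSubcategory := ⟨X', X.property.of_exactPairing_left e⟩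
        let : ExactPairing X''.obj X.obj := e
        exact ⟨{ leftDual := X'', exact := fullSubcategoryExactPairing _ X'' X }⟩
      nonempty_hasRightDual := fun X => by
        obtain ⟨X', ⟨e⟩⟩ := HasDuals.exists_right X.obj
        let X'' : (subquotient F).FullSubcategory := ⟨X', X.property.of_exactPairing_right e⟩
        let : ExactPairing X.obj X''.obj := e
        exact ⟨{ rightDual := X'', exact := fullSubcategoryExactPairing _ X X'' }⟩
      finrank_end_unit := by rw [e.finrank_eq, hT.finrank_end_unit] }

end TensorCategory

section Projective

variable {T : Type u₂} [Category.{v₂} T] [Abelian T] [MonoidalCategory T] [MonoidalPreadditive T]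
  [HasDuals T]

theorem projective_tensor_left {P : T} (hP : Projective P) (X : T) : Projective (X ⊗ P) := by
  obtain ⟨X', ⟨adj⟩⟩ := exists_tensorLeft_adj X
  exact adj.map_projective P hP

theorem projective_tensor_right {P : T} (hP : Projective P) (X : T) : Projective (P ⊗ X) := by
  obtain ⟨X', ⟨adj⟩⟩ := exists_tensorRight_adj X
  exact adj.map_projective P hP

/-- An exact functor with projective values sends all morphisms to split morphisms. -/
theorem isSplit_map_of_projective {T' : Type u₃} [Category.{v₃} T'] [Abelian T'] (G : T ⥤ T')
    [G.Additive] [PreservesFiniteLimits G] [PreservesFiniteColimits G]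
    (hG : ∀ M, Projective (G.obj M)) {X Y : T} (f : X ⟶ Y) : IsSplit (G.map f) := by
  obtain ⟨w, r, t, h⟩ := isSplitExact_map_of_projective
    (S := ShortComplex.mk (kernel.ι f) f (kernel.condition f))
    (ShortComplex.exact_of_f_is_kernel _ (kernelIsKernel f)) G hG
  refine ⟨t, ?_⟩
  have e := congrArg (· ≫ G.map f) h
  simpa [w] using e

/-- A projective object of a rigid abelian category is a global splitting object: all objects
`X ⊗ P` and `P ⊗ X` are projective. -/
theorem globalSplitting_of_projective {P : T} (hP : Projective P) : globalSplitting T P :=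
  fun _ _ f => ⟨isSplit_map_of_projective (tensorLeft P) (projective_tensor_right hP) f,
    isSplit_map_of_projective (tensorRight P) (projective_tensor_left hP) f⟩

/-- A projective object `P` of a rigid abelian category is injective: for a dual `P'` of `P`, the
monomorphism `i ⊗ P'` splits, and `P` is a retract of `P ⊗ P' ⊗ P`. -/
theorem exists_retraction_of_projective {P M : T} (hP : Projective P) (i : P ⟶ M) [Mono i] :
    ∃ r : M ⟶ P, i ≫ r = 𝟙 P := by
  obtain ⟨P', ⟨_⟩⟩ := HasDuals.exists_left P
  have hP' : globalSplitting T P' :=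
    globalSplitting.of_exactPairing_left (globalSplitting_of_projective hP)
  obtain ⟨s, hs⟩ := (hP' i).2
  have := mono_whiskerRight P' i
  have hs' : i ▷ P' ≫ s = 𝟙 _ := by
    rw [← cancel_mono (i ▷ P'), Category.assoc, hs, Category.id_comp]
  refine ⟨(ρ_ M).inv ≫ M ◁ η_ P' P ≫ (α_ _ _ _).inv ≫ s ▷ P ≫ ε_ P' P ▷ P ≫ (λ_ P).hom, ?_⟩
  rw [rightUnitor_inv_naturality_assoc, ← whisker_exchange_assoc,
    associator_inv_naturality_left_assoc, ← comp_whiskerRight_assoc, hs', id_whiskerRight,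
    Category.id_comp, ExactPairing.coevaluation_evaluation_assoc]
  simp

end Projective

/-! ### Envelopes with enough projectives -/

section Generation

variable {k : Type t} [Field k] {C : Type u₁} [Category.{v₁} C] [Preadditive C] [Linear k C]
  [MonoidalCategory C] [hC : IsPseudoTensorCategory.{w} k C]

/-- An isomorphism of tensor functors from a monoidal natural isomorphism. -/
def TensorFunctor.isoMk {T : Type u₂} [Category.{v₂} T] [Preadditive T] [Linear k T]
    [MonoidalCategory T] {F G : TensorFunctor k C T} (e : F.toFunctor ≅ G.toFunctor)
    (he : NatTrans.IsMonoidal e.hom) : F ≅ G where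
  hom := ⟨e.hom, he⟩
  inv := ⟨e.inv, inferInstance⟩
  hom_inv_id := TensorFunctor.Hom.ext e.hom_inv_id
  inv_hom_id := TensorFunctor.Hom.ext e.inv_hom_id

/-- In a monoidal abelian envelope, every object is a subquotient of an object of `C`: the
subquotients form a tensor category, over which the identity functor factors by the universal
property. -/
theorem subquotient_of_envelope {T : Type u₂} [Category.{v₂} T] [Preadditive T] [Linear k T]
    [MonoidalCategory T] (F : TensorFunctor k C T) (hF : IsMonoidalAbelianEnvelope.{w} F) (X : T) :
    subquotient F.toFunctor X := by
  have := hC.hasFiniteBiproducts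
  have := hasBinaryBiproducts_of_finite_biproducts C
  have := hasDuals_of_isPseudoTensorCategory.{w} k C
  have hT := hF.isTensorCategory
  have := hasDuals_of_isPseudoTensorCategory.{w} k T
  let := abelianOfIsTensorCategory.{w} k T
  have := hF.faithful
  let P := subquotient F.toFunctor
  have hT₁ : IsTensorCategory.{w} k P.FullSubcategory := isTensorCategory_subquotient F.toFunctor
  let F₀ : C ⥤ P.FullSubcategory := P.lift F.toFunctor (subquotient_map F.toFunctor)
  let : F₀.Monoidal := liftMonoidal P F.toFunctor _
  have : F₀.Additive := ⟨fun {X Y f g} => by ext1; exact F.toFunctor.map_add⟩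
  have : F₀.Linear k := ⟨fun {X Y} f r => by ext1; exact F.toFunctor.map_smul _ _⟩
  let F₁ : TensorFunctor k C P.FullSubcategory := ⟨F₀⟩
  obtain ⟨h₁, h₁'⟩ := hF.universal P.FullSubcategory
  obtain ⟨h₂, h₂'⟩ := hF.universal T
  have hF₁ : TensorFunctor.faithful k C P.FullSubcategory F₁ :=
    inferInstanceAs (P.lift F.toFunctor (subquotient_map F.toFunctor)).Faithful
  obtain ⟨G, ⟨e⟩⟩ := h₁'.essSurj.mem_essImage ⟨F₁, hF₁⟩
  have := G.property.1
  have := G.property.2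
  have : PreservesFiniteLimits P.ι := by
    have (X Y : P.FullSubcategory) (f : X ⟶ Y) : PreservesLimit (parallelPair f 0) P.ι :=
      P.preservesKernels_ι f
    exact P.ι.preservesFiniteLimits_of_preservesKernels
  have : PreservesFiniteColimits P.ι := by
    have (X Y : P.FullSubcategory) (f : X ⟶ Y) : PreservesColimit (parallelPair f 0) P.ι :=
      P.preservesCokernels_ι f
    exact P.ι.preservesFiniteColimits_of_preservesCokernels
  -- the composition of the extension `G` of `F₁` with the inclusion restricts to `F`, like the
  -- identity functor; so it is isomorphic to the latter
  let ι : TensorFunctor k P.FullSubcategory T := ⟨P.ι⟩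
  let G₁ : (TensorFunctor.exact k T T).FullSubcategory :=
    ⟨G.obj.comp ι, inferInstanceAs (PreservesFiniteLimits (G.obj.toFunctor ⋙ P.ι)),
      inferInstanceAs (PreservesFiniteColimits (G.obj.toFunctor ⋙ P.ι))⟩
  let G₂ : (TensorFunctor.exact k T T).FullSubcategory :=
    ⟨⟨𝟭 T⟩, inferInstanceAs (PreservesFiniteLimits (𝟭 T)),
      inferInstanceAs (PreservesFiniteColimits (𝟭 T))⟩
  let e₁ : F.comp G.obj ≅ F₁ := ((TensorFunctor.faithful k C P.FullSubcategory).ι.mapIso e)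
  let e₂ : F.toFunctor ⋙ G.obj.toFunctor ≅ F₀ :=
    ⟨e₁.hom.hom, e₁.inv.hom, congrArg (fun c => c.hom) e₁.hom_inv_id,
      congrArg (fun c => c.hom) e₁.inv_hom_id⟩
  let e₀ : F₀ ⋙ P.ι ≅ F.toFunctor := NatIso.ofComponents fun A => Iso.refl _
  let e₃ : F.toFunctor ⋙ G.obj.toFunctor ⋙ P.ι ≅ F.toFunctor ⋙ 𝟭 T :=
    (Functor.associator _ _ _).symm ≪≫ Functor.isoWhiskerRight e₂ P.ι ≪≫ e₀ ≪≫
      F.toFunctor.rightUnitor.symm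
  have he₀ : NatTrans.IsMonoidal e₀.hom := liftMonoidal_comp_ι P F.toFunctor _
  have he₂ : NatTrans.IsMonoidal e₂.hom := e₁.hom.isMonoidal
  have he₂' : NatTrans.IsMonoidal (Functor.whiskerRight e₂.hom P.ι) :=
    NatTrans.IsMonoidal.whiskerRight e₂.hom
  have he₃ : NatTrans.IsMonoidal e₃.hom := inferInstanceAs (NatTrans.IsMonoidal
    ((Functor.associator F.toFunctor G.obj.toFunctor P.ι).inv ≫ Functor.whiskerRight e₂.hom P.ι ≫
      e₀.hom ≫ F.toFunctor.rightUnitor.inv))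
  let e₄ : F.comp G₁.obj ≅ F.comp G₂.obj := TensorFunctor.isoMk e₃ he₃
  let e₅ := ((TensorFunctor.faithful k C T).lift _ h₂).preimageIso (X := G₁) (Y := G₂)
    (ObjectProperty.isoMk _ e₄)
  let e₆ : P.ι.obj (G.obj.toFunctor.obj X) ≅ X :=
    ⟨e₅.hom.hom.hom.app X, e₅.inv.hom.hom.app X,
      congrArg (fun c => c.hom.hom.app X) e₅.hom_inv_id,
      congrArg (fun c => c.hom.hom.app X) e₅.inv_hom_id⟩
  have : IsIso e₆.hom := e₆.isIso_hom
  have : Epi e₆.hom := IsIso.epi_of_iso e₆.hom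
  exact subquotient.of_epi e₆.hom (G.obj.toFunctor.obj X).property

end Generation

section Projective

open Functor.LaxMonoidal Functor.OplaxMonoidal Functor.Monoidal

variable {C : Type u₁} [Category.{v₁} C] [Preadditive C] [MonoidalCategory C]
  [IsIdempotentComplete C]
  {T : Type u₂} [Category.{v₂} T] [Abelian T] [MonoidalCategory T] [MonoidalPreadditive T]
  [HasDuals T] (F : C ⥤ T) [F.Additive] [F.Full] [F.Faithful] [F.Monoidal]

/-- Fully faithful monoidal functors reflect global splitting objects. -/
theorem globalSplitting_of_map {S : C} (h : globalSplitting T (F.obj S)) : globalSplitting C S := by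
  intro X Y f
  constructor
  · obtain ⟨g, hg⟩ := (h (F.map f)).1
    refine ⟨F.preimage (δ F S Y ≫ g ≫ μ F S X), F.map_injective ?_⟩
    have e : F.map (S ◁ f) = δ F S X ≫ F.obj S ◁ F.map f ≫ μ F S Y := by
      rw [δ_natural_right_assoc, δ_μ, Category.comp_id]
    simp only [F.map_comp, F.map_preimage, e, Category.assoc, μ_δ_assoc]
    rw [reassoc_of% hg]
  · obtain ⟨g, hg⟩ := (h (F.map f)).2
    refine ⟨F.preimage (δ F Y S ≫ g ≫ μ F X S), F.map_injective ?_⟩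
    have e : F.map (f ▷ S) = δ F X S ≫ F.map f ▷ F.obj S ≫ μ F Y S := by
      rw [δ_natural_left_assoc, δ_μ, Category.comp_id]
    simp only [F.map_comp, F.map_preimage, e, Category.assoc, μ_δ_assoc]
    rw [reassoc_of% hg]

/-- A projective object which is a subquotient of an object of `C` is a direct summand of it, and
it comes from a global splitting object of `C`. -/
theorem exists_iso_map_of_projective {P : T} (hP : Projective P) (h : subquotient F P) :
    ∃ S : C, globalSplitting C S ∧ Nonempty (F.obj S ≅ P) := by
  obtain ⟨A, B, i, p, hi, hp⟩ := h
  let s : P ⟶ B := Projective.factorThru (𝟙 P) p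
  have hs : s ≫ p = 𝟙 P := Projective.factorThru_comp _ _
  have : Mono s := mono_of_mono_fac hs
  obtain ⟨r, hr⟩ := exists_retraction_of_projective hP (s ≫ i)
  obtain ⟨S, a, b, hab, hba⟩ := IsIdempotentComplete.idempotents_split A
    (F.preimage (r ≫ s ≫ i)) (F.map_injective (by
      simp only [F.map_comp, F.map_preimage, Category.assoc]
      rw [← Category.assoc s, ← Category.assoc (s ≫ i), hr, Category.id_comp]))
  have hba' : F.map b ≫ F.map a = r ≫ s ≫ i := by rw [← F.map_comp, hba, F.map_preimage]
  have hab' : F.map a ≫ F.map b = 𝟙 _ := by rw [← F.map_comp, hab, F.map_id]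
  let e : F.obj S ≅ P :=
    { hom := F.map a ≫ r
      inv := (s ≫ i) ≫ F.map b
      hom_inv_id := by
        rw [Category.assoc, ← Category.assoc r, ← hba', Category.assoc, hab', Category.comp_id,
          hab']
      inv_hom_id := by
        rw [Category.assoc, reassoc_of% hba', ← Category.assoc s i, hr, Category.comp_id, hr] }
  refine ⟨S, globalSplitting_of_map F ?_, ⟨e⟩⟩
  exact (globalSplitting_of_projective hP).of_iso e

/-- The first two terms of a projective resolution of the unit come from global splitting objects
of `C`. -/
theorem unitHasSplittingPresentation_of_enoughProjectives [EnoughProjectives T]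
    (h : ∀ X : T, subquotient F X) : UnitHasSplittingPresentation C := by
  let p : Projective.over (𝟙_ T) ⟶ 𝟙_ T := Projective.π _
  let q : Projective.over (kernel p) ⟶ kernel p := Projective.π _
  obtain ⟨S₀, h₀, ⟨e₀⟩⟩ := exists_iso_map_of_projective F
    (Projective.projective_over (𝟙_ T)) (h _)
  obtain ⟨S₁, h₁, ⟨e₁⟩⟩ := exists_iso_map_of_projective F
    (Projective.projective_over (kernel p)) (h _)
  have hpq : IsCoker (q ≫ kernel.ι p) p := by
    have hk := isCoker_kernel_ι p
    refine ⟨by rw [Category.assoc, hk.zero, comp_zero], hk.epi, fun t ht => hk.exists_desc t ?_⟩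
    rw [← cancel_epi q, ← Category.assoc, ht, comp_zero]
  have hF := hpq.of_iso (f' := F.map (F.preimage (e₁.hom ≫ (q ≫ kernel.ι p) ≫ e₀.inv)))
    (g' := F.map (F.preimage (e₀.hom ≫ p ≫ ε F))) e₁.symm e₀.symm (εIso F) (by simp) (by simp)
  have hC := IsCoker.of_map F hF
  exact ⟨S₁, S₀, _, _, hC.zero, h₁, h₀, ⟨hC.isColimit⟩⟩

end Projective

/-! ### Existence of the envelope -/

section Existence

variable (k : Type t) [Field k] {C : Type u} [Category.{v} C] [Preadditive C] [Linear k C]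
  [MonoidalCategory C] [hk : IsPseudoTensorCategory.{w} k C]

/-- The category of finitely presented functors on the global splitting objects is a monoidal
abelian envelope with enough projectives. -/
theorem exists_envelope_modCat (hC : UnitHasSplittingPresentation C) :
    ∃ (h : ∀ A : C, finitelyPresented (globalSplitting C).FullSubcategory
        ((restrictedYoneda (globalSplitting C)).obj A))
      (_ : MonoidalCategory (ModCat (globalSplitting C).FullSubcategory))
      (F : TensorFunctor k C (ModCat (globalSplitting C).FullSubcategory)),
      F.toFunctor = (finitelyPresented (globalSplitting C).FullSubcategory).lift
        (restrictedYoneda (globalSplitting C)) h ∧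
      IsMonoidalAbelianEnvelope.{w} F ∧
      EnoughProjectives (ModCat (globalSplitting C).FullSubcategory) := by
  have := hk.monoidalPreadditive
  have := hk.monoidalLinear
  have := hk.hasFiniteBiproducts
  have := hk.isIdempotentComplete
  have := hasDuals_of_isPseudoTensorCategory.{w} k C
  have h := finitelyPresented_restrictedYoneda hC
  let := abelianModCatGlobalSplitting hC
  have := full_restrictedYoneda_globalSplitting hC
  have := faithful_restrictedYoneda_globalSplitting hC
  let Y := (finitelyPresented (globalSplitting C).FullSubcategory).lift
    (restrictedYoneda (globalSplitting C)) h
  have : Y.Additive := ⟨fun {_ _ f g} => by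
    ext1
    exact (restrictedYoneda (globalSplitting C)).map_add (f := f) (g := g)⟩
  have : Y.Linear k := linear_lift_restrictedYoneda _ h
  have : IsProjectiveRealization Y := isProjectiveRealization_restrictedYoneda hC h
  obtain ⟨hm, F, hF, hF'⟩ := exists_envelope.{w} (k := k) Y hC
  exact ⟨h, hm, F, hF, hF', IsProjectiveRealization.enoughProjectives Y⟩

variable {k}

theorem unitHasSplittingPresentation_of_envelope {T : Type u₂} [Category.{v₂} T] [Preadditive T]
    [Linear k T] [MonoidalCategory T] (F : TensorFunctor k C T)
    (hF : IsMonoidalAbelianEnvelope.{w} F) [EnoughProjectives T] :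
    UnitHasSplittingPresentation C := by
  have := hk.isIdempotentComplete
  have := hk.monoidalPreadditive
  have := hasDuals_of_isPseudoTensorCategory.{w} k C
  have := hF.isTensorCategory
  have := hF.isTensorCategory.monoidalPreadditive
  have := hasDuals_of_isPseudoTensorCategory.{w} k T
  let := abelianOfIsTensorCategory.{w} k T
  have := hF.full
  have := hF.faithful
  exact unitHasSplittingPresentation_of_enoughProjectives F.toFunctor (subquotient_of_envelope F hF)

theorem morU_eq_morUex_of_envelope {T : Type u₂} [Category.{v₂} T] [Preadditive T]
    [Linear k T] [MonoidalCategory T] (F : TensorFunctor k C T)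
    (hF : IsMonoidalAbelianEnvelope.{w} F) : morU C = morUex C := by
  have := hF.isTensorCategory
  have := hF.isTensorCategory.monoidalPreadditive
  have := hasDuals_of_isPseudoTensorCategory.{w} k T
  have := isDivisionUnit_of_isPseudoTensorCategory.{w} k (C := T)
  let := abelianOfIsTensorCategory.{w} k T
  have := hF.full
  have := hF.faithful
  exact morU_eq_morUex F.toFunctor

end Existence

end AbEnv

theorem mainTheorem2 {k : Type t} [Field k] {C : Type u} [Category.{v} C] [Preadditive C]
    [Linear k C] [MonoidalCategory C] [AbEnv.IsPseudoTensorCategory.{v} k C] :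
    List.TFAE [
      -- (a) there is a monoidal abelian envelope with enough projectives
      ∃ (T : Type (max u (v + 1))) (_ : Category.{max u v} T) (_ : Preadditive T) (_ : Linear k T)
        (_ : MonoidalCategory T) (F : AbEnv.TensorFunctor k C T),
        AbEnv.IsMonoidalAbelianEnvelope.{v} F ∧ EnoughProjectives T,
      -- (b) the unit has a presentation by global splitting objects
      AbEnv.UnitHasSplittingPresentation C,
      -- (c) there is a nonzero global splitting object, and every nonzero morphism to the unit
      -- satisfies the exactness condition
      (∃ S : C, AbEnv.globalSplitting C S ∧ ¬ IsZero S) ∧ AbEnv.morU C = AbEnv.morUex C] ∧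
    -- in this case, the envelope is given by finitely presented functors
    (AbEnv.UnitHasSplittingPresentation C →
      ∃ (h : ∀ A : C, AbEnv.finitelyPresented (AbEnv.globalSplitting C).FullSubcategory
          ((AbEnv.restrictedYoneda (AbEnv.globalSplitting C)).obj A))
        (_ : MonoidalCategory (AbEnv.ModCat (AbEnv.globalSplitting C).FullSubcategory))
        (F : AbEnv.TensorFunctor k C (AbEnv.ModCat (AbEnv.globalSplitting C).FullSubcategory)),
        F.toFunctor = (AbEnv.finitelyPresented (AbEnv.globalSplitting C).FullSubcategory).lift
          (AbEnv.restrictedYoneda (AbEnv.globalSplitting C)) h ∧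
        AbEnv.IsMonoidalAbelianEnvelope.{v} F ∧
        EnoughProjectives (AbEnv.ModCat (AbEnv.globalSplitting C).FullSubcategory)) := by
  have hC : AbEnv.IsPseudoTensorCategory.{v} k C := inferInstance
  have := hC.monoidalPreadditive
  have := AbEnv.hasDuals_of_isPseudoTensorCategory.{v} k C
  have := AbEnv.isDivisionUnit_of_isPseudoTensorCategory.{v} k (C := C)
  refine ⟨?_, AbEnv.exists_envelope_modCat k⟩
  tfae_have 1 → 2 := by
    rintro ⟨T, _, _, _, _, F, hF, _⟩
    exact AbEnv.unitHasSplittingPresentation_of_envelope F hF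
  tfae_have 2 → 1 := by
    intro h
    obtain ⟨_, _, F, -, hF, hT⟩ := AbEnv.exists_envelope_modCat k h
    exact ⟨_, _, _, _, _, F, hF, hT⟩
  tfae_have 2 → 3 := by
    intro h
    obtain ⟨_, _, F, -, hF, -⟩ := AbEnv.exists_envelope_modCat k h
    exact ⟨AbEnv.exists_not_isZero h, AbEnv.morU_eq_morUex_of_envelope F hF⟩
  tfae_have 3 → 2 := fun h => AbEnv.unitHasSplittingPresentation h.1 h.2
  tfae_finish
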